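/- Let $n\ge 1$. A (hypersurface type) almost CR structure of CR dimension $n$ on a smooth real manifold $M$ of dimension $2n+1$ consists of a smooth subbundle $H\subset TM$ of rank $2n$ and a smooth bundle automorphism $J\colon H\to H$ with $J^2=-\mathrm{id}$. Put $H^{1,0}=\{\xi\in\mathbb C\otimes H: J\xi=i\xi\}$, and let $\pi_p\colon \mathbb C\otimes T_pM\to (\mathbb C\otimes T_pM)/(\mathbb C\otimes H_p)$ be the projection. The Levi form $\mathcal L_p$ and the transversal component $\mathcal N^w_p$ of the non-integrability tensor are the forms on $H^{1,0}_p\times H^{1,0}_p$ given by $$\mathcal L_p(X_p,Y_p)=\tfrac1{2i}\,\pi_p([\overline X,Y]_p),\qquad \mathcal N^w_p(X_p,Y_p)=\pi_p([X,Y]_p)$$ for local smooth sections $X,Y$ of $H^{1,0}$ near $p$. The structure is strongly nondegenerate if at every point $p$ both $\mathcal L_p$ and $6i\mathcal L_p+\mathcal N^w_p$ are nondegenerate, i.e. $\mathcal L_p(\xi,\cdot)=0$ implies $\xi=0$, and $6i\mathcal L_p(\xi,\cdot)+\mathcal N^w_p(\xi,\cdot)=0$ implies $\xi=0$. Let $M$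 and $M'$ be smooth (Hausdorff) manifolds of the same dimension $2n+1$ with smooth strongly nondegenerate hypersurface type almost CR structures $(H,J)$ and $(H',J')$. Let $U\subset M$ be a connected open set, and let $f,g\colon U\to M'$ be smooth CR-diffeomorphisms onto open subsets of $M'$, that is, diffeomorphisms onto their (open) images whose differentials map $H$ onto $H'$ and intertwine $J$ with $J'$. If $p\in U$ and the $2$-jets of $f$ and $g$ at $p$ coincide, $j^2_pf=j^2_pg$, then $f= g$ on $U$. -/

import Mathlib

open scoped Manifold ContDiff TensorProduct

noncomputable section

namespace AlmostCR

section Complexification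

variable (V : Type*) [AddCommGroup V] [Module ℝ V]

/-- The real part `ℂ ⊗ V → V` of a vector of the complexification, `c ⊗ v ↦ (re c) v`. -/
def rePart : ℂ ⊗[ℝ] V →ₗ[ℝ] V :=
  (TensorProduct.lid ℝ V).toLinearMap ∘ₗ LinearMap.rTensor V Complex.reLm

/-- The imaginary part `ℂ ⊗ V → V` of a vector of the complexification, `c ⊗ v ↦ (im c) v`. -/
def imPart : ℂ ⊗[ℝ] V →ₗ[ℝ] V :=
  (TensorProduct.lid ℝ V).toLinearMap ∘ₗ LinearMap.rTensor V Complex.imLm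

variable {V}

/-- The vector `a + i b` of the complexification of `V`. -/
def mkComplex (a b : V) : ℂ ⊗[ℝ] V :=
  (1 : ℂ) ⊗ₜ[ℝ] a + Complex.I ⊗ₜ[ℝ] b

/-- Complex conjugation `a + i b ↦ a - i b` on the complexification. -/
def conjVec (ξ : ℂ ⊗[ℝ] V) : ℂ ⊗[ℝ] V :=
  mkComplex (rePart V ξ) (-imPart V ξ)

end Complexification

/-- The model with corners of smooth manifolds (without boundary) of real dimension `2 n + 1`. -/
abbrev Model (n : ℕ) :
    ModelWithCorners ℝ (EuclideanSpace ℝ (Fin (2 * n + 1))) (EuclideanSpace ℝ (Fin (2 * n + 1))) :=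
  𝓡 (2 * n + 1)

variable {n : ℕ}
  {M : Type*} [TopologicalSpace M] [ChartedSpace (EuclideanSpace ℝ (Fin (2 * n + 1))) M]
  {M' : Type*} [TopologicalSpace M'] [ChartedSpace (EuclideanSpace ℝ (Fin (2 * n + 1))) M']

/-- The real vector field `X` is smooth on the set `U`. -/
def SmoothFieldOn [IsManifold (Model n) ∞ M] (X : ∀ q : M, TangentSpace (Model n) q)
    (U : Set M) : Prop :=
  ContMDiffOn (Model n) (Model n).tangent ∞
    (fun q => (⟨q, X q⟩ : TangentBundle (Model n) M)) U

variable (n M) in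
/-- A smooth almost CR structure of hypersurface type on a manifold `M` of dimension `2 n + 1`:
a smooth subbundle `H` of corank one of the tangent bundle, together with a smooth bundle
automorphism `J` of `H` with `J ^ 2 = -1`. The number `n` is the CR dimension.

Smoothness of `H` says that near every point there is a frame of `H` by smooth vector fields
`e j`, and smoothness of `J` that the fields `J (e j)` are smooth too. (The values of `e` away
from the neighbourhood `U` of the point play no role.) -/
structure Structure [IsManifold (Model n) ∞ M] where
  /-- the fibre `H_p`, a subspace of the tangent space `T_p M` -/
  H : ∀ p : M, Submodule ℝ (TangentSpace (Model n) p)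
  /-- the complex structure on the fibre `H_p` -/
  J : ∀ p : M, H p →ₗ[ℝ] H p
  J_sq : ∀ (p : M) (v : H p), J p (J p v) = -v
  exists_frame : ∀ p : M, ∃ U : Set M, IsOpen U ∧ p ∈ U ∧
    ∃ e : ∀ q : M, Module.Basis (Fin (2 * n)) ℝ (H q),
      ∀ j, SmoothFieldOn (fun q => (e q j : TangentSpace (Model n) q)) U ∧
        SmoothFieldOn (fun q => (J q (e q j) : TangentSpace (Model n) q)) U

section ComplexFields

/-- The complexified tangent space `ℂ T_p M = ℂ ⊗ T_p M`. -/
abbrev CTangent (n : ℕ) {M : Type*} [TopologicalSpace M]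
    [ChartedSpace (EuclideanSpace ℝ (Fin (2 * n + 1))) M] (p : M) : Type :=
  ℂ ⊗[ℝ] (TangentSpace (Model n) p)

/-- The Lie bracket at `p` of complex vector fields: the complex-bilinear extension
`[A + iB, C + iD] = ([A, C] - [B, D]) + i ([A, D] + [B, C])` of the bracket of real ones. -/
def cBracket (Z W : ∀ q : M, CTangent n q) (p : M) : CTangent n p :=
  mkComplex
    (VectorField.mlieBracket (Model n) (fun q => rePart _ (Z q)) (fun q => rePart _ (W q)) p
      - VectorField.mlieBracket (Model n) (fun q => imPart _ (Z q)) (fun q => imPart _ (W q)) p)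
    (VectorField.mlieBracket (Model n) (fun q => rePart _ (Z q)) (fun q => imPart _ (W q)) p
      + VectorField.mlieBracket (Model n) (fun q => imPart _ (Z q)) (fun q => rePart _ (W q)) p)

end ComplexFields

namespace Structure

variable [IsManifold (Model n) ∞ M] [IsManifold (Model n) ∞ M']

/-- The space `H^{1,0}_p = {ξ ∈ ℂ ⊗ H_p : J ξ = i ξ}`, as a complex subspace of `ℂ T_p M`. -/
def H10 (S : Structure n M) (p : M) : Submodule ℂ (CTangent n p) :=
  (Module.End.eigenspace ((S.J p).baseChange ℂ) Complex.I).map ((S.H p).subtype.baseChange ℂ)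

/-- `Z` is a smooth section of `H^{1,0}` on some neighbourhood of `p`. -/
def IsLocalSection (S : Structure n M) (Z : ∀ q : M, CTangent n q) (p : M) : Prop :=
  ∃ U : Set M, IsOpen U ∧ p ∈ U ∧
    SmoothFieldOn (fun q => rePart _ (Z q)) U ∧ SmoothFieldOn (fun q => imPart _ (Z q)) U ∧
    ∀ q ∈ U, Z q ∈ S.H10 q

/-- The canonical projection `π_p : ℂ T_p M → ℂ T_p M / ℂ H_p`, where the quotient is
`ℂ ⊗ (T_p M / H_p)`. -/
def proj (S : Structure n M) (p : M) :
    CTangent n p →ₗ[ℂ] ℂ ⊗[ℝ] (TangentSpace (Model n) p ⧸ S.H p) :=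
  (S.H p).mkQ.baseChange ℂ

/-- The Levi form `𝓛_p (X_p, Y_p) = (1 / 2i) π_p ([conj X, Y]_p)`, written through local sections
`X`, `Y` of `H^{1,0}`; it depends on the values of `X` and `Y` at `p` only. -/
def levi (S : Structure n M) (p : M) (X Y : ∀ q : M, CTangent n q) :
    ℂ ⊗[ℝ] (TangentSpace (Model n) p ⧸ S.H p) :=
  (1 / (2 * Complex.I)) • S.proj p (cBracket (fun q => conjVec (X q)) Y p)

/-- The transversal component `𝓝^w_p (X_p, Y_p) = π_p ([X, Y]_p)` of the non-integrability tensor,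
written through local sections `X`, `Y` of `H^{1,0}`; it depends on the values of `X` and `Y`
at `p` only. -/
def nijenhuis (S : Structure n M) (p : M) (X Y : ∀ q : M, CTangent n q) :
    ℂ ⊗[ℝ] (TangentSpace (Model n) p ⧸ S.H p) :=
  S.proj p (cBracket X Y p)

/-- The Levi form is nondegenerate at `p`. -/
def LeviNondegenerateAt (S : Structure n M) (p : M) : Prop :=
  ∀ X, S.IsLocalSection X p →
    (∀ Y, S.IsLocalSection Y p → S.levi p X Y = 0) → X p = 0

/-- The form `6 i 𝓛 + 𝓝^w` is nondegenerate (in its first argument) at `p`. -/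
def CombinationNondegenerateAt (S : Structure n M) (p : M) : Prop :=
  ∀ X, S.IsLocalSection X p →
    (∀ Y, S.IsLocalSection Y p →
      (6 * Complex.I) • S.levi p X Y + S.nijenhuis p X Y = 0) → X p = 0

/-- Strong nondegeneracy, at every point. -/
def StronglyNondegenerate (S : Structure n M) : Prop :=
  ∀ p : M, S.LeviNondegenerateAt p ∧ S.CombinationNondegenerateAt p

end Structure

section Maps

variable [IsManifold (Model n) ∞ M] [IsManifold (Model n) ∞ M']

/-- `f` restricts to a smooth CR-diffeomorphism of the open set `U` of `M` onto an open set of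
`M'`: a diffeomorphism whose differential maps `H` onto `H'` and intertwines `J` with `J'`.
(The values of `f` outside `U` play no role.) -/
structure IsCRDiffeoOn (S : Structure n M) (S' : Structure n M') (f : M → M') (U : Set M) :
    Prop where
  isOpen_source : IsOpen U
  isOpen_image : IsOpen (f '' U)
  smooth : ContMDiffOn (Model n) (Model n) ∞ f U
  exists_inverse : ∃ h : M' → M,
    ContMDiffOn (Model n) (Model n) ∞ h (f '' U) ∧ Set.LeftInvOn h f U
  map_H : ∀ q ∈ U, (S.H q).map (mfderiv (Model n) (Model n) f q).toLinearMap = S'.H (f q)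
  map_J : ∀ q ∈ U, ∀ (v : S.H q) (w : S'.H (f q)),
    mfderiv (Model n) (Model n) f q v = w →
      mfderiv (Model n) (Model n) f q (S.J q v) = S'.J (f q) w

variable (n) in
/-- `j^k_p f = j^k_p g`: the maps have the same value at `p`, and in the charts at `p` and at
`f p = g p` they have the same derivatives up to order `k` at `p`. -/
def SameJet (k : ℕ) (f g : M → M') (p : M) : Prop :=
  f p = g p ∧ ∀ m ≤ k,
    iteratedFDeriv ℝ m (writtenInExtChartAt (Model n) (Model n) p f)
        (extChartAt (Model n) p p) =
      iteratedFDeriv ℝ m (writtenInExtChartAt (Model n) (Model n) p g)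
        (extChartAt (Model n) p p)

end Maps

end AlmostCR

end

/-! Near a point the claim concerns φ = K ∘ f, where K is a local inverse of g and everything is
written in charts: φ preserves one almost CR structure, has the 2-jet of the identity at x₀, and
must be the identity. Complete a frame of H by a constant transversal field t and work in the ring
of germs of smooth functions at x₀. The deviation of φ from the identity is encoded by the germs φˢ
− xˢ and by the matrix G of dφ in the frame; b denotes the H-part of the image of t, and λ its
transversal part.

Suppose a finitely generated ideal contains all φˢ − xˢ, vanishes at x₀ and is stable under the
frame derivations. Its generators then solve a homogeneous linear system du = μu with u(x₀) = 0, so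
they vanish by Gronwall (`eq_zero_of_mem_stable_ideal`) and φ = id near x₀. The heart of the proof
is to produce such an ideal (`CRFrameData.exists_stable_ideal`).

Differentiating the structure equations gives congruences for the derivatives of G. By Nakayama
(`subset_ideal_of_functionals`) only the values of their coefficients at x₀ matter, and what remains
is linear algebra on H at x₀ with J and Ω(X, Y) = θ([X, Y]), where θ is the contact form. The
J-invariant part of Ω is the Levi form, the anti-invariant part is the form 𝓝^w. The first
prolongation of (J, Ω) vanishes. If Ω is not J-invariant at x₀, the torsion equation kills b as
well, and the first order deviations form a closed system (`I0_stable`). If Ω is J-invariant at x₀,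
the second prolongation leaves a single scalar, the transversal derivative of λ, and the third
prolongation is zero (`I2_stable`). That scalar vanishes at x₀ because of the second derivatives of
φ; nothing else in the 2-jet beyond order one is needed.

Globally, the set of points near which f = g is open, and it is closed in U because equality of
2-jets passes to limits. Connectedness of U concludes. -/

/-! ### Linear algebra of the prolongations of (J, Ω). -/

section LinearAlgebra

variable {H : Type*} [AddCommGroup H] [Module ℝ H]

/-- A symmetric bilinear map, complex linear in its second argument, with values in the
infinitesimal symmetries of a skew form with nondegenerate `J`-invariant part, vanishes. -/
theorem eq_zero_of_symmetric_of_skew {J : H →ₗ[ℝ] H} {Ω : H →ₗ[ℝ] H →ₗ[ℝ] ℝ} {A : H → H → H}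
    (hJ : ∀ x, J (J x) = -x) (hω : ∀ x y, Ω x y = -Ω y x)
    (hnd : ∀ x, (∀ y, Ω x y + Ω (J x) (J y) = 0) → x = 0)
    (hA : ∀ x y, A x y = A y x) (hAJ : ∀ x y, A x (J y) = J (A x y))
    (hAω : ∀ z x y, Ω (A z x) y + Ω x (A z y) = 0) (z x : H) : A z x = 0 := by
  -- Up to a factor 2, `h z x y` pairs `A z x` with `y` by the J-invariant part of Ω. It is totally
  -- symmetric, so J moves between slots without a sign; but J-invariance of the pairing moves it
  -- between the last two slots with a minus sign. Hence `h = 0`.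
  let h : H → H → H → ℝ := fun z x y => Ω (A z x) y + Ω (J (A z x)) (J y)
  have h12 : ∀ z x y, h z x y = h x z y := fun z x y => by simp only [h, hA z x]
  have h23 : ∀ z x y, h z x y = h z y x := fun z x y => by
    have h1 := hAω z x y
    have h2 := hAω z (J x) (J y)
    simp only [hAJ] at h2
    simp only [h]
    linarith [hω x (A z y), hω (J x) (J (A z y))]
  have hJ2 : ∀ z x y, h z (J x) y = - h z x (J y) := fun z x y => by
    simp only [h, hAJ, hJ, map_neg, LinearMap.neg_apply]
    ring
  have hJ1 : ∀ z x y, h (J z) x y = h z (J x) y := fun z x y => by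
    simp only [h, hA (J z) x, hAJ, hA z x]
  have hz : ∀ z x y, h z x (J y) = 0 := fun z x y => by
    have : h z x (J y) = h z (J x) y := by
      rw [h23, h12, hJ1, h12, h23, hJ1]
    linarith [hJ2 z x y]
  refine hnd _ fun y => ?_
  have := hz z x (J y)
  simp only [h, hJ, map_neg] at this
  linarith

/-- If the torsion of a bilinear map that is complex linear in its second argument is `Ω ⊗ b`,
and `Ω` is not `J`-invariant, then `b = 0`. -/
theorem eq_zero_of_torsion {J : H →ₗ[ℝ] H} {Ω : H →ₗ[ℝ] H →ₗ[ℝ] ℝ} {A : H → H → H} {b : H}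
    (hJ : ∀ x, J (J x) = -x) (hA : ∀ x y, A x y - A y x = Ω x y • b) (hAJ : ∀ x y, A x (J y) = J (A x y))
    {x y : H} (hxy : Ω x y ≠ Ω (J x) (J y)) : b = 0 := by
  have h1 := hA x y
  have h2 := hA (J x) (J y)
  have h3 := hA (J x) y
  have h4 := hA x (J y)
  simp only [hAJ] at h2 h3 h4
  have h5 := congrArg J h3
  have h6 := congrArg J h4
  simp only [map_sub, hJ, map_smul] at h5 h6
  -- In this combination of the torsion identities at (x, y), (Jx, Jy), (Jx, y), (x, Jy) all values
  -- of `A` cancel. What is left is (s + tJ) b = 0, and s + tJ is invertible because s ≠ 0.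
  have e1 : (Ω x y - Ω (J x) (J y)) • b + (Ω (J x) y + Ω x (J y)) • J b = 0 := by
    rw [sub_smul, add_smul, ← h1, ← h2, ← h5, ← h6]; abel
  have e2 := congrArg J e1
  simp only [map_add, map_smul, hJ, map_zero] at e2
  set s := Ω x y - Ω (J x) (J y) with hs
  set t := Ω (J x) y + Ω x (J y)
  have e3 : (s ^ 2 + t ^ 2) • b = 0 := by
    have : s • (s • b + t • J b) - t • (s • J b + t • -b) = 0 := by rw [e1, e2]; simp
    rw [← this]; module
  have : s ≠ 0 := sub_ne_zero.2 hxy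
  exact (smul_eq_zero.1 e3).resolve_left (by positivity)

/-- The second prolongation of a nondegenerate Hermitian symbol is one-dimensional. -/
theorem eq_half_smul_of_prolongation {J : H →ₗ[ℝ] H} {Ω : H →ₗ[ℝ] H →ₗ[ℝ] ℝ} {A : H → H → H → H}
    {B : H →ₗ[ℝ] H} {c : ℝ}
    (hJ : ∀ x, J (J x) = -x) (hω : ∀ x y, Ω x y = -Ω y x)
    (hωJ : ∀ x y, Ω (J x) (J y) = Ω x y) (hnd : ∀ x, (∀ y, Ω x y = 0) → x = 0)
    (hA : ∀ k i j, A k i j - A k j i = Ω i j • B k)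
    (hAω : ∀ k z x y, Ω (A k z x) y + Ω x (A k z y) + Ω x y * Ω z (B k) = 0)
    (hAJ : ∀ k x y, A k x (J y) = J (A k x y))
    (hAB : ∀ k l i, A k l i - A l k i = Ω k l • B i)
    (hc : ∀ k l, Ω k (B l) - Ω l (B k) = Ω k l * c) (k : H) : B k = (c / 2) • k := by
  have hωJ' : ∀ x y, Ω (J x) y = - Ω x (J y) := fun x y => by
    rw [← hωJ x (J y), hJ, map_neg, neg_neg]
  rcases subsingleton_or_nontrivial H with hH | hH
  · exact Subsingleton.elim _ _
  obtain ⟨v, hv⟩ := exists_ne (0 : H)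
  obtain ⟨w, hvw⟩ : ∃ w, Ω v w ≠ 0 := by
    by_contra! hcon
    exact hv (hnd v hcon)
  have hBJ : ∀ i, B (J i) = J (B i) := fun i => by
    have h1 := hAB v w (J i)
    rw [hAJ, hAJ, ← map_sub, hAB, map_smul] at h1
    exact (smul_right_injective H hvw h1).symm
  -- A Koszul-type formula: torsion (`e1`), skewness (`e2`) and J-linearity (`e3`), used at rotated
  -- arguments, determine `A m` from `B m`.
  have formula : ∀ m z x y, 2 * Ω (A m z x) y = Ω z x * Ω (B m) y - Ω (J z) x * Ω (B m) (J y)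
      + Ω (B m) z * Ω x y + Ω z (J y) * Ω (B m) (J x) + Ω z y * Ω (B m) x
      + Ω (B m) (J z) * Ω x (J y) := by
    intro m z x y
    have e1 : ∀ z x y, Ω (A m z x) y = Ω (A m x z) y + Ω z x * Ω (B m) y := fun z x y => by
      have := congrArg (fun u => Ω u y) (hA m z x)
      simp only [map_sub, map_smul, LinearMap.sub_apply, LinearMap.smul_apply, smul_eq_mul] at this
      linarith
    have e2 : ∀ z x y, Ω (A m z x) y = Ω (A m z y) x + Ω (B m) z * Ω x y := fun z x y => by
      have := hAω m z x y
      rw [hω z, hω x (A m z y)] at this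
      linarith
    have e3 : ∀ z x y, Ω (A m z (J x)) y = - Ω (A m z x) (J y) := fun z x y => by
      rw [hAJ, hωJ']
    have f1 := e1 (J z) x (J y)
    have f2 := e3 x z (J y)
    have f3 := e1 x z (J (J y))
    have f4 := e2 (J z) x (J y)
    have f5 := e1 (J z) (J y) x
    have f6 := e3 (J y) z x
    have f7 := e1 (J y) z (J x)
    have f8 := e2 z (J y) (J x)
    have f9 := e3 z x (J y)
    have s := hω z (J y)
    simp only [hωJ', neg_neg] at s
    simp only [hJ, map_neg, hωJ', hω x z, hω y x] at *
    rw [s]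
    linarith
  have step : ∀ k, Ω k (J k) ≠ 0 → B k = (c / 2) • k := by
    intro k hk
    have hc1 : 2 * Ω (B k) (J k) = Ω k (J k) * c := by
      have := hc k (J k)
      rw [hBJ, hω (J k)] at this
      have h2 : Ω k (J (B k)) = Ω (B k) (J k) := by
        rw [hω, hωJ']; ring
      linarith
    -- Put l = Jk and i = k in `hAB` and eliminate `A` by `formula`: an equation for `B k` alone,
    -- solvable because `k` is not isotropic.
    have hB : ∀ u, Ω k (J k) * Ω (B k) u = Ω (B k) (J k) * Ω k u + Ω (B k) k * Ω (J k) u := by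
      intro u
      have h0 := congrArg (fun v => Ω v u) (hAB k (J k) k)
      simp only [map_sub, map_smul, LinearMap.sub_apply, LinearMap.smul_apply, smul_eq_mul] at h0
      have h1 := formula k (J k) k u
      have h2 := formula (J k) k k u
      have kk : Ω k k = 0 := by linarith [hω k k]
      have h3 : Ω (J (B k)) k = - Ω (B k) (J k) := hωJ' _ _
      simp only [hBJ, hJ, map_neg, hωJ', LinearMap.neg_apply, kk] at h0 h1 h2 h3 ⊢
      linarith
    have hBk : Ω (B k) k = 0 := by
      have := hB k
      have kk : Ω k k = 0 := by linarith [hω k k]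
      rw [kk, hω (J k)] at this
      have : 2 * Ω k (J k) * Ω (B k) k = 0 := by linarith
      simpa [hk] using this
    rw [← sub_eq_zero]
    refine hnd _ fun u => ?_
    have := hB u
    rw [hBk, zero_mul, add_zero] at this
    have h3 : Ω k (J k) * (Ω (B k) u - c / 2 * Ω k u) = 0 := by
      linear_combination this + (Ω k u / 2) * hc1
    simpa [hk] using h3
  -- Ω(·, J·) is a nondegenerate symmetric form, so by polarization its quadratic form is not zero.
  obtain ⟨k0, hk0⟩ : ∃ k0, Ω k0 (J k0) ≠ 0 := by
    by_contra! hcon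
    refine hv (hnd v fun u => ?_)
    have h1 := hcon (v + J u)
    have h2 := hcon v
    have h3 := hcon (J u)
    simp only [map_add, LinearMap.add_apply, hJ, map_neg, hωJ'] at h1 h3
    linarith [hω u v]
  by_cases hk : Ω k (J k) = 0
  -- Parallelogram law: for isotropic k the values at k0 ± k add up to twice the value at k0.
  -- Linearity of `B` then transfers the result to k.
  · have hs : Ω (k0 + k) (J (k0 + k)) ≠ 0 ∨ Ω (k0 - k) (J (k0 - k)) ≠ 0 := by
      by_contra! hcon
      obtain ⟨h1, h2⟩ := hcon
      simp only [map_add, map_sub, LinearMap.add_apply, LinearMap.sub_apply] at h1 h2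
      exact hk0 (by linarith)
    have h0 := step k0 hk0
    rcases hs with hs | hs
    · have := step _ hs
      rw [map_add, h0, smul_add] at this
      exact add_left_cancel this
    · have := step _ hs
      rw [map_sub, h0, smul_sub] at this
      exact sub_right_injective this
  · exact step k hk

/-- The third prolongation of a nondegenerate symbol vanishes. -/
theorem eq_zero_of_third_prolongation {Ω : H →ₗ[ℝ] H →ₗ[ℝ] ℝ} {B : H → H → H} {c : H → ℝ} {t : H}
    (hω : ∀ x y, Ω x y = -Ω y x) (hnd : ∀ x, (∀ y, Ω x y = 0) → x = 0)
    (hB : ∀ m k, B m k = (c m / 2) • k) (hBt : ∀ m k, B m k - B k m = Ω m k • t)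
    (hc : ∀ k, c k + Ω k t = 0) : t = 0 := by
  refine hnd t fun y => ?_
  have h1 := hBt y t
  have h2 := hc y
  have h3 : c t = 0 := by linarith [hc t, hω t t]
  rw [hB, hB, h3, zero_div, zero_smul, sub_zero] at h1
  have h4 : (Ω y t) • t = 0 := by
    -- With c y = −Ω(y, t) the equation (c y / 2) t = Ω(y, t) t collects to the factor 1 + 1/2.
    have : (3 / 2 * Ω y t) • t = 0 := by
      have hcy : c y = - Ω y t := by linarith
      rw [hcy, ← sub_eq_zero] at h1
      rw [← neg_eq_zero, ← h1]; module
    have h5 := smul_eq_zero.1 this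
    rcases h5 with h5 | h5
    · rw [show Ω y t = 0 by linarith, zero_smul]
    · rw [h5, smul_zero]
  rcases smul_eq_zero.1 h4 with h5 | h5
  · rw [hω, h5, neg_zero]
  · simp [h5]

end LinearAlgebra

/-! ### Nakayama's lemma as a passage from ideals to functionals. -/

section Reduction

variable {R : Type*} [CommRing R] [Algebra ℝ R]

/-- Nakayama's lemma in terms of functionals: over a local ring with residue field `ℝ`, a finite
set lies in an ideal as soon as this holds for its constant-coefficient specializations. -/
theorem subset_ideal_of_functionals {ev : R →ₐ[ℝ] ℝ} (hev : ∀ r, ev r ≠ 0 → IsUnit r)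
    {I : Ideal R} {s : Set R} (hs : s.Finite)
    (h : ∀ l : R →ₗ[ℝ] ℝ, (∀ r ∈ I, l r = 0) → (∀ r, ∀ v ∈ s, l (r * v) = ev r * l v) →
      ∀ v ∈ s, l v = 0) : s ⊆ I := by
  -- An element of ker ev times anything, plus 1, has value 1 and is therefore a unit.
  have hm : RingHom.ker ev ≤ Ideal.jacobson ⊥ := fun r hr => by
    rw [Ideal.mem_jacobson_bot]
    intro y
    apply hev
    rw [RingHom.mem_ker] at hr
    simp [hr]
  rw [← Ideal.span_le]
  refine Submodule.le_of_le_smul_of_le_jacobson_bot (Submodule.fg_span hs) hm ?_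
  refine Ideal.span_le.2 fun v hv => ?_
  by_contra hcon
  -- A separating real functional kills I and ker ev · span s, so on s it sees a coefficient only
  -- through its value.
  obtain ⟨l, hlv, hl⟩ := Submodule.exists_le_ker_of_notMem
    (p := (I ⊔ RingHom.ker ev • Ideal.span s).restrictScalars ℝ) (v := v) hcon
  refine hlv (h l (fun r hr => hl (Ideal.mem_sup_left hr)) (fun r u hu => ?_) v hv)
  have h1 : l ((r - algebraMap ℝ R (ev r)) * u) = 0 := by
    refine hl (Ideal.mem_sup_right (Submodule.smul_mem_smul ?_ (Ideal.subset_span hu)))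
    simp [RingHom.mem_ker]
  rw [sub_mul, map_sub, ← Algebra.smul_def, map_smul, smul_eq_mul] at h1
  linarith

variable {ι H V : Type*} [AddCommGroup H] [Module ℝ H] [AddCommGroup V] [Module ℝ V]

/-- Stated for bare functions so that a multilinear identity can be reduced to basis vectors one
variable at a time, after reverting that variable. -/
theorem IsLinearMap.eq_zero_of_basis (b : Module.Basis ι ℝ H) {F : H → V} (hF : IsLinearMap ℝ F)
    (h : ∀ i, F (b i) = 0) (x : H) : F x = 0 := by
  have : hF.mk' F = 0 := b.ext fun i => by simpa using h i
  simpa using congrArg (fun f => f x) this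

end Reduction

/-! ### Frame data of a CR map, deviation ideals, first order congruences. -/

/-- The algebraic data of a local CR-diffeomorphism of a frame of vector fields:
derivations `D k` (`k = none` is the transversal direction) of the ring of germs of functions at
a fixed point, their structure functions `C`, the pull-back of functions, and the matrices of the
differential and of the complex structure. -/
structure CRFrameData (ι σ R H : Type*) [Fintype ι] [DecidableEq ι] [CommRing R] [Algebra ℝ R]
    [AddCommGroup H] [Module ℝ H] where
  ev : R →ₐ[ℝ] ℝ
  isUnit_of_ev : ∀ r, ev r ≠ 0 → IsUnit r
  D : Option ι → Derivation ℝ R R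
  C : Option ι → Option ι → Option ι → R
  bracket : ∀ i j h, D i (D j h) - D j (D i h) = ∑ k, C i j k * D k h
  pull : R →+* R
  x : σ → R
  pull_sub_mem : ∀ h, pull h - h ∈ Ideal.span (Set.range fun s => pull (x s) - x s)
  G : Option ι → Option ι → R
  chain : ∀ i h, D i (pull h) = ∑ k, G i k * pull (D k h)
  frame : ∀ y : Option ι → R, (∀ s, ∑ k, y k * pull (D k (x s)) = 0) → ∀ k, y k = 0
  G_none : ∀ i, G (some i) none = 0
  Jm : ι → ι → R
  commute : ∀ i l, ∑ k, G (some i) (some k) * pull (Jm k l) = ∑ k, Jm i k * G (some k) (some l)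
  ev_G : ∀ i k, ev (G i k) = if i = k then 1 else 0
  ev_x : ∀ s, ev (pull (x s) - x s) = 0
  ev_DG : ev (D none (G none none)) = 0
  b : Module.Basis ι ℝ H
  J : H →ₗ[ℝ] H
  levi : H →ₗ[ℝ] H →ₗ[ℝ] ℝ
  J_basis : ∀ i, J (b i) = ∑ k, ev (Jm i k) • b k
  levi_basis : ∀ i j, levi (b i) (b j) = ev (C (some i) (some j) none)
  J_sq : ∀ v, J (J v) = -v
  levi_skew : ∀ v w, levi v w = -levi w v
  levi_nondegenerate : ∀ v, (∀ w, levi v w + levi (J v) (J w) = 0) → v = 0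

namespace CRFrameData

variable {ι σ R H : Type*} [Fintype ι] [DecidableEq ι] [CommRing R] [Algebra ℝ R]
  [AddCommGroup H] [Module ℝ H] (P : CRFrameData ι σ R H)

/-- The structure equations, pulled back by the map. -/
theorem structure_equation (i j k : Option ι) :
    P.D i (P.G j k) - P.D j (P.G i k) + ∑ l, ∑ m, P.G i l * P.G j m * P.pull (P.C l m k)
      = ∑ l, P.C i j l * P.G l k := by
  rw [← sub_eq_zero]
  revert k
  -- The pulled-back frame is still a frame, so coefficients may be compared after pairing with the
  -- pulled-back derivatives of the coordinates. There the identity is the bracket relation applied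
  -- to `pull (x s)`.
  refine P.frame _ fun s => ?_
  have h0 := P.bracket i j (P.pull (P.x s))
  have h1 : ∀ i j, P.D i (P.D j (P.pull (P.x s))) =
      ∑ k, P.D i (P.G j k) * P.pull (P.D k (P.x s))
        + ∑ l, ∑ k, P.G i l * P.G j k * P.pull (P.D l (P.D k (P.x s))) := by
    intro i j
    rw [P.chain j, map_sum, Finset.sum_comm (s := Finset.univ (α := Option ι)),
      ← Finset.sum_add_distrib]
    refine Finset.sum_congr rfl fun k _ => ?_
    rw [Derivation.leibniz, P.chain, smul_eq_mul, smul_eq_mul, Finset.mul_sum, add_comm]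
    congr 1
    · ring
    · exact Finset.sum_congr rfl fun l _ => by ring
  rw [h1, h1, Finset.sum_comm (f := fun l k => P.G j l * P.G i k * _)] at h0
  have h2 : ∑ l, ∑ k, P.G i l * P.G j k * P.pull (P.D l (P.D k (P.x s)))
      - ∑ l, ∑ k, P.G j k * P.G i l * P.pull (P.D k (P.D l (P.x s)))
      = ∑ m, (∑ l, ∑ k, P.G i l * P.G j k * P.pull (P.C l k m)) * P.pull (P.D m (P.x s)) := by
    simp only [Finset.sum_mul, ← Finset.sum_sub_distrib]
    rw [Finset.sum_comm (s := Finset.univ (α := Option ι))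
      (f := fun m l => ∑ k, P.G i l * P.G j k * P.pull (P.C l k m) * P.pull (P.D m (P.x s)))]
    refine Finset.sum_congr rfl fun l _ => ?_
    rw [Finset.sum_comm (s := Finset.univ (α := Option ι))
      (f := fun m k => P.G i l * P.G j k * P.pull (P.C l k m) * P.pull (P.D m (P.x s)))]
    refine Finset.sum_congr rfl fun k _ => ?_
    have h3 := congrArg P.pull (P.bracket l k (P.x s))
    simp only [map_sub, map_sum, map_mul] at h3
    simp only [mul_assoc, ← Finset.mul_sum, ← h3]
    ring
  have h4 : ∑ m, (∑ l, P.C i j l * P.G l m) * P.pull (P.D m (P.x s))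
      = ∑ k, P.C i j k * P.D k (P.pull (P.x s)) := by
    simp only [P.chain, Finset.mul_sum, Finset.sum_mul, mul_assoc]
    rw [Finset.sum_comm]
  simp only [sub_mul, add_mul, Finset.sum_sub_distrib, Finset.sum_add_distrib]
  rw [← h2, h4, ← h0]
  ring

/-- The ideal of first order deviations from the identity. -/
def I0 : Ideal R :=
  Ideal.span (Set.range (fun s => P.pull (P.x s) - P.x s)
    ∪ Set.range (fun i : ι × ι => P.G (some i.1) (some i.2) - if i.1 = i.2 then 1 else 0)
    ∪ {P.G none none - 1})

/-- The ideal of deviations of the first derivatives from the identity. -/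
def I1 : Ideal R := P.I0 ⊔ Ideal.span (Set.range fun k => P.G none (some k))

/-- The ideal of deviations of weighted order four from the identity. -/
def I2 : Ideal R := P.I1 ⊔ Ideal.span {P.D none (P.G none none)}

theorem I0_le_I1 : P.I0 ≤ P.I1 := le_sup_left

theorem I1_le_I2 : P.I1 ≤ P.I2 := le_sup_left

theorem pull_x_mem (s : σ) : P.pull (P.x s) - P.x s ∈ P.I0 :=
  Ideal.subset_span (Or.inl (Or.inl ⟨s, rfl⟩))

theorem pull_mem (h : R) : P.pull h - h ∈ P.I0 :=
  Ideal.span_mono (fun _ hx => Or.inl (Or.inl hx)) (P.pull_sub_mem h)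

theorem G_some_mem (i j : ι) : P.G (some i) (some j) - (if i = j then 1 else 0) ∈ P.I0 :=
  Ideal.subset_span (Or.inl (Or.inr ⟨(i, j), rfl⟩))

theorem G_none_mem : P.G none none - 1 ∈ P.I0 := Ideal.subset_span (Or.inr rfl)

theorem b_mem (k : ι) : P.G none (some k) ∈ P.I1 :=
  Ideal.mem_sup_right (Ideal.subset_span ⟨k, rfl⟩)

theorem c_mem : P.D none (P.G none none) ∈ P.I2 := Ideal.mem_sup_right (Ideal.subset_span rfl)

section Quotient

variable {I : Ideal R} (hI : P.I0 ≤ I)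
include hI

theorem mk_pull (h : R) : Ideal.Quotient.mk I (P.pull h) = Ideal.Quotient.mk I h :=
  Ideal.Quotient.eq.2 (hI (P.pull_mem h))

theorem mk_G_some (i j : ι) :
    Ideal.Quotient.mk I (P.G (some i) (some j)) = if i = j then 1 else 0 := by
  have := Ideal.Quotient.eq.2 (hI (P.G_some_mem i j))
  rw [this]
  split_ifs <;> simp

theorem mk_G_none : Ideal.Quotient.mk I (P.G none none) = 1 := by
  rw [Ideal.Quotient.eq.2 (hI P.G_none_mem), map_one]

/-- Since `G (some z) none = 0`, the chain rule along H only meets entries of G that are Kronecker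
deltas modulo `I0`. The transversal direction would also involve b. -/
theorem mk_D_pull (z : ι) (h : R) :
    Ideal.Quotient.mk I (P.D (some z) (P.pull h)) = Ideal.Quotient.mk I (P.D (some z) h) := by
  rw [P.chain]
  simp [Fintype.sum_option, P.G_none, P.mk_pull hI, P.mk_G_some hI]

end Quotient

/-- The H-component of the structure equation for two directions of H; b appears as the torsion. -/
theorem torsion_mem (i j k : ι) :
    P.D (some i) (P.G (some j) (some k)) - P.D (some j) (P.G (some i) (some k))
      - P.C (some i) (some j) none * P.G none (some k) ∈ P.I0 := by
  have h := congrArg (Ideal.Quotient.mk P.I0) (P.structure_equation (some i) (some j) (some k))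
  rw [← Ideal.Quotient.eq_zero_iff_mem]
  simp [Fintype.sum_option, P.G_none, P.mk_pull le_rfl, P.mk_G_some le_rfl] at h ⊢
  linear_combination h

/-- The transversal component for one direction of H and the transversal one. It makes the
derivatives of λ along H functions of b rather than new unknowns. -/
theorem D_G_none_mem (i : ι) :
    P.D (some i) (P.G none none)
      + ∑ m, P.G none (some m) * P.C (some i) (some m) none ∈ P.I0 := by
  have h := congrArg (Ideal.Quotient.mk P.I0) (P.structure_equation (some i) none none)
  rw [← Ideal.Quotient.eq_zero_iff_mem]
  simp [Fintype.sum_option, P.G_none, P.mk_pull le_rfl, P.mk_G_some le_rfl,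
    P.mk_G_none le_rfl, Finset.sum_add_distrib] at h ⊢
  linear_combination h

/-- Trades a transversal derivative of G for a derivative of b along H; this is how commutators of
H-derivatives are later expressed through b. -/
theorem D_b_mem (i k : ι) :
    P.D (some i) (P.G none (some k)) - P.D none (P.G (some i) (some k)) ∈ P.I1 := by
  have h := congrArg (Ideal.Quotient.mk P.I1) (P.structure_equation (some i) none (some k))
  rw [← Ideal.Quotient.eq_zero_iff_mem]
  have hb : ∀ m, Ideal.Quotient.mk P.I1 (P.G none (some m)) = 0 :=
    fun m => Ideal.Quotient.eq_zero_iff_mem.2 (P.b_mem m)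
  simp [Fintype.sum_option, P.G_none, P.mk_pull P.I0_le_I1, P.mk_G_some P.I0_le_I1,
    P.mk_G_none P.I0_le_I1, hb] at h ⊢
  linear_combination h

/-- For two directions of H the transversal component contains no derivative of G: it says that the
H-block of G transforms Ω by the factor λ. Being an exact identity, it can be differentiated before
reduction modulo `I0`, an ideal not known to be stable. The derivative of λ is then eliminated by
`D_G_none_mem`. -/
theorem D_levi_mem (z i j : ι) :
    ∑ l, P.D (some z) (P.G (some i) (some l)) * P.C (some l) (some j) none
      + ∑ m, P.D (some z) (P.G (some j) (some m)) * P.C (some i) (some m) none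
      + P.C (some i) (some j) none * ∑ m, P.G none (some m) * P.C (some z) (some m) none
      ∈ P.I0 := by
  have h := congrArg (fun r => Ideal.Quotient.mk P.I0 (P.D (some z) r))
    (P.structure_equation (some i) (some j) none)
  have h2 := Ideal.Quotient.eq_zero_iff_mem.2 (P.D_G_none_mem z)
  rw [← Ideal.Quotient.eq_zero_iff_mem]
  simp [Fintype.sum_option, P.G_none, P.mk_pull le_rfl, P.mk_G_some le_rfl,
    P.mk_G_none le_rfl, P.mk_D_pull le_rfl, mul_add, Finset.sum_add_distrib] at h h2 ⊢
  simp only [mul_comm (Ideal.Quotient.mk P.I0 (P.D _ _)) (Ideal.Quotient.mk P.I0 (P.C _ _ _))]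
  linear_combination h + Ideal.Quotient.mk P.I0 (P.C (some i) (some j) none) * h2

theorem D_commute_mem (z i l : ι) :
    ∑ k, P.D (some z) (P.G (some i) (some k)) * P.Jm k l
      - ∑ k, P.Jm i k * P.D (some z) (P.G (some k) (some l)) ∈ P.I0 := by
  have h := congrArg (fun r => Ideal.Quotient.mk P.I0 (P.D (some z) r)) (P.commute i l)
  rw [← Ideal.Quotient.eq_zero_iff_mem]
  simp [P.mk_pull le_rfl, P.mk_G_some le_rfl, P.mk_D_pull le_rfl, Finset.sum_add_distrib] at h ⊢
  simp only [mul_comm (Ideal.Quotient.mk P.I0 (P.D _ _)) (Ideal.Quotient.mk P.I0 (P.Jm _ _))]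
  linear_combination h

/-! ### From coefficient arrays to multilinear maps on H. -/

/-- The value of the Levi form (with values in the transversal direction) on the frame. -/
noncomputable def leviCoeff (i j : ι) : ℝ := P.ev (P.C (some i) (some j) none)

/-- The value of the complex structure on the frame. -/
noncomputable def jCoeff (i k : ι) : ℝ := P.ev (P.Jm i k)

/-- The bilinear map on `H` with the given coefficients. -/
noncomputable def lift2 (a : ι → ι → ι → ℝ) : H →ₗ[ℝ] H →ₗ[ℝ] H :=
  P.b.constr ℝ fun z => P.b.constr ℝ fun i => ∑ k, a z i k • P.b k

theorem lift2_basis (a : ι → ι → ι → ℝ) (z i : ι) :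
    P.lift2 a (P.b z) (P.b i) = ∑ k, a z i k • P.b k := by
  simp [lift2]

theorem coeff_eq_zero {f : ι → ℝ} (h : ∑ k, f k • P.b k = 0) (k : ι) : f k = 0 :=
  Fintype.linearIndependent_iff.1 P.b.linearIndependent f h k

/-- Nakayama yields arrays of numbers, whereas the prolongation lemmas are coordinate free. This and
the next two results translate J-linearity, torsion and skewness of an array by checking them on the
basis. -/
theorem lift2_J {a : ι → ι → ι → ℝ}
    (h : ∀ z i l, ∑ k, a z i k * P.jCoeff k l = ∑ k, P.jCoeff i k * a z k l) (x y : H) :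
    P.lift2 a x (P.J y) = P.J (P.lift2 a x y) := by
  rw [← sub_eq_zero]
  revert y
  refine IsLinearMap.eq_zero_of_basis P.b
    ⟨fun _ _ => by simp only [map_add]; abel, fun _ _ => by simp only [map_smul]; module⟩
    fun i => ?_
  revert x
  refine IsLinearMap.eq_zero_of_basis P.b
    ⟨fun _ _ => by simp only [map_add, LinearMap.add_apply]; abel,
      fun _ _ => by simp only [map_smul, LinearMap.smul_apply]; module⟩ fun z => ?_
  simp only [P.J_basis, map_sum, map_smul, P.lift2_basis, Finset.smul_sum, smul_smul]
  rw [Finset.sum_comm, Finset.sum_comm (f := fun k l => (a z i k * P.ev (P.Jm k l)) • P.b l),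
    ← Finset.sum_sub_distrib]
  refine Finset.sum_eq_zero fun l _ => ?_
  rw [← Finset.sum_smul, ← Finset.sum_smul, ← sub_smul]
  have := h z i l
  simp only [jCoeff] at this
  rw [this, sub_self, zero_smul]

theorem lift2_torsion {a : ι → ι → ι → ℝ} {β : ι → ℝ}
    (h : ∀ i j k, a i j k - a j i k = P.leviCoeff i j * β k) (x y : H) :
    P.lift2 a x y - P.lift2 a y x = P.levi x y • ∑ k, β k • P.b k := by
  rw [← sub_eq_zero]
  revert y
  refine IsLinearMap.eq_zero_of_basis P.b
    ⟨fun _ _ => by simp only [map_add, LinearMap.add_apply]; module,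
      fun _ _ => by simp only [map_smul, LinearMap.smul_apply, smul_eq_mul]; module⟩
    fun j => ?_
  revert x
  refine IsLinearMap.eq_zero_of_basis P.b
    ⟨fun _ _ => by simp only [map_add, LinearMap.add_apply]; module,
      fun _ _ => by simp only [map_smul, LinearMap.smul_apply, smul_eq_mul]; module⟩
    fun i => ?_
  rw [P.lift2_basis, P.lift2_basis, P.levi_basis, Finset.smul_sum, ← Finset.sum_sub_distrib,
    ← Finset.sum_sub_distrib]
  refine Finset.sum_eq_zero fun k _ => ?_
  rw [smul_smul, ← sub_smul, h, leviCoeff, sub_self]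

theorem lift2_levi {a : ι → ι → ι → ℝ} {β : ι → ℝ}
    (h : ∀ z i j, ∑ l, a z i l * P.leviCoeff l j + ∑ m, a z j m * P.leviCoeff i m
      + P.leviCoeff i j * ∑ m, β m * P.leviCoeff z m = 0) (z x y : H) :
    P.levi (P.lift2 a z x) y + P.levi x (P.lift2 a z y) + P.levi x y * P.levi z (∑ k, β k • P.b k) = 0 := by
  revert y
  refine IsLinearMap.eq_zero_of_basis P.b
    ⟨fun _ _ => by simp only [map_add]; ring,
      fun _ _ => by simp only [map_smul, smul_eq_mul]; ring⟩ fun j => ?_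
  revert x
  refine IsLinearMap.eq_zero_of_basis P.b
    ⟨fun _ _ => by simp only [map_add, LinearMap.add_apply]; ring,
      fun _ _ => by simp only [map_smul, LinearMap.smul_apply, smul_eq_mul]; ring⟩ fun i => ?_
  revert z
  refine IsLinearMap.eq_zero_of_basis P.b
    ⟨fun _ _ => by simp only [map_add, LinearMap.add_apply]; ring,
      fun _ _ => by simp only [map_smul, LinearMap.smul_apply, smul_eq_mul]; ring⟩ fun z => ?_
  have := h z i j
  simp only [leviCoeff] at this
  simpa only [P.lift2_basis, map_sum, map_smul, LinearMap.sum_apply, LinearMap.smul_apply,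
    P.levi_basis, smul_eq_mul] using this

theorem eq_zero_of_lift2 {a : ι → ι → ι → ℝ} (h : ∀ x y, P.lift2 a x y = 0) (z i k : ι) :
    a z i k = 0 := by
  refine P.coeff_eq_zero (f := a z i) ?_ k
  rw [← P.lift2_basis, h]

/-- Vanishing of the first prolongation, in coefficients. -/
theorem first_prolongation {a : ι → ι → ι → ℝ} (h1 : ∀ i j k, a i j k = a j i k)
    (h2 : ∀ z i j, ∑ l, a z i l * P.leviCoeff l j + ∑ m, a z j m * P.leviCoeff i m = 0)
    (h3 : ∀ z i l, ∑ k, a z i k * P.jCoeff k l = ∑ k, P.jCoeff i k * a z k l) (z i k : ι) :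
    a z i k = 0 := by
  refine P.eq_zero_of_lift2 (fun x y => ?_) z i k
  refine eq_zero_of_symmetric_of_skew P.J_sq P.levi_skew P.levi_nondegenerate (fun x y => ?_)
    (P.lift2_J h3) (fun z x y => ?_) x y
  · simpa [sub_eq_zero] using P.lift2_torsion (β := 0) (a := a) (by simp [h1 _ _]) x y
  · simpa using P.lift2_levi (β := 0) (a := a) (by simpa using h2) z x y

/-- The torsion determines the transversal derivative if the Levi form is not `J`-invariant. -/
theorem torsion_eq_zero {a : ι → ι → ι → ℝ} {β : ι → ℝ}
    (h1 : ∀ i j k, a i j k - a j i k = P.leviCoeff i j * β k)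
    (h3 : ∀ z i l, ∑ k, a z i k * P.jCoeff k l = ∑ k, P.jCoeff i k * a z k l)
    {x y : H} (hxy : P.levi x y ≠ P.levi (P.J x) (P.J y)) (k : ι) : β k = 0 :=
  P.coeff_eq_zero (eq_zero_of_torsion P.J_sq (P.lift2_torsion h1) (P.lift2_J h3) hxy) k

/-- The trilinear map on `H` with the given coefficients. -/
noncomputable def lift3 (a : ι → ι → ι → ι → ℝ) : H →ₗ[ℝ] H →ₗ[ℝ] H →ₗ[ℝ] H :=
  P.b.constr ℝ fun m => P.lift2 (a m)

/-- The linear map of `H` with the given coefficients. -/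
noncomputable def lift1 (β : ι → ι → ℝ) : H →ₗ[ℝ] H :=
  P.b.constr ℝ fun m => ∑ k, β m k • P.b k

theorem lift3_basis (a : ι → ι → ι → ι → ℝ) (m : ι) : P.lift3 a (P.b m) = P.lift2 (a m) := by
  simp [lift3]

theorem lift1_basis (β : ι → ι → ℝ) (m : ι) : P.lift1 β (P.b m) = ∑ k, β m k • P.b k := by
  simp [lift1]

/-- The second prolongation, in coefficients. -/
theorem second_prolongation (hωJ : ∀ x y, P.levi (P.J x) (P.J y) = P.levi x y)
    {a : ι → ι → ι → ι → ℝ} {β : ι → ι → ℝ} {c : ℝ}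
    (h1 : ∀ m i j k, a m i j k - a m j i k = P.leviCoeff i j * β m k)
    (h2 : ∀ m z i j, ∑ l, a m z i l * P.leviCoeff l j + ∑ l, a m z j l * P.leviCoeff i l
      + P.leviCoeff i j * ∑ l, β m l * P.leviCoeff z l = 0)
    (h3 : ∀ m z i l, ∑ k, a m z i k * P.jCoeff k l = ∑ k, P.jCoeff i k * a m z k l)
    (h4 : ∀ k l i j, a k l i j - a l k i j = P.leviCoeff k l * β i j)
    (h5 : ∀ k l, ∑ m, β l m * P.leviCoeff k m - ∑ m, β k m * P.leviCoeff l m = P.leviCoeff k l * c) (m k : ι) :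
    β m k = if m = k then c / 2 else 0 := by
  have hnd : ∀ x, (∀ y, P.levi x y = 0) → x = 0 := fun x hx =>
    P.levi_nondegenerate x fun y => by rw [hωJ, hx, add_zero]
  have key := eq_half_smul_of_prolongation (A := fun k x y => P.lift3 a k x y) (B := P.lift1 β)
    (c := c) P.J_sq P.levi_skew hωJ hnd
    (fun k x y => by
      rw [← sub_eq_zero]
      revert k
      refine IsLinearMap.eq_zero_of_basis P.b
        ⟨fun _ _ => by simp only [map_add, LinearMap.add_apply]; module,
          fun _ _ => by simp only [map_smul, LinearMap.smul_apply]; module⟩ fun m => ?_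
      rw [P.lift3_basis, P.lift1_basis, P.lift2_torsion (h1 m), sub_self])
    (fun k z x y => by
      revert k
      refine IsLinearMap.eq_zero_of_basis P.b
        ⟨fun _ _ => by simp only [map_add, LinearMap.add_apply]; ring,
          fun _ _ => by simp only [map_smul, LinearMap.smul_apply, smul_eq_mul]; ring⟩ fun m => ?_
      rw [P.lift3_basis, P.lift1_basis, P.lift2_levi (h2 m)])
    (fun k x y => by
      rw [← sub_eq_zero]
      revert k
      refine IsLinearMap.eq_zero_of_basis P.b
        ⟨fun _ _ => by simp only [map_add, LinearMap.add_apply]; module,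
          fun _ _ => by simp only [map_smul, LinearMap.smul_apply]; module⟩ fun m => ?_
      rw [P.lift3_basis, P.lift2_J (h3 m), sub_self])
    (fun k l i => by
      rw [← sub_eq_zero]
      revert k
      refine IsLinearMap.eq_zero_of_basis P.b
        ⟨fun _ _ => by simp only [map_add, LinearMap.add_apply]; module,
          fun _ _ => by simp only [map_smul, LinearMap.smul_apply, smul_eq_mul]; module⟩
        fun k => ?_
      revert l
      refine IsLinearMap.eq_zero_of_basis P.b
        ⟨fun _ _ => by simp only [map_add, LinearMap.add_apply]; module,
          fun _ _ => by simp only [map_smul, LinearMap.smul_apply, smul_eq_mul]; module⟩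
        fun l => ?_
      revert i
      refine IsLinearMap.eq_zero_of_basis P.b
        ⟨fun _ _ => by simp only [map_add]; module,
          fun _ _ => by simp only [map_smul]; module⟩ fun i => ?_
      rw [P.lift3_basis, P.lift3_basis, P.lift2_basis, P.lift2_basis, P.lift1_basis, P.levi_basis,
        Finset.smul_sum, ← Finset.sum_sub_distrib, ← Finset.sum_sub_distrib]
      refine Finset.sum_eq_zero fun j _ => ?_
      rw [smul_smul, ← sub_smul, h4, leviCoeff, sub_self])
    (fun k l => by
      rw [← sub_eq_zero]
      revert k
      refine IsLinearMap.eq_zero_of_basis P.b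
        ⟨fun _ _ => by simp only [map_add, LinearMap.add_apply]; ring,
          fun _ _ => by simp only [map_smul, LinearMap.smul_apply, smul_eq_mul]; ring⟩
        fun k => ?_
      revert l
      refine IsLinearMap.eq_zero_of_basis P.b
        ⟨fun _ _ => by simp only [map_add, LinearMap.add_apply]; ring,
          fun _ _ => by simp only [map_smul, LinearMap.smul_apply, smul_eq_mul]; ring⟩
        fun l => ?_
      have := h5 k l
      simp only [leviCoeff] at this
      simp only [P.lift1_basis, map_sum, map_smul, P.levi_basis, smul_eq_mul, this, sub_self])
    (P.b m)
  rw [P.lift1_basis, ← sub_eq_zero] at key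
  have h6 : ∑ k, (β m k - if m = k then c / 2 else 0) • P.b k = 0 := by
    simpa [sub_smul, Finset.sum_sub_distrib] using key
  exact sub_eq_zero.1 (P.coeff_eq_zero h6 k)

/-- Vanishing of the third prolongation, in coefficients. -/
theorem third_prolongation (hωJ : ∀ x y, P.levi (P.J x) (P.J y) = P.levi x y)
    {β : ι → ι → ι → ℝ} {c t : ι → ℝ}
    (h1 : ∀ m k j, β m k j = if k = j then c m / 2 else 0)
    (h2 : ∀ m k j, β m k j - β k m j = P.leviCoeff m k * t j)
    (h3 : ∀ k, c k + ∑ m, t m * P.leviCoeff k m = 0) (k : ι) : t k = 0 := by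
  have hnd : ∀ x, (∀ y, P.levi x y = 0) → x = 0 := fun x hx =>
    P.levi_nondegenerate x fun y => by rw [hωJ, hx, add_zero]
  let c' : H →ₗ[ℝ] ℝ := P.b.constr ℝ c
  have hc' : ∀ i, c' (P.b i) = c i := fun i => by simp [c']
  refine P.coeff_eq_zero (f := t) ?_ k
  refine eq_zero_of_third_prolongation (B := fun m k => (c' m / 2) • k) (c := c') P.levi_skew hnd
    (fun _ _ => rfl) (fun m k => ?_) (fun k => ?_)
  · rw [← sub_eq_zero]
    revert m
    refine IsLinearMap.eq_zero_of_basis P.b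
      ⟨fun _ _ => by simp only [map_add, LinearMap.add_apply]; module,
        fun _ _ => by simp only [map_smul, LinearMap.smul_apply, smul_eq_mul]; module⟩
      fun m => ?_
    revert k
    refine IsLinearMap.eq_zero_of_basis P.b
      ⟨fun _ _ => by simp only [map_add]; module,
        fun _ _ => by simp only [map_smul, smul_eq_mul]; module⟩
      fun k => ?_
    have h4 : ∀ m k, (c m / 2) • P.b k = ∑ j, β m k j • P.b j := fun m k => by
      simp [h1]
    rw [hc', hc', h4, h4, P.levi_basis, Finset.smul_sum, ← Finset.sum_sub_distrib,
      ← Finset.sum_sub_distrib]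
    refine Finset.sum_eq_zero fun j _ => ?_
    rw [smul_smul, ← sub_smul, h2, leviCoeff, sub_self]
  · revert k
    refine IsLinearMap.eq_zero_of_basis P.b
      ⟨fun _ _ => by simp only [map_add, LinearMap.add_apply]; ring,
        fun _ _ => by simp only [map_smul, LinearMap.smul_apply, smul_eq_mul]; ring⟩
      fun k => ?_
    have := h3 k
    simp only [leviCoeff] at this
    simpa only [hc', map_sum, map_smul, P.levi_basis, smul_eq_mul] using this

end CRFrameData

/-! ### Derivatives of the ideals; the case of Ω not J-invariant. -/

theorem Derivation.mem_of_mem_span {R : Type*} [CommRing R] [Algebra ℝ R]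
    (D : Derivation ℝ R R) {s : Set R} {K : Ideal R} (hs : s ⊆ K) (hD : ∀ v ∈ s, D v ∈ K) {r : R}
    (hr : r ∈ Ideal.span s) : D r ∈ K := by
  have hle : Ideal.span s ≤ K := Ideal.span_le.2 hs
  induction hr using Submodule.span_induction with
  | mem v hv => exact hD v hv
  | zero => simp
  | add u v _ _ hu hv => rw [map_add]; exact K.add_mem hu hv
  | smul a v hv h =>
    rw [smul_eq_mul, Derivation.leibniz, smul_eq_mul, smul_eq_mul]
    exact K.add_mem (K.mul_mem_left _ h) (K.mul_mem_right _ (hle hv))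

theorem Derivation.mem_of_mem_sup {R : Type*} [CommRing R] [Algebra ℝ R]
    (D : Derivation ℝ R R) {I J K : Ideal R} (hI : ∀ r ∈ I, D r ∈ K) (hJ : ∀ r ∈ J, D r ∈ K)
    {r : R} (hr : r ∈ I ⊔ J) : D r ∈ K := by
  obtain ⟨u, hu, v, hv, rfl⟩ := Submodule.mem_sup.1 hr
  rw [map_add]
  exact K.add_mem (hI u hu) (hJ v hv)

/-- Differentiation of a linear combination of elements of an ideal, modulo this ideal. -/
theorem Derivation.sum_mul_sub_mem {R κ : Type*} [CommRing R] [Algebra ℝ R] [Fintype κ]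
    (D : Derivation ℝ R R) {K : Ideal R} {v : κ → R} (c : κ → R) (hv : ∀ k, v k ∈ K) :
    D (∑ k, v k * c k) - ∑ k, D (v k) * c k ∈ K := by
  rw [map_sum, ← Finset.sum_sub_distrib]
  refine K.sum_mem fun k _ => ?_
  rw [Derivation.leibniz, smul_eq_mul, smul_eq_mul]
  convert K.mul_mem_right (D (c k)) (hv k) using 1
  ring

namespace CRFrameData

variable {ι σ R H : Type*} [Fintype ι] [DecidableEq ι] [CommRing R] [Algebra ℝ R]
  [AddCommGroup H] [Module ℝ H] (P : CRFrameData ι σ R H)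

/-- Modulo `I1` the torsion disappears, so a Nakayama functional turns the first derivatives of G
along H into an element of the first prolongation, which is zero. -/
theorem D_G_mem (z i k : ι) : P.D (some z) (P.G (some i) (some k)) ∈ P.I1 := by
  have key : Set.range (fun t : ι × ι × ι => P.D (some t.1) (P.G (some t.2.1) (some t.2.2)))
      ⊆ P.I1 := by
    refine subset_ideal_of_functionals P.isUnit_of_ev (Set.finite_range _) fun l hl hmul => ?_
    have hm : ∀ r z i k, l (P.D (some z) (P.G (some i) (some k)) * r)
        = l (P.D (some z) (P.G (some i) (some k))) * P.ev r := fun r z i k => by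
      rw [mul_comm, hmul r _ ⟨(z, i, k), rfl⟩, mul_comm]
    have hm' : ∀ r z i k, l (r * P.D (some z) (P.G (some i) (some k)))
        = P.ev r * l (P.D (some z) (P.G (some i) (some k))) := fun r z i k =>
      hmul r _ ⟨(z, i, k), rfl⟩
    rintro _ ⟨⟨z, i, k⟩, rfl⟩
    refine P.first_prolongation (a := fun z i k => l (P.D (some z) (P.G (some i) (some k))))
      (fun i j k => ?_) (fun z i j => ?_) (fun z i k => ?_) z i k
    · have := hl _ (P.I0_le_I1 (P.torsion_mem i j k))
      rw [map_sub, map_sub, hl _ (P.I1.mul_mem_left _ (P.b_mem k))] at this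
      linarith
    · have := hl _ (P.I0_le_I1 (P.D_levi_mem z i j))
      rw [map_add, map_add, map_sum, map_sum, hl _ (P.I1.mul_mem_left _
        (P.I1.sum_mem fun m _ => P.I1.mul_mem_right _ (P.b_mem m))), add_zero] at this
      simpa only [hm, leviCoeff] using this
    · have := hl _ (P.I0_le_I1 (P.D_commute_mem z i k))
      rw [map_sub, map_sum, map_sum, sub_eq_zero] at this
      simpa only [hm, hm', jCoeff] using this
  exact key ⟨(z, i, k), rfl⟩

theorem D_lam_mem (z : ι) : P.D (some z) (P.G none none) ∈ P.I1 := by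
  refine (Ideal.add_mem_iff_left _ ?_).1 (P.I0_le_I1 (P.D_G_none_mem z))
  exact P.I1.sum_mem fun m _ => P.I1.mul_mem_right _ (P.b_mem m)

theorem mk_G (i k : Option ι) : Ideal.Quotient.mk P.I1 (P.G i k) = if i = k then 1 else 0 := by
  rcases i with _ | i <;> rcases k with _ | k
  · simp [P.mk_G_none P.I0_le_I1]
  · simpa using Ideal.Quotient.eq_zero_iff_mem.2 (P.b_mem k)
  · simp [P.G_none]
  · simp [P.mk_G_some P.I0_le_I1]

theorem D_pull_sub_mem (k : Option ι) (h : R) : P.D k (P.pull h) - P.D k h ∈ P.I1 := by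
  rw [← Ideal.Quotient.eq, P.chain]
  simp only [map_sum, map_mul, P.mk_G, P.mk_pull P.I0_le_I1, ite_mul, one_mul, zero_mul,
    Finset.sum_ite_eq, Finset.mem_univ, if_true]

theorem D_some_mem_of_mem_I0 (z : ι) {r : R} (hr : r ∈ P.I0) : P.D (some z) r ∈ P.I1 := by
  refine Derivation.mem_of_mem_span _ (Ideal.subset_span.trans P.I0_le_I1) ?_ hr
  rintro _ ((⟨s, rfl⟩ | ⟨⟨i, k⟩, rfl⟩) | rfl)
  · dsimp only
    rw [map_sub]
    exact P.D_pull_sub_mem _ _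
  · dsimp only
    rw [map_sub]
    refine P.I1.sub_mem (P.D_G_mem z i k) ?_
    split_ifs <;> simp
  · simpa using P.D_lam_mem z

theorem D_none_mem_of_mem_I0 {K : Ideal R} (hK : P.I1 ≤ K)
    (hG : ∀ i k, P.D none (P.G (some i) (some k)) ∈ K) (hc : P.D none (P.G none none) ∈ K) {r : R}
    (hr : r ∈ P.I0) : P.D none r ∈ K := by
  refine Derivation.mem_of_mem_span _ (Ideal.subset_span.trans (P.I0_le_I1.trans hK)) ?_ hr
  rintro _ ((⟨s, rfl⟩ | ⟨⟨i, k⟩, rfl⟩) | rfl)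
  · dsimp only
    rw [map_sub]
    exact hK (P.D_pull_sub_mem _ _)
  · dsimp only
    rw [map_sub]
    refine K.sub_mem (hG i k) ?_
    split_ifs <;> simp
  · simpa using hc

/-- The transversal derivation is a combination of brackets. -/
theorem D_none_mem_of_bracket [Nonempty ι] {K : Ideal R}
    (hK : ∀ z, ∀ r ∈ K, P.D (some z) r ∈ K) {r : R} (hr : r ∈ K) : P.D none r ∈ K := by
  -- Where Ω is nonzero at the base point, the transversal coefficient of [D i, D j] is a unit, so
  -- the bracket relation can be solved for `D none`.
  obtain ⟨i, j, hij⟩ : ∃ i j, P.leviCoeff i j ≠ 0 := by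
    by_contra! hcon
    have h0 : P.levi = 0 := P.b.ext fun i => P.b.ext fun j => by
      simpa [P.levi_basis, leviCoeff] using hcon i j
    exact P.b.ne_zero (Classical.arbitrary ι) (P.levi_nondegenerate _ fun y => by simp [h0])
  have h := P.bracket (some i) (some j) r
  rw [Fintype.sum_option] at h
  have h1 : P.C (some i) (some j) none * P.D none r ∈ K := by
    rw [← sub_eq_iff_eq_add] at h
    rw [← h]
    exact K.sub_mem (K.sub_mem (hK _ _ (hK _ _ hr)) (hK _ _ (hK _ _ hr)))
      (K.sum_mem fun k _ => K.mul_mem_left _ (hK _ _ hr))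
  exact (Ideal.unit_mul_mem_iff_mem K (P.isUnit_of_ev _ hij)).1 h1

theorem ev_eq_zero_of_mem_I2 {r : R} (hr : r ∈ P.I2) : P.ev r = 0 := by
  have h : P.I2 ≤ RingHom.ker P.ev := by
    refine sup_le (sup_le (Ideal.span_le.2 ?_) (Ideal.span_le.2 ?_)) (Ideal.span_le.2 ?_)
    · rintro _ ((⟨s, rfl⟩ | ⟨⟨i, k⟩, rfl⟩) | rfl)
      · exact P.ev_x s
      · simp only [SetLike.mem_coe, RingHom.mem_ker, map_sub, P.ev_G, Option.some.injEq]
        split_ifs <;> simp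
      · simp [RingHom.mem_ker, P.ev_G]
    · rintro _ ⟨k, rfl⟩
      simp [RingHom.mem_ker, P.ev_G]
    · rintro _ rfl
      exact P.ev_DG
  exact h hr

theorem I0_fg [Finite σ] : P.I0.FG :=
  Submodule.fg_span (((Set.finite_range _).union (Set.finite_range _)).union
    (Set.finite_singleton _))

theorem I2_fg [Finite σ] : P.I2.FG :=
  Submodule.FG.sup (Submodule.FG.sup P.I0_fg (Submodule.fg_span (Set.finite_range _)))
    (Submodule.fg_span (Set.finite_singleton _))

/-- If the Levi form is not `J`-invariant, the first derivatives satisfy a closed system. -/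
theorem I0_stable [Nonempty ι] {x y : H} (hxy : P.levi x y ≠ P.levi (P.J x) (P.J y)) (k : Option ι)
    {r : R} (hr : r ∈ P.I0) : P.D k r ∈ P.I0 := by
  -- The torsion equation couples derivatives of G with b, so both families go into one application
  -- of Nakayama. The functional kills b first, and then the first prolongation applies.
  have key : Set.range (fun t : ι × ι × ι => P.D (some t.1) (P.G (some t.2.1) (some t.2.2)))
      ∪ Set.range (fun k => P.G none (some k)) ⊆ P.I0 := by
    refine subset_ideal_of_functionals P.isUnit_of_ev
      ((Set.finite_range _).union (Set.finite_range _)) fun l hl hmul => ?_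
    have hm : ∀ r z i k, l (P.D (some z) (P.G (some i) (some k)) * r)
        = l (P.D (some z) (P.G (some i) (some k))) * P.ev r := fun r z i k => by
      rw [mul_comm, hmul r _ (Or.inl ⟨(z, i, k), rfl⟩), mul_comm]
    have hm' : ∀ r z i k, l (r * P.D (some z) (P.G (some i) (some k)))
        = P.ev r * l (P.D (some z) (P.G (some i) (some k))) := fun r z i k =>
      hmul r _ (Or.inl ⟨(z, i, k), rfl⟩)
    have hb : ∀ r k, l (r * P.G none (some k)) = P.ev r * l (P.G none (some k)) :=
      fun r k => hmul r _ (Or.inr ⟨k, rfl⟩)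
    have h3 : ∀ z i k, ∑ j, l (P.D (some z) (P.G (some i) (some j))) * P.jCoeff j k
        = ∑ j, P.jCoeff i j * l (P.D (some z) (P.G (some j) (some k))) := fun z i k => by
      have := hl _ (P.D_commute_mem z i k)
      rw [map_sub, map_sum, map_sum, sub_eq_zero] at this
      simpa only [hm, hm', jCoeff] using this
    have h1 : ∀ i j k, l (P.D (some i) (P.G (some j) (some k)))
        - l (P.D (some j) (P.G (some i) (some k))) = P.leviCoeff i j * l (P.G none (some k)) :=
      fun i j k => by
        have := hl _ (P.torsion_mem i j k)
        rw [map_sub, map_sub, hb] at this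
        exact sub_eq_zero.1 this
    have hβ : ∀ k, l (P.G none (some k)) = 0 := P.torsion_eq_zero
      (a := fun z i k => l (P.D (some z) (P.G (some i) (some k)))) h1 h3 hxy
    rintro _ (⟨⟨z, i, k⟩, rfl⟩ | ⟨k, rfl⟩)
    · refine P.first_prolongation (a := fun z i k => l (P.D (some z) (P.G (some i) (some k))))
        (fun i j k => ?_) (fun z i j => ?_) h3 z i k
      · have := h1 i j k
        rw [hβ, mul_zero] at this
        exact sub_eq_zero.1 this
      · have := hl _ (P.D_levi_mem z i j)
        rw [map_add, map_add, map_sum, map_sum, Finset.mul_sum, map_sum,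
          Finset.sum_eq_zero (f := fun m => l (_ * (P.G none (some m) * _))) (fun m _ => by
            rw [mul_left_comm, mul_comm, hb, hβ, mul_zero]), add_zero] at this
        simpa only [hm, leviCoeff] using this
    · exact hβ k
  -- As b already lies in `I0`, the inclusion of `D (some z) I0` in `I1` becomes stability.
  have hI : P.I1 = P.I0 :=
    le_antisymm (sup_le le_rfl (Ideal.span_le.2 fun _ hr => key (Or.inr hr))) P.I0_le_I1
  have hstable : ∀ z, ∀ r ∈ P.I0, P.D (some z) r ∈ P.I0 := fun z r hr =>
    hI ▸ P.D_some_mem_of_mem_I0 z hr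
  rcases k with _ | z
  · exact P.D_none_mem_of_bracket hstable hr
  · exact hstable z r hr

end CRFrameData

/-! ### Higher derivatives; the case of Ω J-invariant at the base point. -/

section Differentiate

variable {R κ : Type*} [CommRing R] [Algebra ℝ R] [Fintype κ] (D : Derivation ℝ R R) {K : Ideal R}

/-- The product rule modulo K for congruences whose unknowns lie in K: terms with a differentiated
coefficient drop out, so a differentiated congruence keeps its shape and its coefficients. The next
two results serve the same purpose for sums. -/
theorem Derivation.mem_of_sub_sub {x y r b : R} (hb : b ∈ K) (h : D (x - y - r * b) ∈ K) :
    D x - D y - r * D b ∈ K := by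
  have := K.add_mem h (K.mul_mem_right (D r) hb)
  convert this using 1
  simp only [map_sub, Derivation.leibniz, smul_eq_mul]
  ring

theorem Derivation.mem_of_sum_sub_sum_sub {v v' : κ → R} {c c' : κ → R} {r b : R}
    (hv : ∀ k, v k ∈ K) (hv' : ∀ k, v' k ∈ K) (hb : b ∈ K)
    (h : D (∑ k, v k * c k - ∑ k, v' k * c' k - r * b) ∈ K) :
    ∑ k, D (v k) * c k - ∑ k, D (v' k) * c' k - r * D b ∈ K := by
  have h1 := D.mem_of_sub_sub hb h
  have := K.add_mem (K.sub_mem h1 (D.sum_mul_sub_mem c hv)) (D.sum_mul_sub_mem c' hv')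
  convert this using 1
  ring

theorem Derivation.mem_of_sum_add_sum_add {v v' b : κ → R} {c c' e : κ → R} {r : R}
    (hv : ∀ k, v k ∈ K) (hv' : ∀ k, v' k ∈ K) (hb : ∀ k, b k ∈ K)
    (h : D (∑ k, v k * c k + ∑ k, v' k * c' k + r * ∑ k, b k * e k) ∈ K) :
    ∑ k, D (v k) * c k + ∑ k, D (v' k) * c' k + r * ∑ k, D (b k) * e k ∈ K := by
  have h1 := K.sub_mem (K.sub_mem h (D.sum_mul_sub_mem c hv)) (D.sum_mul_sub_mem c' hv')
  have h2 := K.mul_mem_left r (D.sum_mul_sub_mem e hb)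
  have h3 : (∑ k, b k * e k) * D r ∈ K :=
    K.mul_mem_right _ (K.sum_mem fun k _ => K.mul_mem_right _ (hb k))
  have := K.sub_mem (K.sub_mem h1 h2) h3
  convert this using 1
  simp only [map_add, Derivation.leibniz, smul_eq_mul]
  ring

end Differentiate

namespace CRFrameData

variable {ι σ R H : Type*} [Fintype ι] [DecidableEq ι] [CommRing R] [Algebra ℝ R]
  [AddCommGroup H] [Module ℝ H] (P : CRFrameData ι σ R H)

/-- The first order congruences can be differentiated along H because this maps `I0` into `I1`,
which also contains the first order unknowns. For each fixed m the relations for D m D z G and D m b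
have the same form as those for D z G and b. -/
theorem D_D_torsion_mem (m i j k : ι) :
    P.D (some m) (P.D (some i) (P.G (some j) (some k)))
      - P.D (some m) (P.D (some j) (P.G (some i) (some k)))
      - P.C (some i) (some j) none * P.D (some m) (P.G none (some k)) ∈ P.I1 :=
  Derivation.mem_of_sub_sub _ (P.b_mem k) (P.D_some_mem_of_mem_I0 m (P.torsion_mem i j k))

theorem D_D_levi_mem (m z i j : ι) :
    ∑ l, P.D (some m) (P.D (some z) (P.G (some i) (some l))) * P.C (some l) (some j) none
      + ∑ l, P.D (some m) (P.D (some z) (P.G (some j) (some l))) * P.C (some i) (some l) none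
      + P.C (some i) (some j) none
        * ∑ l, P.D (some m) (P.G none (some l)) * P.C (some z) (some l) none ∈ P.I1 :=
  Derivation.mem_of_sum_add_sum_add _ (fun _ => P.D_G_mem _ _ _) (fun _ => P.D_G_mem _ _ _)
    P.b_mem (P.D_some_mem_of_mem_I0 m (P.D_levi_mem z i j))

theorem D_D_commute_mem (m z i l : ι) :
    ∑ k, P.D (some m) (P.D (some z) (P.G (some i) (some k))) * P.Jm k l
      - ∑ k, P.D (some m) (P.D (some z) (P.G (some k) (some l))) * P.Jm i k - 0 * P.D (some m) 0
      ∈ P.I1 := by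
  refine Derivation.mem_of_sum_sub_sum_sub _ (fun _ => P.D_G_mem _ _ _) (fun _ => P.D_G_mem _ _ _)
    P.I1.zero_mem (P.D_some_mem_of_mem_I0 m ?_)
  simpa [mul_comm] using P.D_commute_mem z i l

theorem D_D_G_none_mem (m z : ι) :
    P.D (some m) (P.D (some z) (P.G none none))
      + ∑ l, P.D (some m) (P.G none (some l)) * P.C (some z) (some l) none ∈ P.I1 := by
  have h1 := P.D_some_mem_of_mem_I0 m (P.D_G_none_mem z)
  have h2 := P.I1.sub_mem h1 (Derivation.sum_mul_sub_mem (P.D (some m))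
    (fun l => P.C (some z) (some l) none) P.b_mem)
  convert h2 using 1
  simp only [map_add]
  ring

/-- Modulo `I1` only the transversal part of [D k, D l] acts on G, and `D_b_mem` rewrites it by b.
This is the commutator hypothesis `hAB` of `eq_half_smul_of_prolongation`. -/
theorem bracket_G_mem (k l i j : ι) :
    P.D (some k) (P.D (some l) (P.G (some i) (some j)))
      - P.D (some l) (P.D (some k) (P.G (some i) (some j)))
      - P.C (some k) (some l) none * P.D (some i) (P.G none (some j)) ∈ P.I1 := by
  rw [P.bracket, Fintype.sum_option]
  have h1 := P.I1.mul_mem_left (P.C (some k) (some l) none) (P.D_b_mem i j)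
  have h2 : ∑ m, P.C (some k) (some l) (some m) * P.D (some m) (P.G (some i) (some j)) ∈ P.I1 :=
    P.I1.sum_mem fun m _ => P.I1.mul_mem_left _ (P.D_G_mem m i j)
  convert P.I1.sub_mem h2 h1 using 1
  ring

/-- The same commutator applied to λ, whose H-derivatives are expressed by b. It brings in the
scalar c of the second prolongation, namely the transversal derivative of λ. -/
theorem bracket_lam_mem (k l : ι) :
    ∑ m, P.D (some l) (P.G none (some m)) * P.C (some k) (some m) none
      - ∑ m, P.D (some k) (P.G none (some m)) * P.C (some l) (some m) none
      - P.C (some k) (some l) none * P.D none (P.G none none) ∈ P.I1 := by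
  have h := P.bracket (some k) (some l) (P.G none none)
  rw [Fintype.sum_option] at h
  have h2 : ∑ m, P.C (some k) (some l) (some m) * P.D (some m) (P.G none none) ∈ P.I1 :=
    P.I1.sum_mem fun m _ => P.I1.mul_mem_left _ (P.D_lam_mem m)
  convert P.I1.add_mem (P.I1.sub_mem (P.D_D_G_none_mem l k) (P.D_D_G_none_mem k l)) h2 using 1
  linear_combination h

section Hermitian

variable (hωJ : ∀ x y, P.levi (P.J x) (P.J y) = P.levi x y)
include hωJ

theorem second_derivatives_mem :
    Set.range (fun t : (ι × ι) × ι × ι =>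
      P.D (some t.1.1) (P.D (some t.1.2) (P.G (some t.2.1) (some t.2.2))))
      ∪ Set.range (fun t : ι × ι => P.D (some t.1) (P.G none (some t.2))) ⊆ P.I2 := by
  refine subset_ideal_of_functionals P.isUnit_of_ev
    ((Set.finite_range _).union (Set.finite_range _)) fun l hl hmul => ?_
  have hl' : ∀ r ∈ P.I1, l r = 0 := fun r hr => hl r (P.I1_le_I2 hr)
  have hm : ∀ r m z i k, l (P.D (some m) (P.D (some z) (P.G (some i) (some k))) * r)
      = l (P.D (some m) (P.D (some z) (P.G (some i) (some k)))) * P.ev r := fun r m z i k => by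
    rw [mul_comm, hmul r _ (Or.inl ⟨((m, z), i, k), rfl⟩), mul_comm]
  have hb : ∀ r m k, l (r * P.D (some m) (P.G none (some k)))
      = P.ev r * l (P.D (some m) (P.G none (some k))) :=
    fun r m k => hmul r _ (Or.inr ⟨(m, k), rfl⟩)
  have hb' : ∀ r m k, l (P.D (some m) (P.G none (some k)) * r)
      = l (P.D (some m) (P.G none (some k))) * P.ev r :=
    fun r m k => by rw [mul_comm, hb, mul_comm]
  have hbb : ∀ r s m k, l (r * (P.D (some m) (P.G none (some k)) * s))
      = P.ev r * (l (P.D (some m) (P.G none (some k))) * P.ev s) :=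
    fun r s m k => by rw [mul_left_comm, hb', map_mul]; ring
  have h1 : ∀ m i j k, l (P.D (some m) (P.D (some i) (P.G (some j) (some k))))
      - l (P.D (some m) (P.D (some j) (P.G (some i) (some k))))
      = P.leviCoeff i j * l (P.D (some m) (P.G none (some k))) := fun m i j k => by
    have := hl' _ (P.D_D_torsion_mem m i j k)
    rw [map_sub, map_sub, hb] at this
    exact sub_eq_zero.1 this
  have h2 : ∀ m z i j,
      ∑ k, l (P.D (some m) (P.D (some z) (P.G (some i) (some k)))) * P.leviCoeff k j
      + ∑ k, l (P.D (some m) (P.D (some z) (P.G (some j) (some k)))) * P.leviCoeff i k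
      + P.leviCoeff i j * ∑ k, l (P.D (some m) (P.G none (some k))) * P.leviCoeff z k = 0 :=
    fun m z i j => by
      have := hl' _ (P.D_D_levi_mem m z i j)
      simpa only [map_add, map_sum, hm, Finset.mul_sum, hbb, leviCoeff] using this
  have h3 : ∀ m z i k,
      ∑ j, l (P.D (some m) (P.D (some z) (P.G (some i) (some j)))) * P.jCoeff j k
      = ∑ j, P.jCoeff i j * l (P.D (some m) (P.D (some z) (P.G (some j) (some k)))) :=
    fun m z i k => by
      have := hl' _ (P.D_D_commute_mem m z i k)
      simp only [map_sub, map_sum, hm, zero_mul, map_zero, sub_zero, sub_eq_zero] at this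
      simpa only [jCoeff, mul_comm (P.ev (P.Jm i _))] using this
  -- The scalar is zero here, since the transversal derivative of λ generates part of `I2`.
  have hβ : ∀ m k, l (P.D (some m) (P.G none (some k))) = 0 := fun m k => by
    have := P.second_prolongation hωJ (c := 0)
      (a := fun m z i k => l (P.D (some m) (P.D (some z) (P.G (some i) (some k)))))
      (β := fun m k => l (P.D (some m) (P.G none (some k)))) h1 h2 h3
      (fun k n i j => by
        have := hl' _ (P.bracket_G_mem k n i j)
        rw [map_sub, map_sub, hb] at this
        exact sub_eq_zero.1 this)
      (fun k n => by
        have := hl' _ (P.bracket_lam_mem k n)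
        simpa only [map_sub, map_sum, hb', hl _ (P.I2.mul_mem_left _ P.c_mem), sub_zero,
          mul_zero, leviCoeff] using this) m k
    simpa using this
  rintro _ (⟨⟨⟨m, z⟩, i, k⟩, rfl⟩ | ⟨⟨m, k⟩, rfl⟩)
  · refine P.first_prolongation
      (a := fun z i k => l (P.D (some m) (P.D (some z) (P.G (some i) (some k)))))
      (fun i j k => ?_) (fun z i j => ?_) (h3 m) z i k
    · have := h1 m i j k
      rw [hβ, mul_zero] at this
      exact sub_eq_zero.1 this
    · simpa only [hβ, zero_mul, Finset.sum_const_zero, mul_zero, add_zero] using h2 m z i j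
  · exact hβ m k

theorem D_D_G_mem (m z i k : ι) : P.D (some m) (P.D (some z) (P.G (some i) (some k))) ∈ P.I2 :=
  P.second_derivatives_mem hωJ (Or.inl ⟨((m, z), i, k), rfl⟩)

theorem D_b_mem_I2 (m k : ι) : P.D (some m) (P.G none (some k)) ∈ P.I2 :=
  P.second_derivatives_mem hωJ (Or.inr ⟨(m, k), rfl⟩)

theorem D_some_mem_of_mem_I1 (z : ι) {r : R} (hr : r ∈ P.I1) : P.D (some z) r ∈ P.I2 := by
  refine Derivation.mem_of_mem_sup _ (fun r hr => P.I1_le_I2 (P.D_some_mem_of_mem_I0 z hr))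
    (fun r hr => Derivation.mem_of_mem_span _ ?_ ?_ hr) hr
  · rintro _ ⟨k, rfl⟩
    exact P.I1_le_I2 (P.b_mem k)
  · rintro _ ⟨k, rfl⟩
    exact P.D_b_mem_I2 hωJ z k

theorem D_none_mem_I2 {r : R} (hr : r ∈ P.I0) : P.D none r ∈ P.I2 := by
  refine P.D_none_mem_of_mem_I0 P.I1_le_I2 (fun i k => ?_) P.c_mem hr
  have := P.I2.sub_mem (P.D_b_mem_I2 hωJ i k) (P.I1_le_I2 (P.D_b_mem i k))
  simpa using this

theorem bracket_b_mem (m k j : ι) :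
    P.D (some m) (P.D (some k) (P.G none (some j)))
      - P.D (some k) (P.D (some m) (P.G none (some j)))
      - P.C (some m) (some k) none * P.D none (P.G none (some j)) ∈ P.I2 := by
  rw [P.bracket, Fintype.sum_option, add_sub_cancel_left]
  exact P.I2.sum_mem fun l _ => P.I2.mul_mem_left _ (P.D_b_mem_I2 hωJ l j)

/-- Differentiate `D_G_none_mem` transversally, then exchange the two derivations; the commutator
only produces first derivatives of λ, which lie in `I2`. -/
theorem D_c_mem (k : ι) :
    P.D (some k) (P.D none (P.G none none))
      + ∑ m, P.D none (P.G none (some m)) * P.C (some k) (some m) none ∈ P.I2 := by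
  have h1 := P.D_none_mem_I2 hωJ (P.D_G_none_mem k)
  have h2 := Derivation.sum_mul_sub_mem (P.D none) (fun m => P.C (some k) (some m) none)
    (fun m => P.I1_le_I2 (P.b_mem m))
  have h3 := P.bracket none (some k) (P.G none none)
  have h4 : ∑ m, P.C none (some k) m * P.D m (P.G none none) ∈ P.I2 := by
    rw [Fintype.sum_option]
    exact P.I2.add_mem (P.I2.mul_mem_left _ P.c_mem)
      (P.I2.sum_mem fun m _ => P.I2.mul_mem_left _ (P.I1_le_I2 (P.D_lam_mem m)))
  convert P.I2.sub_mem (P.I2.sub_mem h1 h2) h4 using 1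
  rw [map_add]
  linear_combination -h3

/-- With one more H-derivative the second prolongation no longer has c = 0: D n D m b is half of D n
of the transversal derivative of λ, times the identity. The commutator on b and `D_c_mem` relate
these scalars to the transversal derivative of b, and the third prolongation forces all of them to
vanish. -/
theorem third_derivatives_mem :
    Set.range (fun t : (ι × ι × ι) × ι × ι =>
      P.D (some t.1.1) (P.D (some t.1.2.1) (P.D (some t.1.2.2) (P.G (some t.2.1) (some t.2.2)))))
      ∪ Set.range (fun t : ι × ι × ι => P.D (some t.1) (P.D (some t.2.1) (P.G none (some t.2.2))))
      ∪ Set.range (fun k => P.D (some k) (P.D none (P.G none none)))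
      ∪ Set.range (fun k => P.D none (P.G none (some k))) ⊆ P.I2 := by
  refine subset_ideal_of_functionals P.isUnit_of_ev
    ((((Set.finite_range _).union (Set.finite_range _)).union (Set.finite_range _)).union
      (Set.finite_range _)) fun l hl hmul => ?_
  have hm : ∀ r n m z i k,
      l (P.D (some n) (P.D (some m) (P.D (some z) (P.G (some i) (some k)))) * r)
      = l (P.D (some n) (P.D (some m) (P.D (some z) (P.G (some i) (some k))))) * P.ev r :=
    fun r n m z i k => by
      rw [mul_comm, hmul r _ (Or.inl (Or.inl (Or.inl ⟨((n, m, z), i, k), rfl⟩))), mul_comm]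
  have hb : ∀ r n m k, l (r * P.D (some n) (P.D (some m) (P.G none (some k))))
      = P.ev r * l (P.D (some n) (P.D (some m) (P.G none (some k)))) :=
    fun r n m k => hmul r _ (Or.inl (Or.inl (Or.inr ⟨(n, m, k), rfl⟩)))
  have hb' : ∀ r n m k, l (P.D (some n) (P.D (some m) (P.G none (some k))) * r)
      = l (P.D (some n) (P.D (some m) (P.G none (some k)))) * P.ev r :=
    fun r n m k => by rw [mul_comm, hb, mul_comm]
  have hbb : ∀ r s n m k, l (r * (P.D (some n) (P.D (some m) (P.G none (some k))) * s))
      = P.ev r * (l (P.D (some n) (P.D (some m) (P.G none (some k)))) * P.ev s) :=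
    fun r s n m k => by rw [mul_left_comm, hb', map_mul]; ring
  have hc : ∀ r k, l (r * P.D (some k) (P.D none (P.G none none)))
      = P.ev r * l (P.D (some k) (P.D none (P.G none none))) :=
    fun r k => hmul r _ (Or.inl (Or.inr ⟨k, rfl⟩))
  have ht : ∀ r k, l (r * P.D none (P.G none (some k)))
      = P.ev r * l (P.D none (P.G none (some k))) :=
    fun r k => hmul r _ (Or.inr ⟨k, rfl⟩)
  have ht' : ∀ r k, l (P.D none (P.G none (some k)) * r)
      = l (P.D none (P.G none (some k))) * P.ev r :=
    fun r k => by rw [mul_comm, ht, mul_comm]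
  have hG := P.D_D_G_mem hωJ
  have hbI := P.D_b_mem_I2 hωJ
  have hD : ∀ n, ∀ r ∈ P.I1, P.D (some n) r ∈ P.I2 := fun n r hr => P.D_some_mem_of_mem_I1 hωJ n hr
  have h1 : ∀ n m i j k, l (P.D (some n) (P.D (some m) (P.D (some i) (P.G (some j) (some k)))))
      - l (P.D (some n) (P.D (some m) (P.D (some j) (P.G (some i) (some k)))))
      = P.leviCoeff i j * l (P.D (some n) (P.D (some m) (P.G none (some k)))) :=
    fun n m i j k => by
      have := hl _ (Derivation.mem_of_sub_sub _ (hbI m k) (hD n _ (P.D_D_torsion_mem m i j k)))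
      rw [map_sub, map_sub, hb] at this
      exact sub_eq_zero.1 this
  have h2 : ∀ n m z i j,
      ∑ k, l (P.D (some n) (P.D (some m) (P.D (some z) (P.G (some i) (some k)))))
        * P.leviCoeff k j
      + ∑ k, l (P.D (some n) (P.D (some m) (P.D (some z) (P.G (some j) (some k)))))
        * P.leviCoeff i k
      + P.leviCoeff i j
        * ∑ k, l (P.D (some n) (P.D (some m) (P.G none (some k)))) * P.leviCoeff z k = 0 :=
    fun n m z i j => by
      have := hl _ (Derivation.mem_of_sum_add_sum_add _ (fun _ => hG _ _ _ _)
        (fun _ => hG _ _ _ _) (fun _ => hbI _ _) (hD n _ (P.D_D_levi_mem m z i j)))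
      simpa only [map_add, map_sum, hm, Finset.mul_sum, hbb, leviCoeff] using this
  have h3 : ∀ n m z i k,
      ∑ j, l (P.D (some n) (P.D (some m) (P.D (some z) (P.G (some i) (some j))))) * P.jCoeff j k
      = ∑ j, P.jCoeff i j
        * l (P.D (some n) (P.D (some m) (P.D (some z) (P.G (some j) (some k))))) :=
    fun n m z i k => by
      have := hl _ (Derivation.mem_of_sum_sub_sum_sub _ (b := P.D (some m) 0)
        (fun _ => hG _ _ _ _) (fun _ => hG _ _ _ _) (by simp)
        (hD n _ (P.D_D_commute_mem m z i k)))
      simp only [map_sub, map_sum, hm, zero_mul, map_zero, sub_zero, sub_eq_zero] at this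
      simpa only [jCoeff, mul_comm (P.ev (P.Jm i _))] using this
  have hβ : ∀ n m k, l (P.D (some n) (P.D (some m) (P.G none (some k))))
      = if m = k then l (P.D (some n) (P.D none (P.G none none))) / 2 else 0 := fun n m k =>
    P.second_prolongation hωJ (c := l (P.D (some n) (P.D none (P.G none none))))
      (a := fun m z i k => l (P.D (some n) (P.D (some m) (P.D (some z) (P.G (some i) (some k))))))
      (β := fun m k => l (P.D (some n) (P.D (some m) (P.G none (some k)))))
      (h1 n) (h2 n) (h3 n)
      (fun k p i j => by
        have := hl _ (Derivation.mem_of_sub_sub _ (hbI i j) (hD n _ (P.bracket_G_mem k p i j)))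
        rw [map_sub, map_sub, hb] at this
        exact sub_eq_zero.1 this)
      (fun k p => by
        have := hl _ (Derivation.mem_of_sum_sub_sum_sub _ (fun _ => hbI _ _) (fun _ => hbI _ _)
          P.c_mem (hD n _ (P.bracket_lam_mem k p)))
        simp only [map_sub, map_sum, hb', hc] at this
        exact sub_eq_zero.1 this) m k
  have hcl : ∀ k, l (P.D (some k) (P.D none (P.G none none)))
      + ∑ m, l (P.D none (P.G none (some m))) * P.leviCoeff k m = 0 := fun k => by
    have := hl _ (P.D_c_mem hωJ k)
    simpa only [map_add, map_sum, ht', leviCoeff] using this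
  have htl : ∀ k, l (P.D none (P.G none (some k))) = 0 :=
    P.third_prolongation hωJ (t := fun k => l (P.D none (P.G none (some k)))) hβ
      (fun m k j => by
        have := hl _ (P.bracket_b_mem hωJ m k j)
        rw [map_sub, map_sub, ht] at this
        exact sub_eq_zero.1 this) hcl
  have hc0 : ∀ k, l (P.D (some k) (P.D none (P.G none none))) = 0 := fun k => by
    simpa only [htl, zero_mul, Finset.sum_const_zero, add_zero] using hcl k
  have hβ0 : ∀ n m k, l (P.D (some n) (P.D (some m) (P.G none (some k)))) = 0 := fun n m k => by
    simp [hβ, hc0]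
  rintro _ (((⟨⟨⟨n, m, z⟩, i, k⟩, rfl⟩ | ⟨⟨n, m, k⟩, rfl⟩) | ⟨k, rfl⟩) | ⟨k, rfl⟩)
  · refine P.first_prolongation
      (a := fun z i k => l (P.D (some n) (P.D (some m) (P.D (some z) (P.G (some i) (some k))))))
      (fun i j k => ?_) (fun z i j => ?_) (h3 n m) z i k
    · have := h1 n m i j k
      rw [hβ0, mul_zero] at this
      exact sub_eq_zero.1 this
    · simpa only [hβ0, zero_mul, Finset.sum_const_zero, mul_zero, add_zero] using h2 n m z i j
  · exact hβ0 n m k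
  · exact hc0 k
  · exact htl k

/-- If the Levi form is `J`-invariant, the derivatives of weighted order at most four satisfy a
closed system. -/
theorem I2_stable [Nonempty ι] (k : Option ι) {r : R} (hr : r ∈ P.I2) : P.D k r ∈ P.I2 := by
  have hstable : ∀ z, ∀ r ∈ P.I2, P.D (some z) r ∈ P.I2 := fun z r hr => by
    refine Derivation.mem_of_mem_sup _ (fun r hr => P.D_some_mem_of_mem_I1 hωJ z hr)
      (fun r hr => Derivation.mem_of_mem_span _ ?_ ?_ hr) hr
    · rintro _ rfl
      exact P.c_mem
    · rintro _ rfl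
      exact P.third_derivatives_mem hωJ (Or.inl (Or.inr ⟨z, rfl⟩))
  rcases k with _ | z
  · exact P.D_none_mem_of_bracket hstable hr
  · exact hstable z r hr

end Hermitian

/-- The deviation of a CR-diffeomorphism from the identity satisfies a closed system of linear
differential equations. -/
theorem exists_stable_ideal [Nonempty ι] [Finite σ] :
    ∃ I : Ideal R, I.FG ∧ (∀ r ∈ I, P.ev r = 0) ∧ (∀ s, P.pull (P.x s) - P.x s ∈ I) ∧
      ∀ k, ∀ r ∈ I, P.D k r ∈ I := by
  -- The alternative concerns the base point alone: Nakayama requires nothing about Ω at nearby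
  -- points.
  by_cases h : ∃ x y, P.levi x y ≠ P.levi (P.J x) (P.J y)
  · obtain ⟨x, y, hxy⟩ := h
    exact ⟨P.I0, P.I0_fg, fun r hr => P.ev_eq_zero_of_mem_I2 (P.I1_le_I2 (P.I0_le_I1 hr)),
      P.pull_x_mem, fun k r hr => P.I0_stable hxy k hr⟩
  · push Not at h
    exact ⟨P.I2, P.I2_fg, fun r hr => P.ev_eq_zero_of_mem_I2 hr,
      fun s => P.I1_le_I2 (P.I0_le_I1 (P.pull_x_mem s)),
      fun k r hr => P.I2_stable (fun x y => (h x y).symm) k hr⟩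

end CRFrameData

/-! ### Hadamard's lemma and uniqueness for linear systems. -/

section Analysis

open Set Filter
open scoped Topology

section Hadamard

universe u

variable {E : Type u} [NormedAddCommGroup E] [NormedSpace ℝ E]

theorem hasFDerivAt_integral_of_contDiffAt {V : Type*} [NormedAddCommGroup V] [NormedSpace ℝ V]
    {F : E × ℝ → V} {x : E} (h : ∀ t ∈ Icc (0 : ℝ) 1, ContDiffAt ℝ 1 F (x, t)) :
    HasFDerivAt (fun y => ∫ t in (0 : ℝ)..1, F (y, t))
      (∫ t in (0 : ℝ)..1, (fderiv ℝ F (x, t)).comp (ContinuousLinearMap.inl ℝ E ℝ)) x := by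
  have hcd : ∀ᶠ y in 𝓝 x, ∀ t ∈ Icc (0 : ℝ) 1, ContDiffAt ℝ 1 F (y, t) :=
    isCompact_Icc.eventually_forall_of_forall_eventually (P := fun y t => ContDiffAt ℝ 1 F (y, t))
      fun t ht => by
        exact (h t ht).eventually (by simp)
  have hcont : ∀ y, (∀ t ∈ Icc (0 : ℝ) 1, ContDiffAt ℝ 1 F (y, t)) →
      ContinuousOn (fun t => F (y, t)) (Icc 0 1) := fun y hy t ht =>
    ((hy t ht).continuousAt.comp (f := fun t : ℝ => (y, t))
      (by fun_prop)).continuousWithinAt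
  have hfc : ∀ t ∈ Icc (0 : ℝ) 1,
      ContinuousAt (fun p => (fderiv ℝ F p).comp (ContinuousLinearMap.inl ℝ E ℝ)) (x, t) :=
    fun t ht => ((h t ht).fderiv_right (m := 0) (by simp)).continuousAt.clm_comp continuousAt_const
  have hcont' : ContinuousOn
      (fun t => (fderiv ℝ F (x, t)).comp (ContinuousLinearMap.inl ℝ E ℝ)) (Icc 0 1) :=
    fun t ht => ((hfc t ht).comp (f := fun t : ℝ => (x, t))
      (by fun_prop)).continuousWithinAt
  obtain ⟨C, hC⟩ := isCompact_Icc.exists_bound_of_continuousOn hcont'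
  have hbd : ∀ᶠ y in 𝓝 x, ∀ t ∈ Icc (0 : ℝ) 1,
      ‖(fderiv ℝ F (y, t)).comp (ContinuousLinearMap.inl ℝ E ℝ)‖ ≤ C + 1 :=
    isCompact_Icc.eventually_forall_of_forall_eventually
      (P := fun y t => ‖(fderiv ℝ F (y, t)).comp (ContinuousLinearMap.inl ℝ E ℝ)‖ ≤ C + 1)
      fun t ht => by
        filter_upwards [(hfc t ht).norm.eventually_lt_const
          (lt_of_le_of_lt (hC t ht) (lt_add_one C))] with p hp
        exact hp.le
  have hI : uIoc (0 : ℝ) 1 ⊆ Icc 0 1 := by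
    rw [uIoc_of_le zero_le_one]
    exact Ioc_subset_Icc_self
  refine intervalIntegral.hasFDerivAt_integral_of_dominated_of_fderiv_le
    (F := fun y t => F (y, t))
    (F' := fun y t => (fderiv ℝ F (y, t)).comp (ContinuousLinearMap.inl ℝ E ℝ))
    (bound := fun _ => C + 1) (hcd.and hbd) ?_ ?_ ?_ ?_ ?_ ?_
  · filter_upwards [hcd] with y hy
    exact ((hcont y hy).mono hI).aestronglyMeasurable measurableSet_uIoc
  · exact ContinuousOn.intervalIntegrable (by
      rw [uIcc_of_le zero_le_one]
      exact hcont x fun t ht => h t ht)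
  · exact (hcont'.mono hI).aestronglyMeasurable measurableSet_uIoc
  · exact Eventually.of_forall fun t ht y hy => hy.2 t (hI ht)
  · simp
  · refine Eventually.of_forall fun t ht y hy => ?_
    have h1 := ((hy.1 t (hI ht)).differentiableAt (by simp)).hasFDerivAt
    exact h1.comp y (hasFDerivAt_prodMk_left y t)

/-- Induction on n by differentiation under the integral sign; one order of smoothness is lost,
which is harmless for smooth integrands. `V` shares the universe of `E` because the induction
replaces it by `E →L[ℝ] V`. -/
theorem contDiffAt_integral_of_contDiffAt {V : Type u} [NormedAddCommGroup V] [NormedSpace ℝ V]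
    {x : E} (n : ℕ) {F : E × ℝ → V}
    (h : ∀ t ∈ Icc (0 : ℝ) 1, ContDiffAt ℝ (n + 1) F (x, t)) :
    ContDiffAt ℝ n (fun y => ∫ t in (0 : ℝ)..1, F (y, t)) x := by
  induction n generalizing V with
  | zero =>
    have hcd : ∀ᶠ y in 𝓝 x, ∀ t ∈ Icc (0 : ℝ) 1, ContDiffAt ℝ 1 F (y, t) :=
      isCompact_Icc.eventually_forall_of_forall_eventually
        (P := fun y t => ContDiffAt ℝ 1 F (y, t)) fun t ht => by
          exact ContDiffAt.eventually (by simpa using h t ht) (by simp)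
    refine contDiffAt_zero.2 ⟨_, hcd, fun y hy => ?_⟩
    exact (hasFDerivAt_integral_of_contDiffAt hy).continuousAt.continuousWithinAt
  | succ n ih =>
    have hcd : ∀ᶠ y in 𝓝 x, ∀ t ∈ Icc (0 : ℝ) 1, ContDiffAt ℝ 1 F (y, t) :=
      isCompact_Icc.eventually_forall_of_forall_eventually
        (P := fun y t => ContDiffAt ℝ 1 F (y, t)) fun t ht => by
          exact ContDiffAt.eventually ((h t ht).of_le (by simp)) (by simp)
    rw [Nat.cast_succ, contDiffAt_succ_iff_hasFDerivAt]
    refine ⟨_, ⟨_, hcd, fun y hy => hasFDerivAt_integral_of_contDiffAt hy⟩, ?_⟩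
    refine ih (F := fun p => (fderiv ℝ F p).comp (ContinuousLinearMap.inl ℝ E ℝ)) fun t ht => ?_
    exact ((h t ht).fderiv_right (by simp)).clm_comp contDiffAt_const

/-- Hadamard's lemma for the composition with a map having a fixed point. -/
theorem exists_sub_eq_clm_apply {h : E → ℝ} {φ : E → E} {x₀ : E} (hh : ContDiffAt ℝ ∞ h x₀)
    (hφ : ContDiffAt ℝ ∞ φ x₀) (hx₀ : φ x₀ = x₀) :
    ∃ g : E → E →L[ℝ] ℝ, ContDiffAt ℝ ∞ g x₀ ∧ ∀ᶠ x in 𝓝 x₀, h (φ x) - h x = g x (φ x - x) := by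
  -- Average of dh over the segment from x to φ x.
  refine ⟨fun x => ∫ t in (0 : ℝ)..1, fderiv ℝ h (x + t • (φ x - x)), ?_, ?_⟩
  · refine contDiffAt_infty.2 fun n => contDiffAt_integral_of_contDiffAt
      (F := fun p => fderiv ℝ h (p.1 + p.2 • (φ p.1 - p.1))) n fun t _ => ?_
    have h1 : ContDiffAt ℝ (n + 1) (fun p : E × ℝ => p.1 + p.2 • (φ p.1 - p.1)) (x₀, t) := by
      have h2 : ContDiffAt ℝ (n + 1) (fun p : E × ℝ => φ p.1) (x₀, t) :=
        ContDiffAt.comp (x₀, t) (hφ.of_le (by exact_mod_cast le_top)) contDiffAt_fst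
      exact contDiffAt_fst.add (contDiffAt_snd.smul (h2.sub contDiffAt_fst))
    refine ContDiffAt.comp (g := fderiv ℝ h) (x₀, t) ?_ h1
    simp only [hx₀, sub_self, smul_zero, add_zero]
    exact (hh.fderiv_right (m := ∞) (by simp)).of_le (by exact_mod_cast le_top)
  · obtain ⟨ε, hε, hball⟩ := Metric.eventually_nhds_iff_ball.1
      ((hh.of_le (m := 1) (by exact_mod_cast le_top)).eventually (by simp))
    have h1 : ∀ᶠ x in 𝓝 x₀, φ x ∈ Metric.ball x₀ ε :=
      hφ.continuousAt.eventually (by rw [hx₀]; exact Metric.ball_mem_nhds _ hε)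
    filter_upwards [h1, Metric.ball_mem_nhds x₀ hε] with x hx1 hx2
    have hseg : ∀ t ∈ Icc (0 : ℝ) 1, x + t • (φ x - x) ∈ Metric.ball x₀ ε := fun t ht =>
      (convex_ball x₀ ε).add_smul_sub_mem hx2 hx1 ht
    have hd : ∀ t ∈ uIcc (0 : ℝ) 1, HasDerivAt (fun t : ℝ => h (x + t • (φ x - x)))
        (fderiv ℝ h (x + t • (φ x - x)) (φ x - x)) t := fun t ht => by
      rw [uIcc_of_le zero_le_one] at ht
      have h2 := ((hball _ (hseg t ht)).differentiableAt (by simp)).hasFDerivAt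
      have h3 : HasDerivAt (fun t : ℝ => x + t • (φ x - x)) (φ x - x) t := by
        simpa using ((hasDerivAt_id t).smul_const (φ x - x)).const_add x
      exact h2.comp_hasDerivAt t h3
    have hc : ContinuousOn (fun t : ℝ => fderiv ℝ h (x + t • (φ x - x))) (uIcc 0 1) := by
      rw [uIcc_of_le zero_le_one]
      intro t ht
      have h2 := ((hball _ (hseg t ht)).fderiv_right (m := 0) (by simp)).continuousAt
      exact (ContinuousAt.comp (f := fun t : ℝ => x + t • (φ x - x)) h2
        (by fun_prop)).continuousWithinAt
    have h4 := intervalIntegral.integral_eq_sub_of_hasDerivAt hd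
      ((hc.clm_apply continuousOn_const).intervalIntegrable)
    simp only [one_smul, add_sub_cancel, zero_smul, add_zero] at h4
    rw [← h4, ContinuousLinearMap.intervalIntegral_apply hc.intervalIntegrable]

end Hadamard

/-- A solution of a closed linear system of differential equations vanishes near each of its
zeros. -/
theorem eventually_eq_zero_of_fderiv_le {E V : Type*} [NormedAddCommGroup E] [NormedSpace ℝ E]
    [NormedAddCommGroup V] [NormedSpace ℝ V] {u : E → V} {x₀ : E} {K : ℝ}
    (hu : ∀ᶠ x in 𝓝 x₀, DifferentiableAt ℝ u x) (h0 : u x₀ = 0)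
    (hK : ∀ᶠ x in 𝓝 x₀, ‖fderiv ℝ u x‖ ≤ K * ‖u x‖) : ∀ᶠ x in 𝓝 x₀, u x = 0 := by
  obtain ⟨ε, hε, hball⟩ := Metric.eventually_nhds_iff_ball.1 (hu.and hK)
  filter_upwards [Metric.ball_mem_nhds x₀ hε] with x hx
  have hseg : ∀ t ∈ Icc (0 : ℝ) 1, x₀ + t • (x - x₀) ∈ Metric.ball x₀ ε := fun t ht =>
    (convex_ball x₀ ε).add_smul_sub_mem (Metric.mem_ball_self hε) hx ht
  have hd : ∀ t ∈ Icc (0 : ℝ) 1, HasDerivAt (fun t : ℝ => u (x₀ + t • (x - x₀)))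
      (fderiv ℝ u (x₀ + t • (x - x₀)) (x - x₀)) t := fun t ht => by
    have h3 : HasDerivAt (fun t : ℝ => x₀ + t • (x - x₀)) (x - x₀) t := by
      simpa using ((hasDerivAt_id t).smul_const (x - x₀)).const_add x₀
    exact (hball _ (hseg t ht)).1.hasFDerivAt.comp_hasDerivAt t h3
  -- Gronwall's inequality along the segment from x₀ to x.
  have := eq_zero_of_abs_deriv_le_mul_abs_self_of_eq_zero_right (K := K * ‖x - x₀‖)
    (fun t ht => (hd t ht).continuousAt.continuousWithinAt)
    (fun t ht => (hd t (Ico_subset_Icc_self ht)).hasDerivWithinAt) (by simpa using h0)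
    (fun t ht => by
      refine (ContinuousLinearMap.le_opNorm _ _).trans ?_
      have := (hball _ (hseg t (Ico_subset_Icc_self ht))).2
      calc _ ≤ (K * ‖u (x₀ + t • (x - x₀))‖) * ‖x - x₀‖ := by gcongr
        _ = _ := by ring) 1 (right_mem_Icc.2 zero_le_one)
  simpa using this

end Analysis

/-! ### The ring of smooth germs, its derivations and pull-backs. -/

section Germs

open Set Filter
open scoped Topology

variable {E : Type*} [NormedAddCommGroup E] [NormedSpace ℝ E] (x₀ : E)

/-- The algebra of real functions which are smooth at `x₀`. -/
def smoothAt : Subalgebra ℝ (E → ℝ) where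
  carrier := {f | ContDiffAt ℝ ∞ f x₀}
  mul_mem' {f g} (hf : ContDiffAt ℝ ∞ f x₀) (hg : ContDiffAt ℝ ∞ g x₀) := hf.mul hg
  add_mem' {f g} (hf : ContDiffAt ℝ ∞ f x₀) (hg : ContDiffAt ℝ ∞ g x₀) := hf.add hg
  algebraMap_mem' c := show ContDiffAt ℝ ∞ (fun _ : E => c) x₀ from contDiffAt_const

/-- The ideal of functions which vanish near `x₀`. -/
def nullAt : Ideal (smoothAt x₀) where
  carrier := {f | ∀ᶠ x in 𝓝 x₀, (f : E → ℝ) x = 0}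
  zero_mem' := Eventually.of_forall fun _ => rfl
  add_mem' {f g} hf hg := by
    filter_upwards [hf, hg] with x h1 h2
    simp [h1, h2]
  smul_mem' c f hf := by
    filter_upwards [hf] with x h1
    simp [h1]

/-- The ring of germs at `x₀` of smooth real functions. -/
def SmoothGerm : Type _ := smoothAt x₀ ⧸ nullAt x₀

instance : CommRing (SmoothGerm x₀) := inferInstanceAs (CommRing (smoothAt x₀ ⧸ nullAt x₀))

instance : Algebra ℝ (SmoothGerm x₀) := inferInstanceAs (Algebra ℝ (smoothAt x₀ ⧸ nullAt x₀))

/-- The projection of smooth functions to germs. -/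
def toGerm : smoothAt x₀ →+* SmoothGerm x₀ := Ideal.Quotient.mk (nullAt x₀)

variable {x₀}

/-- The germ at `x₀` of a function which is smooth at `x₀`. -/
def germ (f : E → ℝ) (hf : ContDiffAt ℝ ∞ f x₀) : SmoothGerm x₀ :=
  toGerm x₀ ⟨f, hf⟩

theorem germ_eq_iff {f g : E → ℝ} {hf : ContDiffAt ℝ ∞ f x₀} {hg : ContDiffAt ℝ ∞ g x₀} :
    germ f hf = germ g hg ↔ ∀ᶠ x in 𝓝 x₀, f x = g x := by
  refine (Ideal.Quotient.eq (I := nullAt x₀)).trans ?_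
  refine eventually_congr (Eventually.of_forall fun x => ?_)
  exact sub_eq_zero

theorem exists_germ (r : SmoothGerm x₀) : ∃ f, ∃ hf : ContDiffAt ℝ ∞ f x₀, germ f hf = r := by
  obtain ⟨⟨f, hf⟩, rfl⟩ := Ideal.Quotient.mk_surjective r
  exact ⟨f, hf, rfl⟩

theorem germ_add {f g : E → ℝ} (hf : ContDiffAt ℝ ∞ f x₀) (hg : ContDiffAt ℝ ∞ g x₀) :
    germ f hf + germ g hg = germ (fun x => f x + g x) (hf.add hg) := rfl

theorem germ_sub {f g : E → ℝ} (hf : ContDiffAt ℝ ∞ f x₀) (hg : ContDiffAt ℝ ∞ g x₀) :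
    germ f hf - germ g hg = germ (fun x => f x - g x) (hf.sub hg) := rfl

theorem germ_mul {f g : E → ℝ} (hf : ContDiffAt ℝ ∞ f x₀) (hg : ContDiffAt ℝ ∞ g x₀) :
    germ f hf * germ g hg = germ (fun x => f x * g x) (hf.mul hg) := rfl

theorem germ_sum {κ : Type*} [Fintype κ] {f : κ → E → ℝ} (hf : ∀ k, ContDiffAt ℝ ∞ (f k) x₀) :
    ∑ k, germ (f k) (hf k) = germ (fun x => ∑ k, f k x) (ContDiffAt.sum fun k _ => hf k) := by
  simp only [germ, ← map_sum]
  congr 1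
  ext x
  simp

/-- The value of a germ. -/
def evalGerm : SmoothGerm x₀ →ₐ[ℝ] ℝ :=
  Ideal.Quotient.liftₐ (nullAt x₀)
    ((Pi.evalAlgHom ℝ (fun _ : E => ℝ) x₀).comp (smoothAt x₀).val) fun _ hf => hf.self_of_nhds

theorem evalGerm_germ {f : E → ℝ} (hf : ContDiffAt ℝ ∞ f x₀) : evalGerm (germ f hf) = f x₀ := rfl

theorem isUnit_of_evalGerm_ne_zero {r : SmoothGerm x₀} (hr : evalGerm r ≠ 0) : IsUnit r := by
  obtain ⟨f, hf, rfl⟩ := exists_germ r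
  rw [evalGerm_germ] at hr
  refine isUnit_iff_exists_inv.2 ⟨germ (fun x => (f x)⁻¹) (hf.inv hr), ?_⟩
  rw [germ_mul]
  refine germ_eq_iff (g := fun _ => 1) (hg := contDiffAt_const).2 ?_
  filter_upwards [hf.continuousAt.eventually_ne hr] with x hx
  exact mul_inv_cancel₀ hx

theorem ContDiffAt.fderiv_apply_smooth {f : E → ℝ} {e : E → E} (hf : ContDiffAt ℝ ∞ f x₀)
    (he : ContDiffAt ℝ ∞ e x₀) : ContDiffAt ℝ ∞ (fun x => fderiv ℝ f x (e x)) x₀ :=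
  (hf.fderiv_right (m := ∞) (by simp)).clm_apply he

theorem ContDiffAt.eventually_differentiableAt {F : Type*} [NormedAddCommGroup F] [NormedSpace ℝ F]
    {f : E → F} (hf : ContDiffAt ℝ ∞ f x₀) : ∀ᶠ x in 𝓝 x₀, DifferentiableAt ℝ f x := by
  filter_upwards [(hf.of_le (m := 1) (by exact_mod_cast le_top)).eventually (by simp)] with x hx
  exact hx.differentiableAt (by simp)

/-- The derivative of a germ along a smooth vector field, as a function. -/
noncomputable def derivFun (e : E → E) (he : ContDiffAt ℝ ∞ e x₀) (r : SmoothGerm x₀) :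
    SmoothGerm x₀ :=
  germ _ (ContDiffAt.fderiv_apply_smooth (exists_germ r).choose_spec.choose he)

/-- `derivFun` picks a representative; equality near x₀ passes to derivatives, so the choice is
immaterial. -/
theorem derivFun_germ {e : E → E} (he : ContDiffAt ℝ ∞ e x₀) {f : E → ℝ}
    (hf : ContDiffAt ℝ ∞ f x₀) :
    derivFun e he (germ f hf) = germ _ (hf.fderiv_apply_smooth he) := by
  refine germ_eq_iff.2 ?_
  have h := germ_eq_iff.1 (exists_germ (germ f hf)).choose_spec.choose_spec
  filter_upwards [h.eventually_nhds] with x hx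
  rw [EventuallyEq.fderiv_eq hx]

/-- The derivation of the ring of germs given by a smooth vector field. -/
noncomputable def germDeriv (e : E → E) (he : ContDiffAt ℝ ∞ e x₀) :
    Derivation ℝ (SmoothGerm x₀) (SmoothGerm x₀) :=
  Derivation.mk'
    { toFun := derivFun e he
      map_add' := fun r s => by
        obtain ⟨f, hf, rfl⟩ := exists_germ r
        obtain ⟨g, hg, rfl⟩ := exists_germ s
        rw [germ_add, derivFun_germ, derivFun_germ, derivFun_germ, germ_add, germ_eq_iff]
        filter_upwards [hf.eventually_differentiableAt, hg.eventually_differentiableAt]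
          with x h1 h2
        rw [fderiv_fun_add h1 h2]
        rfl
      map_smul' := fun c r => by
        obtain ⟨f, hf, rfl⟩ := exists_germ r
        have h : ∀ (f : E → ℝ) (hf : ContDiffAt ℝ ∞ f x₀),
            c • germ f hf = germ (fun x => c * f x) (contDiffAt_const.mul hf) := fun _ _ => rfl
        rw [RingHom.id_apply, derivFun_germ, h, h, derivFun_germ, germ_eq_iff]
        filter_upwards [hf.eventually_differentiableAt] with x h1
        rw [fderiv_const_mul h1]
        rfl }
    fun r s => by
      obtain ⟨f, hf, rfl⟩ := exists_germ r
      obtain ⟨g, hg, rfl⟩ := exists_germ s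
      simp only [LinearMap.coe_mk, AddHom.coe_mk, smul_eq_mul]
      rw [germ_mul, derivFun_germ, derivFun_germ, derivFun_germ, germ_mul, germ_mul, germ_add,
        germ_eq_iff]
      filter_upwards [hf.eventually_differentiableAt, hg.eventually_differentiableAt]
        with x h1 h2
      rw [fderiv_fun_mul h1 h2]
      simp

theorem germDeriv_germ {e : E → E} (he : ContDiffAt ℝ ∞ e x₀) {f : E → ℝ}
    (hf : ContDiffAt ℝ ∞ f x₀) :
    germDeriv e he (germ f hf) = germ (fun x => fderiv ℝ f x (e x)) (hf.fderiv_apply_smooth he) :=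
  derivFun_germ he hf

theorem ContDiffAt.comp_fixed {F : Type*} [NormedAddCommGroup F] [NormedSpace ℝ F] {f : E → F}
    {φ : E → E} (hf : ContDiffAt ℝ ∞ f x₀) (hφ : ContDiffAt ℝ ∞ φ x₀) (hx₀ : φ x₀ = x₀) :
    ContDiffAt ℝ ∞ (fun x => f (φ x)) x₀ :=
  ContDiffAt.comp x₀ (by rwa [hx₀]) hφ

/-- The pull-back of germs by a smooth map fixing `x₀`. -/
def pullGerm (φ : E → E) (hφ : ContDiffAt ℝ ∞ φ x₀) (hx₀ : φ x₀ = x₀) :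
    SmoothGerm x₀ →+* SmoothGerm x₀ :=
  Ideal.Quotient.lift (nullAt x₀)
    ((toGerm x₀).comp
      { toFun := fun f => (⟨fun x => (f : E → ℝ) (φ x), f.2.comp_fixed hφ hx₀⟩ : smoothAt x₀)
        map_one' := rfl
        map_mul' := fun _ _ => rfl
        map_zero' := rfl
        map_add' := fun _ _ => rfl })
    fun f hf => by
      refine Ideal.Quotient.eq_zero_iff_mem.2 ?_
      have hf' : ∀ᶠ y in 𝓝 (φ x₀), (f : E → ℝ) y = 0 := by
        rw [hx₀]
        exact hf
      exact hφ.continuousAt.eventually hf'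

theorem pullGerm_germ {φ : E → E} (hφ : ContDiffAt ℝ ∞ φ x₀) (hx₀ : φ x₀ = x₀) {f : E → ℝ}
    (hf : ContDiffAt ℝ ∞ f x₀) :
    pullGerm φ hφ hx₀ (germ f hf) = germ (fun x => f (φ x)) (hf.comp_fixed hφ hx₀) := rfl

end Germs

/-! ### Coordinate germs and frames; vanishing of stable ideals. -/

section Coordinates

open Set Filter
open scoped Topology

variable {E : Type*} [NormedAddCommGroup E] [NormedSpace ℝ E] [FiniteDimensional ℝ E] {x₀ : E}
  {σ : Type*} (B : Module.Basis σ ℝ E)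

theorem contDiffAt_coord (s : σ) : ContDiffAt ℝ ∞ (fun x => B.coord s x) x₀ :=
  (LinearMap.toContinuousLinearMap (B.coord s)).contDiff.contDiffAt

/-- The germ of a linear coordinate function. -/
noncomputable def coordGerm (s : σ) : SmoothGerm x₀ :=
  germ (fun x => B.coord s x) (contDiffAt_coord B s)

/-- Hadamard's lemma in the ring of germs. -/
theorem pullGerm_sub_mem [Fintype σ] {φ : E → E} (hφ : ContDiffAt ℝ ∞ φ x₀) (hx₀ : φ x₀ = x₀)
    (r : SmoothGerm x₀) :
    pullGerm φ hφ hx₀ r - r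
      ∈ Ideal.span (Set.range fun s => pullGerm φ hφ hx₀ (coordGerm B s) - coordGerm B s) := by
  obtain ⟨f, hf, rfl⟩ := exists_germ r
  obtain ⟨g, hg, hfg⟩ := exists_sub_eq_clm_apply hf hφ hx₀
  have h : pullGerm φ hφ hx₀ (germ f hf) - germ f hf =
      ∑ s, germ (fun x => g x (B s)) (hg.clm_apply contDiffAt_const)
        * (pullGerm φ hφ hx₀ (coordGerm B s) - coordGerm B s) := by
    simp only [coordGerm, pullGerm_germ, germ_sub, germ_mul, germ_sum]
    rw [germ_eq_iff]
    filter_upwards [hfg] with x hx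
    rw [hx]
    conv_lhs => rw [← B.sum_repr (φ x - x)]
    simp [mul_comm]
  rw [h]
  exact Ideal.sum_mem _ fun s _ => Ideal.mul_mem_left _ _ (Ideal.subset_span ⟨s, rfl⟩)

end Coordinates

section Frames

open Set Filter
open scoped Topology

variable {E : Type*} [NormedAddCommGroup E] [NormedSpace ℝ E] {x₀ : E}
  {κ : Type*} [Fintype κ]

/-- The linear map `c ↦ ∑ c k • e k x` given by a family of vector fields. -/
noncomputable def frameMap (e : κ → E → E) (x : E) : (κ → ℝ) →L[ℝ] E :=
  ∑ k, (ContinuousLinearMap.proj (R := ℝ) (φ := fun _ : κ => ℝ) k).smulRight (e k x)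

theorem frameMap_apply (e : κ → E → E) (x : E) (c : κ → ℝ) :
    frameMap e x c = ∑ k, c k • e k x := by
  simp [frameMap]

theorem frameMap_single [DecidableEq κ] (e : κ → E → E) (x : E) (k : κ) :
    frameMap e x (Pi.single k 1) = e k x := by
  simp [frameMap_apply, Pi.single_apply, ite_smul]

theorem contDiffAt_frameMap {e : κ → E → E} (he : ∀ k, ContDiffAt ℝ ∞ (e k) x₀) :
    ContDiffAt ℝ ∞ (frameMap e) x₀ := by
  unfold frameMap
  refine ContDiffAt.sum fun k _ => ?_
  exact contDiffAt_const.smulRight (he k)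

/-- The coefficients of vectors with respect to a frame. -/
noncomputable def coframe (e : κ → E → E) (x : E) : E →L[ℝ] κ → ℝ :=
  (frameMap e x).inverse

theorem contDiffAt_coframe {e : κ → E → E} (he : ∀ k, ContDiffAt ℝ ∞ (e k) x₀)
    (h₀ : (frameMap e x₀).IsInvertible) : ContDiffAt ℝ ∞ (coframe e) x₀ := by
  obtain ⟨L, hL⟩ := h₀
  refine ContDiffAt.comp (g := ContinuousLinearMap.inverse) x₀ ?_ (contDiffAt_frameMap he)
  rw [← hL]
  exact contDiffAt_map_inverse L

theorem eventually_isInvertible_frameMap {e : κ → E → E} (he : ∀ k, ContDiffAt ℝ ∞ (e k) x₀)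
    (h₀ : (frameMap e x₀).IsInvertible) : ∀ᶠ x in 𝓝 x₀, (frameMap e x).IsInvertible := by
  obtain ⟨L, hL⟩ := h₀
  have := (contDiffAt_frameMap he).continuousAt.eventually
    (by rw [← hL]; exact ContinuousLinearEquiv.nhds L)
  filter_upwards [this] with x hx
  exact hx

theorem coframe_frameMap {e : κ → E → E} {x : E} (h : (frameMap e x).IsInvertible) (c : κ → ℝ) :
    coframe e x (frameMap e x c) = c := by
  obtain ⟨L, hL⟩ := h
  simp [coframe, ← hL]

theorem frameMap_coframe {e : κ → E → E} {x : E} (h : (frameMap e x).IsInvertible) (v : E) :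
    frameMap e x (coframe e x v) = v := by
  obtain ⟨L, hL⟩ := h
  simp [coframe, ← hL]

/-- A finitely generated ideal of germs vanishing at `x₀` which is stable under differentiation
is zero. -/
theorem eq_zero_of_mem_stable_ideal {e : κ → E → E} (he : ∀ k, ContDiffAt ℝ ∞ (e k) x₀)
    (h₀ : (frameMap e x₀).IsInvertible) {I : Ideal (SmoothGerm x₀)} (hfg : I.FG)
    (hev : ∀ r ∈ I, evalGerm r = 0) (hI : ∀ k, ∀ r ∈ I, germDeriv (e k) (he k) r ∈ I)
    {r : SmoothGerm x₀} (hr : r ∈ I) : r = 0 := by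
  obtain ⟨m, v, hv⟩ := Submodule.fg_iff_exists_fin_generating_family.1 hfg
  have hmem : ∀ i, v i ∈ I := fun i => hv ▸ Submodule.subset_span ⟨i, rfl⟩
  choose f hf hfv using fun i => exists_germ (v i)
  -- Stability, written on generators, is a closed linear system for them.
  have hD : ∀ k i, ∃ c : Fin m → SmoothGerm x₀, ∑ j, c j • v j = germDeriv (e k) (he k) (v i) :=
    fun k i => (Submodule.mem_span_range_iff_exists_fun _).1 (hv ▸ hI k _ (hmem i))
  choose c hc using hD
  choose μ hμ hμc using fun k i j => exists_germ (c k i j)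
  have hsys : ∀ k i, ∀ᶠ x in 𝓝 x₀, fderiv ℝ (f i) x (e k x) = ∑ j, μ k i j x * f j x := by
    intro k i
    have := hc k i
    simp only [← hfv, ← hμc, smul_eq_mul, germ_mul, germ_sum, germDeriv_germ] at this
    filter_upwards [germ_eq_iff.1 this] with x hx
    exact hx.symm
  let u : E → Fin m → ℝ := fun x i => f i x
  have hu0 : u x₀ = 0 := funext fun i => by
    have := hev _ (hmem i)
    rwa [← hfv, evalGerm_germ] at this
  have hud : ContDiffAt ℝ ∞ u x₀ := contDiffAt_pi.2 hf
  have hμb : ∀ k i j, ∀ᶠ x in 𝓝 x₀, |μ k i j x| ≤ |μ k i j x₀| + 1 := fun k i j => by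
    filter_upwards [(hμ k i j).continuousAt.abs.eventually_lt_const (lt_add_one _)] with x hx
    exact hx.le
  -- `C` bounds the coefficients of the system near x₀; `C'` bounds the coframe and converts
  -- estimates along the frame fields into one for the full derivative.
  set C : ℝ := ∑ k, ∑ i, ∑ j, (|μ k i j x₀| + 1) with hC
  have hC0 : 0 ≤ C := by positivity
  set C' : ℝ := ‖coframe e x₀‖ + 1
  have hC' : ∀ᶠ x in 𝓝 x₀, ‖coframe e x‖ ≤ C' := by
    filter_upwards [(contDiffAt_coframe he h₀).continuousAt.norm.eventually_lt_const
      (lt_add_one _)] with x hx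
    exact hx.le
  have hzero := eventually_eq_zero_of_fderiv_le (K := C * C') hud.eventually_differentiableAt hu0
    (by
      filter_upwards [hud.eventually_differentiableAt, eventually_isInvertible_frameMap he h₀, hC',
        eventually_all.2 fun k => eventually_all.2 (hsys k),
        eventually_all.2 fun k => eventually_all.2 fun i => eventually_all.2 (hμb k i)]
        with x hdx hinv hcx hsx hμx
      have hu : 0 ≤ ‖u x‖ := norm_nonneg _
      refine ContinuousLinearMap.opNorm_le_bound _ (by positivity) fun w => ?_
      have hcomp : ∀ i, fderiv ℝ u x w i = fderiv ℝ (f i) x w := fun i => by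
        have := (hasFDerivAt_pi'.1 hdx.hasFDerivAt i).fderiv
        rw [this]
        rfl
      refine (pi_norm_le_iff_of_nonneg (by positivity)).2 fun i => ?_
      have hw : w = ∑ k, coframe e x w k • e k x := by
        rw [← frameMap_apply, frameMap_coframe hinv]
      have hck : ∀ k, |coframe e x w k| ≤ C' * ‖w‖ := fun k => by
        refine (norm_le_pi_norm (coframe e x w) k).trans ((coframe e x).le_opNorm w |>.trans ?_)
        gcongr
      rw [hcomp]
      conv_lhs => rw [hw]
      simp only [map_sum, map_smul, smul_eq_mul, hsx, Real.norm_eq_abs]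
      calc |∑ k, coframe e x w k * ∑ j, μ k i j x * f j x|
          ≤ ∑ k, (C' * ‖w‖) * ∑ j, (|μ k i j x₀| + 1) * ‖u x‖ := by
            refine (Finset.abs_sum_le_sum_abs _ _).trans (Finset.sum_le_sum fun k _ => ?_)
            rw [abs_mul]
            gcongr
            · exact hck k
            · refine (Finset.abs_sum_le_sum_abs _ _).trans (Finset.sum_le_sum fun j _ => ?_)
              rw [abs_mul]
              gcongr
              · exact hμx k i j
              · exact norm_le_pi_norm (u x) j
        _ = (∑ k, ∑ j, (|μ k i j x₀| + 1)) * (C' * ‖u x‖ * ‖w‖) := by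
            rw [← Finset.mul_sum, Finset.sum_congr rfl fun k _ => (Finset.sum_mul _ _ _).symm,
              ← Finset.sum_mul]
            ring
        _ ≤ C * (C' * ‖u x‖ * ‖w‖) := by
            have : ∑ k, ∑ j, (|μ k i j x₀| + 1) ≤ C := by
              refine Finset.sum_le_sum fun k _ => ?_
              exact Finset.single_le_sum (f := fun i => ∑ j, (|μ k i j x₀| + 1))
                (fun i _ => Finset.sum_nonneg fun j _ => add_nonneg (abs_nonneg _) zero_le_one)
                (Finset.mem_univ i)
            gcongr
        _ = C * C' * ‖u x‖ * ‖w‖ := by ring)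
  have hv0 : ∀ i, v i = 0 := fun i => by
    rw [← hfv]
    refine germ_eq_iff (g := fun _ => 0) (hg := contDiffAt_const).2 ?_
    filter_upwards [hzero] with x hx
    exact congrFun hx i
  rw [← hv] at hr
  obtain ⟨c, rfl⟩ := (Submodule.mem_span_range_iff_exists_fun _).1 hr
  exact Finset.sum_eq_zero fun i _ => by rw [hv0, smul_zero]

end Frames

/-! ### The local theorem on a vector space. -/

section Local

open Set Filter
open scoped Topology

variable {E : Type*} [NormedAddCommGroup E] [NormedSpace ℝ E]

/-- The negative of the exterior derivative of a one-form. -/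
noncomputable def leviTwoForm (θ : E → E →L[ℝ] ℝ) (x₀ : E) : E →ₗ[ℝ] E →ₗ[ℝ] ℝ :=
  LinearMap.mk₂ ℝ (fun v w => fderiv ℝ θ x₀ w v - fderiv ℝ θ x₀ v w)
    (fun _ _ _ => by simp only [map_add, add_apply]; ring)
    (fun _ _ _ => by
      simp only [map_smul, smul_apply, smul_eq_mul]; ring)
    (fun _ _ _ => by simp only [map_add, add_apply]; ring)
    (fun _ _ _ => by
      simp only [map_smul, smul_apply, smul_eq_mul]; ring)

theorem leviTwoForm_apply (θ : E → E →L[ℝ] ℝ) (x₀ v w : E) :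
    leviTwoForm θ x₀ v w = fderiv ℝ θ x₀ w v - fderiv ℝ θ x₀ v w := rfl

/-- The bracket of fields in the kernel of a one-form, modulo this kernel, is tensorial. -/
theorem form_lieBracket {θ : E → E →L[ℝ] ℝ} {V W : E → E} {x₀ : E} (hθ : DifferentiableAt ℝ θ x₀)
    (hV : DifferentiableAt ℝ V x₀) (hW : DifferentiableAt ℝ W x₀)
    (hθV : ∀ᶠ x in 𝓝 x₀, θ x (V x) = 0) (hθW : ∀ᶠ x in 𝓝 x₀, θ x (W x) = 0) :
    θ x₀ (VectorField.lieBracket ℝ V W x₀) = leviTwoForm θ x₀ (V x₀) (W x₀) := by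
  have key : ∀ X : E → E, DifferentiableAt ℝ X x₀ → (∀ᶠ x in 𝓝 x₀, θ x (X x) = 0) → ∀ v,
      θ x₀ (fderiv ℝ X x₀ v) = - fderiv ℝ θ x₀ v (X x₀) := fun X hX h v => by
    have h1 := (hθ.hasFDerivAt.clm_apply hX.hasFDerivAt).fderiv
    have h2 : fderiv ℝ (fun x => θ x (X x)) x₀ = 0 := by
      rw [EventuallyEq.fderiv_eq (f := fun _ => (0 : ℝ)) h]
      simp
    rw [h2] at h1
    have h3 := congrArg (fun L => L v) h1
    simp at h3
    linarith
  rw [VectorField.lieBracket, map_sub, key W hW hθW, key V hV hθV, leviTwoForm_apply]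
  ring

variable {ι : Type*} {x₀ : E}

/-- The frame consisting of the fields `e` and of the constant field `t`. -/
def fullFrame (e : ι → E → E) (t : E) : Option ι → E → E
  | none => fun _ => t
  | some i => e i

theorem contDiffAt_fullFrame {e : ι → E → E} (he : ∀ i, ContDiffAt ℝ ∞ (e i) x₀) (t : E)
    (k : Option ι) : ContDiffAt ℝ ∞ (fullFrame e t k) x₀ := by
  rcases k with _ | i
  · exact contDiffAt_const
  · exact he i

variable [Fintype ι]

/-- The form vanishing on the fields `e` with the value `1` at `t`. -/
noncomputable def contactForm (e : ι → E → E) (t : E) (x : E) : E →L[ℝ] ℝ :=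
  (ContinuousLinearMap.proj (R := ℝ) (φ := fun _ : Option ι => ℝ) none).comp
    (coframe (fullFrame e t) x)

theorem contactForm_apply (e : ι → E → E) (t x v : E) :
    contactForm e t x v = coframe (fullFrame e t) x v none := rfl

theorem contDiffAt_contactForm {e : ι → E → E} {t : E} (he : ∀ i, ContDiffAt ℝ ∞ (e i) x₀)
    (h₀ : (frameMap (fullFrame e t) x₀).IsInvertible) : ContDiffAt ℝ ∞ (contactForm e t) x₀ :=
  contDiffAt_const.clm_comp (contDiffAt_coframe (contDiffAt_fullFrame he t) h₀)

theorem frameMap_fullFrame (e : ι → E → E) (t x : E) (c : Option ι → ℝ) :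
    frameMap (fullFrame e t) x c = c none • t + frameMap e x fun i => c (some i) := by
  simp [frameMap_apply, Fintype.sum_option, fullFrame]

theorem coframe_frame [DecidableEq ι] {e : ι → E → E} {t x : E}
    (h : (frameMap (fullFrame e t) x).IsInvertible) (k : Option ι) :
    coframe (fullFrame e t) x (fullFrame e t k x) = Pi.single k 1 := by
  rw [← frameMap_single (fullFrame e t) x k, coframe_frameMap h]

theorem frameMap_of_contactForm_eq_zero {e : ι → E → E} {t x : E}
    (h : (frameMap (fullFrame e t) x).IsInvertible) {v : E} (hv : contactForm e t x v = 0) :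
    frameMap e x (fun i => coframe (fullFrame e t) x v (some i)) = v := by
  have := frameMap_coframe h v
  rwa [frameMap_fullFrame, ← contactForm_apply, hv, zero_smul, zero_add] at this

theorem contactForm_frameMap {e : ι → E → E} {t x : E}
    (h : (frameMap (fullFrame e t) x).IsInvertible) (c : ι → ℝ) :
    contactForm e t x (frameMap e x c) = 0 := by
  have := congrFun (coframe_frameMap h fun k => k.elim 0 c) none
  rwa [frameMap_fullFrame, Option.elim_none, zero_smul, zero_add] at this

theorem frameMap_injective {e : ι → E → E} {t x : E}
    (h : (frameMap (fullFrame e t) x).IsInvertible) : Function.Injective (frameMap e x) := by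
  intro c d hcd
  have h1 : frameMap (fullFrame e t) x (fun k => k.elim 0 c)
      = frameMap (fullFrame e t) x (fun k => k.elim 0 d) := by
    simp only [frameMap_fullFrame, Option.elim_none, Option.elim_some]
    rw [show (fun i => c i) = c from rfl, hcd]
  have h2 := congrArg (coframe (fullFrame e t) x) h1
  rw [coframe_frameMap h, coframe_frameMap h] at h2
  funext i
  exact congrFun h2 (some i)

/-- A local diffeomorphism preserving an almost CR structure on a vector space with nondegenerate
Levi form is the identity if it has the `2`-jet of the identity at one point. -/
theorem eventually_eq_id_of_jet [FiniteDimensional ℝ E] [Nonempty ι]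
    {e je : ι → E → E} {t : E} {φ : E → E}
    (he : ∀ i, ContDiffAt ℝ ∞ (e i) x₀) (hje : ∀ i, ContDiffAt ℝ ∞ (je i) x₀)
    (h₀ : (frameMap (fullFrame e t) x₀).IsInvertible)
    (hJ : ∀ i, ∀ᶠ x in 𝓝 x₀, contactForm e t x (je i x) = 0)
    (hJ_sq : ∀ c d, frameMap je x₀ c = frameMap e x₀ d → frameMap je x₀ d = - frameMap e x₀ c)
    (hlevi : ∀ c, (∀ d, leviTwoForm (contactForm e t) x₀ (frameMap e x₀ c) (frameMap e x₀ d)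
      + leviTwoForm (contactForm e t) x₀ (frameMap je x₀ c) (frameMap je x₀ d) = 0) → c = 0)
    (hφ : ContDiffAt ℝ ∞ φ x₀) (hφ0 : φ x₀ = x₀)
    (hφ1 : fderiv ℝ φ x₀ = ContinuousLinearMap.id ℝ E) (hφ2 : fderiv ℝ (fderiv ℝ φ) x₀ = 0)
    (hφH : ∀ i, ∀ᶠ x in 𝓝 x₀, contactForm e t (φ x) (fderiv ℝ φ x (e i x)) = 0)
    (hφJ : ∀ i, ∀ᶠ x in 𝓝 x₀, ∀ c, fderiv ℝ φ x (e i x) = frameMap e (φ x) c →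
      fderiv ℝ φ x (je i x) = frameMap je (φ x) c) :
    ∀ᶠ x in 𝓝 x₀, φ x = x := by
  classical
  set f := fullFrame e t with hf
  have hfs : ∀ k, ContDiffAt ℝ ∞ (f k) x₀ := contDiffAt_fullFrame he t
  have hco : ContDiffAt ℝ ∞ (coframe f) x₀ := contDiffAt_coframe hfs h₀
  have hinv : ∀ᶠ x in 𝓝 x₀, (frameMap f x).IsInvertible := eventually_isInvertible_frameMap hfs h₀
  have hφt : Tendsto φ (𝓝 x₀) (𝓝 x₀) := by
    have := hφ.continuousAt
    rwa [ContinuousAt, hφ0] at this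
  have hinvφ : ∀ᶠ x in 𝓝 x₀, (frameMap f (φ x)).IsInvertible := hφt.eventually hinv
  have hdφ : ContDiffAt ℝ ∞ (fderiv ℝ φ) x₀ := hφ.fderiv_right (by simp)
  have hcoφ : ContDiffAt ℝ ∞ (fun x => coframe f (φ x)) x₀ := hco.comp_fixed hφ hφ0
  have hC : ∀ i j k,
      ContDiffAt ℝ ∞ (fun x => coframe f x (VectorField.lieBracket ℝ (f i) (f j) x) k) x₀ :=
    fun i j k => contDiffAt_pi.1 (hco.clm_apply
      ((((hfs j).fderiv_right (m := ∞) (by simp)).clm_apply (hfs i)).sub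
        (((hfs i).fderiv_right (m := ∞) (by simp)).clm_apply (hfs j)))) k
  have hG : ∀ i k, ContDiffAt ℝ ∞ (fun x => coframe f (φ x) (fderiv ℝ φ x (f i x)) k) x₀ :=
    fun i k => contDiffAt_pi.1 (hcoφ.clm_apply (hdφ.clm_apply (hfs i))) k
  have hJm : ∀ i k, ContDiffAt ℝ ∞ (fun x => coframe f x (je i x) (some k)) x₀ :=
    fun i k => contDiffAt_pi.1 (hco.clm_apply (hje i)) (some k)
  let B := Module.finBasis ℝ E
  -- The fields `je i` lie in H, so discarding the transversal coefficient loses nothing.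
  let Jlin : (ι → ℝ) →ₗ[ℝ] ι → ℝ :=
    LinearMap.funLeft ℝ ℝ some ∘ₗ (coframe f x₀).toLinearMap ∘ₗ (frameMap je x₀).toLinearMap
  have hJlin : ∀ c, frameMap e x₀ (Jlin c) = frameMap je x₀ c := fun c => by
    refine frameMap_of_contactForm_eq_zero h₀ ?_
    rw [ContinuousLinearMap.coe_coe, frameMap_apply, map_sum]
    exact Finset.sum_eq_zero fun i _ => by rw [map_smul, (hJ i).self_of_nhds, smul_zero]
  have hinj := frameMap_injective h₀
  let P : CRFrameData ι (Fin (Module.finrank ℝ E)) (SmoothGerm x₀) (ι → ℝ) :=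
    { ev := evalGerm
      isUnit_of_ev := fun r hr => isUnit_of_evalGerm_ne_zero hr
      D := fun k => germDeriv (f k) (hfs k)
      C := fun i j k => germ _ (hC i j k)
      bracket := fun i j h => by
        obtain ⟨h, hh, rfl⟩ := exists_germ h
        simp only [germDeriv_germ, germ_sub, germ_mul, germ_sum]
        rw [germ_eq_iff]
        filter_upwards [hinv, (hfs i).eventually_differentiableAt,
          (hfs j).eventually_differentiableAt,
          (hh.fderiv_right (m := ∞) (by simp)).eventually_differentiableAt,
          (hh.of_le (m := 2) (WithTop.coe_le_coe.2 le_top)).eventually (by simp)]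
          with x hx hi hj hdh hh2
        have hsymm := hh2.isSymmSndFDerivAt (by simp)
        rw [(hdh.hasFDerivAt.clm_apply hi.hasFDerivAt).fderiv,
          (hdh.hasFDerivAt.clm_apply hj.hasFDerivAt).fderiv]
        have h1 : fderiv ℝ h x (VectorField.lieBracket ℝ (f i) (f j) x)
            = ∑ k, coframe f x (VectorField.lieBracket ℝ (f i) (f j) x) k * fderiv ℝ h x (f k x) := by
          conv_lhs => rw [← frameMap_coframe hx (VectorField.lieBracket ℝ (f i) (f j) x)]
          simp [frameMap_apply]
        rw [← h1, VectorField.lieBracket]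
        have h2 := hsymm (f i x) (f j x)
        simp [h2]
      pull := pullGerm φ hφ hφ0
      x := coordGerm B
      pull_sub_mem := pullGerm_sub_mem B hφ hφ0
      G := fun i k => germ _ (hG i k)
      chain := fun i h => by
        obtain ⟨h, hh, rfl⟩ := exists_germ h
        simp only [germDeriv_germ, pullGerm_germ, germ_mul, germ_sum]
        rw [germ_eq_iff]
        filter_upwards [hinvφ, hφ.eventually_differentiableAt,
          hφt.eventually hh.eventually_differentiableAt] with x hx h1 h2
        rw [HasFDerivAt.fderiv (f := fun x => h (φ x)) (h2.hasFDerivAt.comp x h1.hasFDerivAt)]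
        have h3 := frameMap_coframe hx (fderiv ℝ φ x (f i x))
        conv_lhs => rw [ContinuousLinearMap.comp_apply, ← h3]
        simp [frameMap_apply]
      frame := fun y hy => by
        choose y' hy' hyy using fun k => exists_germ (y k)
        have h1 : ∀ s, ∀ᶠ x in 𝓝 x₀, B.coord s (frameMap f (φ x) fun k => y' k x) = 0 := by
          intro s
          have h2 := hy s
          simp only [coordGerm, germDeriv_germ, pullGerm_germ, germ_mul, germ_sum, ← hyy] at h2
          filter_upwards [(germ_eq_iff (g := fun _ => 0) (hg := contDiffAt_const)).1 h2] with x hx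
          rw [← hx, frameMap_apply, map_sum]
          refine Finset.sum_congr rfl fun k _ => ?_
          rw [map_smul, smul_eq_mul]
          congr 1
          exact congrArg (fun L => L (f k (φ x)))
            (LinearMap.toContinuousLinearMap (B.coord s)).fderiv.symm
        have h2 : ∀ᶠ x in 𝓝 x₀, (fun k => y' k x) = 0 := by
          filter_upwards [eventually_all.2 h1, hinvφ] with x hx hi
          have h3 : frameMap f (φ x) (fun k => y' k x) = 0 :=
            B.ext_elem fun s => by simpa using hx s
          have h4 := congrArg (coframe f (φ x)) h3
          rwa [coframe_frameMap hi, map_zero] at h4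
        intro k
        rw [← hyy]
        refine germ_eq_iff (g := fun _ => 0) (hg := contDiffAt_const).2 ?_
        filter_upwards [h2] with x hx
        exact congrFun hx k
      G_none := fun i => germ_eq_iff (g := fun _ => 0) (hg := contDiffAt_const).2 (hφH i)
      Jm := fun i k => germ _ (hJm i k)
      commute := fun i l => by
        simp only [pullGerm_germ, germ_mul, germ_sum]
        rw [germ_eq_iff]
        filter_upwards [hinv, hinvφ, hφH i, hJ i, hφJ i] with x hx hxφ h1 h2 h3
        have h4 := h3 _ (frameMap_of_contactForm_eq_zero hxφ h1).symm
        have h5 := frameMap_of_contactForm_eq_zero hx h2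
        have h6 := congrArg (fun v => coframe f (φ x) v (some l)) h4
        rw [frameMap_apply] at h5 h6
        have h7 := congrArg (fun v => coframe f (φ x) (fderiv ℝ φ x v) (some l)) h5
        simp only [map_sum, map_smul, Finset.sum_apply, Pi.smul_apply, smul_eq_mul] at h6 h7
        exact h6.symm.trans h7.symm
      ev_G := fun i k => by
        rw [evalGerm_germ, hφ0, hφ1, ContinuousLinearMap.id_apply, coframe_frame h₀,
          Pi.single_apply]
        simp only [eq_comm]
      ev_x := fun s => by
        rw [map_sub, coordGerm, pullGerm_germ, evalGerm_germ, evalGerm_germ, hφ0, sub_self]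
      -- The only use of `hφ2`. As φ has the 2-jet of the identity, λ has the same first derivative
      -- at x₀ as the transversal coefficient of t itself, which is constantly 1.
      ev_DG := by
        rw [germDeriv_germ, evalGerm_germ]
        have h1 : HasFDerivAt (fun x => coframe f (φ x)) (fderiv ℝ (coframe f) x₀) x₀ := by
          have h2 : HasFDerivAt (coframe f) (fderiv ℝ (coframe f) x₀) (φ x₀) := by
            rw [hφ0]
            exact (hco.differentiableAt (by simp)).hasFDerivAt
          have h3 := h2.comp x₀ (hφ.differentiableAt (by simp)).hasFDerivAt
          rwa [hφ1, ContinuousLinearMap.comp_id] at h3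
        have h4 := (hdφ.differentiableAt (by simp)).hasFDerivAt.clm_apply
          (hasFDerivAt_const t x₀)
        have h5 := (hasFDerivAt_pi'.1 (h1.clm_apply h4) none).fderiv
        have h6 := (hasFDerivAt_pi'.1 ((hco.differentiableAt (by simp)).hasFDerivAt.clm_apply
          (hasFDerivAt_const t x₀)) none).fderiv
        have h7 : fderiv ℝ (fun x => coframe f x t none) x₀ = 0 := by
          have h8 : ∀ᶠ x in 𝓝 x₀, coframe f x t none = (fun _ => (1 : ℝ)) x := by
            filter_upwards [hinv] with x hx
            rw [show t = f none x from rfl, coframe_frame hx, Pi.single_eq_same]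
          rw [EventuallyEq.fderiv_eq h8]
          simp
        rw [h7] at h6
        have h8 := congrArg (fun L => L t) h6
        have h9 := congrArg (fun L => L t) h5
        simp [hφ1, hφ2] at h8 h9
        exact h9.trans h8.symm
      b := Pi.basisFun ℝ ι
      J := Jlin
      levi := (leviTwoForm (contactForm e t) x₀).compl₁₂ (frameMap e x₀).toLinearMap
        (frameMap e x₀).toLinearMap
      J_basis := fun i => by
        funext l
        simp [Jlin, evalGerm_germ, frameMap_single, Finset.sum_apply, Pi.single_apply]
      levi_basis := fun i j => by
        rw [evalGerm_germ, ← contactForm_apply, form_lieBracket (V := f (some i)) (W := f (some j))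
          ((contDiffAt_contactForm he h₀).differentiableAt (by simp))
          ((he i).differentiableAt (by simp)) ((he j).differentiableAt (by simp))]
        · simp [frameMap_single, hf, fullFrame]
        · filter_upwards [hinv] with x hx
          have := contactForm_frameMap hx (Pi.single i 1)
          rwa [frameMap_single] at this
        · filter_upwards [hinv] with x hx
          have := contactForm_frameMap hx (Pi.single j 1)
          rwa [frameMap_single] at this
      J_sq := fun v => hinj (by
        rw [hJlin, hJ_sq v _ (hJlin v).symm, map_neg])
      levi_skew := fun v w => by simp [leviTwoForm_apply]
      levi_nondegenerate := fun c hc => hlevi c fun d => by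
        have := hc d
        simpa [hJlin] using this }
  obtain ⟨I, hfg, hev, hx, hD⟩ := P.exists_stable_ideal
  have hzero : ∀ s, ∀ᶠ x in 𝓝 x₀, B.coord s (φ x) = B.coord s x := fun s => by
    have h1 : pullGerm φ hφ hφ0 (coordGerm B s) - coordGerm B s = 0 :=
      eq_zero_of_mem_stable_ideal hfs h₀ hfg hev hD (hx s)
    rw [sub_eq_zero, coordGerm, pullGerm_germ, germ_eq_iff] at h1
    exact h1
  filter_upwards [eventually_all.2 hzero] with x hx
  exact B.ext_elem fun s => by simpa using hx s

end Local

/-! ### CR structures and CR maps in charts. -/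

namespace AlmostCR

/-- The space on which manifolds of dimension `2 n + 1` are modelled. -/
abbrev Coord (n : ℕ) : Type := EuclideanSpace ℝ (Fin (2 * n + 1))

section Chart

open Set Filter
open scoped Topology

variable {n : ℕ} {M : Type*} [TopologicalSpace M]
  [ChartedSpace (EuclideanSpace ℝ (Fin (2 * n + 1))) M]

/-- The differential at `x` of the inverse of the chart at `q₀`. -/
noncomputable def chartDeriv (q₀ : M) (x : Coord n) :
    Coord n →L[ℝ]
      TangentSpace (Model n) ((extChartAt (Model n) q₀).symm x) :=
  mfderivWithin 𝓘(ℝ, Coord n) (Model n) (extChartAt (Model n) q₀).symm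
    (range (Model n)) x

/-- A vector field written in the chart at `q₀`. -/
noncomputable def chartField (q₀ : M) (V : ∀ q : M, TangentSpace (Model n) q)
    (x : Coord n) : Coord n :=
  (chartDeriv q₀ x).inverse (V ((extChartAt (Model n) q₀).symm x))

variable [IsManifold (Model n) ∞ M]

theorem isInvertible_chartDeriv {q₀ : M} {x : Coord n}
    (hx : x ∈ (extChartAt (Model n) q₀).target) : (chartDeriv q₀ x).IsInvertible :=
  have : IsManifold (Model n) 1 M := IsManifold.of_le (n := ∞) (by simp)
  isInvertible_mfderivWithin_extChartAt_symm hx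

theorem chartDeriv_chartField {q₀ : M} {x : Coord n}
    (hx : x ∈ (extChartAt (Model n) q₀).target) (V : ∀ q : M, TangentSpace (Model n) q) :
    chartDeriv q₀ x (chartField q₀ V x) = V ((extChartAt (Model n) q₀).symm x) := by
  rw [chartField]
  exact (isInvertible_chartDeriv hx).self_apply_inverse _

/-- The tangent space at q₀ is identified with the model space by the chart at q₀, so the
differential of this chart at its own centre is the identity. -/
theorem chartField_self (q₀ : M) (V : ∀ q : M, TangentSpace (Model n) q) :
    chartField q₀ V (extChartAt (Model n) q₀ q₀) = V q₀ := by
  have : IsManifold (Model n) 1 M := IsManifold.of_le (n := ∞) (by simp)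
  have h : chartDeriv q₀ (extChartAt (Model n) q₀ q₀) = ContinuousLinearMap.id ℝ _ :=
    mfderivWithin_range_extChartAt_symm
  have h' : ∀ q : M, q = q₀ → (V q : Coord n) = V q₀ := by
    rintro q rfl; rfl
  have h2 : chartField q₀ V (extChartAt (Model n) q₀ q₀) =
      (ContinuousLinearMap.id ℝ (Coord n)).inverse
        (V ((extChartAt (Model n) q₀).symm (extChartAt (Model n) q₀ q₀))) := by
    rw [← h]; rfl
  rw [h2, ContinuousLinearMap.inverse_id]
  exact h' _ (extChartAt_to_inv q₀)

theorem contDiffAt_chartField {q₀ : M} {V : ∀ q : M, TangentSpace (Model n) q} {U : Set M}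
    (hU : IsOpen U) (hq : q₀ ∈ U) (hV : SmoothFieldOn V U) :
    ContDiffAt ℝ ∞ (chartField q₀ V) (extChartAt (Model n) q₀ q₀) := by
  have h1 := (hV q₀ hq).contMDiffAt (hU.mem_nhds hq)
  have h2 := VectorField.contMDiffWithinAt_mpullbackWithin_extChartAt_symm (m := ∞) (n := ∞)
    (V := V) (x := q₀) (s := univ) h1 (uniqueMDiffOn_univ) (mem_univ _) (by simp)
  have h3 := contMDiffWithinAt_vectorSpace_iff_contDiffWithinAt.1 h2
  refine h3.contDiffAt ?_
  rw [preimage_univ, inter_univ]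
  exact extChartAt_target_mem_nhds q₀

theorem mlieBracket_eq_lieBracket_chartField (q₀ : M) (V W : ∀ q : M, TangentSpace (Model n) q) :
    (VectorField.mlieBracket (Model n) V W q₀ : Coord n) =
      VectorField.lieBracket ℝ (chartField q₀ V) (chartField q₀ W)
        (extChartAt (Model n) q₀ q₀) := by
  have : IsManifold (Model n) 1 M := IsManifold.of_le (n := ∞) (by simp)
  -- The chart differential is renamed as an endomorphism of the model space, so that it can be
  -- rewritten to the identity.
  obtain ⟨L, hL, h⟩ : ∃ L : Coord n →L[ℝ] Coord n, L = ContinuousLinearMap.id ℝ (Coord n) ∧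
      (VectorField.mlieBracket (Model n) V W q₀ : Coord n) =
        L.inverse (VectorField.lieBracketWithin ℝ (chartField q₀ V) (chartField q₀ W)
          ((extChartAt (Model n) q₀).symm ⁻¹' univ ∩ range (Model n))
          (extChartAt (Model n) q₀ q₀)) :=
    ⟨mfderiv (Model n) 𝓘(ℝ, Coord n) (extChartAt (Model n) q₀) q₀, mfderiv_extChartAt_self, rfl⟩
  rw [h, hL, ContinuousLinearMap.inverse_id, preimage_univ, univ_inter,
    ModelWithCorners.range_eq_univ, VectorField.lieBracketWithin_univ]
  rfl

end Chart

section LinearAlgebra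

variable {E T : Type*} [AddCommGroup E] [Module ℝ E] [AddCommGroup T] [Module ℝ T]

theorem exists_mem_map_sum_eq {ι : Type*} [Fintype ι] (A : E →ₗ[ℝ] T) {H : Submodule ℝ T}
    (J : H →ₗ[ℝ] H) {v w : ι → E} (h : ∀ i, ∃ hv : A (v i) ∈ H, A (w i) = J ⟨_, hv⟩)
    (c : ι → ℝ) : ∃ hv : A (∑ i, c i • v i) ∈ H, A (∑ i, c i • w i) = J ⟨_, hv⟩ := by
  choose hv hw using h
  have hmem : A (∑ i, c i • v i) = ((∑ i, c i • ⟨_, hv i⟩ : H) : T) := by simp [map_sum]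
  have hH : A (∑ i, c i • v i) ∈ H := by
    rw [hmem]; exact Submodule.coe_mem _
  refine ⟨hH, ?_⟩
  have : (⟨_, hH⟩ : H) = ∑ i, c i • ⟨_, hv i⟩ := Subtype.ext hmem
  rw [this, map_sum, map_sum, Submodule.coe_sum]
  simp only [map_smul, hw, Submodule.coe_smul]

theorem sum_repr_smul_coe {ι : Type*} [Fintype ι] {H : Submodule ℝ T} (b : Module.Basis ι ℝ H)
    (v : H) : ∑ i, b.repr v i • (b i : T) = v := by
  simpa only [Submodule.coe_sum, Submodule.coe_smul] using congrArg Subtype.val (b.sum_repr v)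

end LinearAlgebra

section Chart

open Set Filter
open scoped Topology

variable {n : ℕ} {M : Type*} [TopologicalSpace M]
  [ChartedSpace (EuclideanSpace ℝ (Fin (2 * n + 1))) M]
  {M' : Type*} [TopologicalSpace M'] [ChartedSpace (EuclideanSpace ℝ (Fin (2 * n + 1))) M']

/-- The map `f` written in the charts at `q₀` and `q₁`. -/
noncomputable def chartMap (q₀ : M) (q₁ : M') (f : M → M') : Coord n → Coord n :=
  extChartAt (Model n) q₁ ∘ f ∘ (extChartAt (Model n) q₀).symm

variable {f : M → M'} {q₀ : M}

theorem contDiffAt_chartMap (hf : ContMDiffAt (Model n) (Model n) ∞ f q₀) :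
    ContDiffAt ℝ ∞ (chartMap q₀ (f q₀) f) (extChartAt (Model n) q₀ q₀) := by
  have := (contMDiffAt_iff.1 hf).2
  rwa [ModelWithCorners.range_eq_univ, contDiffWithinAt_univ] at this

theorem chartMap_self (f : M → M') (q₀ : M) :
    chartMap q₀ (f q₀) f (extChartAt (Model n) q₀ q₀) = extChartAt (Model n) (f q₀) (f q₀) := by
  simp only [chartMap, Function.comp_apply, extChartAt_to_inv]

theorem eventually_mem_target (q₀ : M) :
    ∀ᶠ x in 𝓝 (extChartAt (Model n) q₀ q₀), x ∈ (extChartAt (Model n) q₀).target :=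
  extChartAt_target_mem_nhds q₀

theorem eventually_chart_symm {p : M → Prop} (h : ∀ᶠ q in 𝓝 q₀, p q) :
    ∀ᶠ x in 𝓝 (extChartAt (Model n) q₀ q₀), p ((extChartAt (Model n) q₀).symm x) := by
  have := continuousAt_extChartAt_symm (I := Model n) q₀
  rw [ContinuousAt, extChartAt_to_inv] at this
  exact this.eventually h

theorem eventually_symm_chartMap (hf : ContinuousAt f q₀) :
    ∀ᶠ x in 𝓝 (extChartAt (Model n) q₀ q₀),
      (extChartAt (Model n) (f q₀)).symm (chartMap q₀ (f q₀) f x) =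
        f ((extChartAt (Model n) q₀).symm x) := by
  have h := hf.eventually (extChartAt_source_mem_nhds (I := Model n) (f q₀))
  filter_upwards [eventually_chart_symm h] with x hx
  exact (extChartAt (Model n) (f q₀)).left_inv hx

variable [IsManifold (Model n) ∞ M] [IsManifold (Model n) ∞ M']

/-- In the chart at `q₀`, the vector `v` at `x` lies in the CR subbundle and the complex structure
maps it to `w`. -/
def Structure.ChartJ (S : Structure n M) (q₀ : M) (x v w : Coord n) : Prop :=
  ∃ h : chartDeriv q₀ x v ∈ S.H ((extChartAt (Model n) q₀).symm x),
    chartDeriv q₀ x w = S.J _ ⟨_, h⟩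

namespace Structure

variable {S : Structure n M} {q₀ : M} {x v w : Coord n}

theorem chartDeriv_injective (hx : x ∈ (extChartAt (Model n) q₀).target) :
    Function.Injective (chartDeriv q₀ x) := by
  obtain ⟨A, hA⟩ := isInvertible_chartDeriv hx
  rw [← hA]
  exact A.injective

theorem ChartJ.unique (hx : x ∈ (extChartAt (Model n) q₀).target) {w' : Coord n}
    (h : S.ChartJ q₀ x v w) (h' : S.ChartJ q₀ x v w') : w = w' := by
  obtain ⟨_, h⟩ := h
  obtain ⟨_, h'⟩ := h'
  exact chartDeriv_injective hx (h.trans h'.symm)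

theorem ChartJ.symm_neg (h : S.ChartJ q₀ x v w) : S.ChartJ q₀ x w (-v) := by
  obtain ⟨hv, h⟩ := h
  have hw : chartDeriv q₀ x w ∈ S.H ((extChartAt (Model n) q₀).symm x) := by
    rw [h]; exact Submodule.coe_mem _
  refine ⟨hw, ?_⟩
  have : (⟨_, hw⟩ : S.H ((extChartAt (Model n) q₀).symm x)) = S.J _ ⟨_, hv⟩ := Subtype.ext h
  rw [this, S.J_sq, map_neg]
  rfl

theorem ChartJ.sum {ι : Type*} [Fintype ι] {v w : ι → Coord n}
    (h : ∀ i, S.ChartJ q₀ x (v i) (w i)) (c : ι → ℝ) :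
    S.ChartJ q₀ x (∑ i, c i • v i) (∑ i, c i • w i) :=
  exists_mem_map_sum_eq (chartDeriv q₀ x).toLinearMap (S.J _) h c

theorem ChartJ.of_field (hx : x ∈ (extChartAt (Model n) q₀).target) (V : ∀ q, S.H q) :
    S.ChartJ q₀ x (chartField q₀ (fun q => (V q : TangentSpace (Model n) q)) x)
      (chartField q₀ (fun q => (S.J q (V q) : TangentSpace (Model n) q)) x) := by
  have h := chartDeriv_chartField hx (fun q => (V q : TangentSpace (Model n) q))
  have hmem : chartDeriv q₀ x (chartField q₀ (fun q => (V q : TangentSpace (Model n) q)) x) ∈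
      S.H ((extChartAt (Model n) q₀).symm x) := by
    rw [h]; exact Submodule.coe_mem _
  refine ⟨hmem, ?_⟩
  rw [chartDeriv_chartField hx]
  congr 2
  exact Subtype.ext h.symm

theorem exists_eq_sum_of_mem {ι : Type*} [Fintype ι] (hx : x ∈ (extChartAt (Model n) q₀).target)
    (e : ∀ q, Module.Basis ι ℝ (S.H q))
    (h : chartDeriv q₀ x v ∈ S.H ((extChartAt (Model n) q₀).symm x)) :
    ∃ c : ι → ℝ, v = ∑ i, c i • chartField q₀ (fun q => (e q i : TangentSpace (Model n) q)) x := by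
  refine ⟨(e _).repr ⟨_, h⟩, chartDeriv_injective hx ?_⟩
  simp only [map_sum, map_smul, chartDeriv_chartField hx]
  exact (sum_repr_smul_coe (e _) ⟨_, h⟩).symm

/-- Transport along an equality of base points; with its converse below it avoids casts between
fibres of H. -/
theorem chartJ_of_eq {y : Coord n} {r : M} (hr : (extChartAt (Model n) q₀).symm y = r) {v w : Coord n}
    (hv : (chartDeriv q₀ y v : Coord n) ∈ S.H r)
    (hw : (chartDeriv q₀ y w : Coord n) = ((S.J r ⟨_, hv⟩ : S.H r) : TangentSpace (Model n) r)) : S.ChartJ q₀ y v w := by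
  subst hr
  exact ⟨hv, hw⟩

theorem ChartJ.exists_of_eq {y : Coord n} {r : M} (hr : (extChartAt (Model n) q₀).symm y = r) {v w : Coord n}
    (h : S.ChartJ q₀ y v w) : ∃ hv : (chartDeriv q₀ y v : Coord n) ∈ S.H r,
    (chartDeriv q₀ y w : Coord n) = ((S.J r ⟨_, hv⟩ : S.H r) : TangentSpace (Model n) r) := by
  subst hr
  exact h

end Structure

variable {S : Structure n M} {S' : Structure n M'} {U : Set M}

/-- Chain rule for the two factorizations of f ∘ chart⁻¹, which agree near x₀. -/
theorem eventually_chartDeriv_fderiv_chartMap (hU : IsOpen U) (hq : q₀ ∈ U)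
    (hf : ContMDiffOn (Model n) (Model n) ∞ f U) :
    ∀ᶠ x in 𝓝 (extChartAt (Model n) q₀ q₀), ∀ v : Coord n,
      (chartDeriv (f q₀) (chartMap q₀ (f q₀) f x) (fderiv ℝ (chartMap q₀ (f q₀) f) x v) :
        Coord n) =
      mfderiv (Model n) (Model n) f ((extChartAt (Model n) q₀).symm x) (chartDeriv q₀ x v) := by
  have : IsManifold (Model n) 1 M := IsManifold.of_le (n := ∞) (by simp)
  have : IsManifold (Model n) 1 M' := IsManifold.of_le (n := ∞) (by simp)
  have hf₀ := hf.contMDiffAt (hU.mem_nhds hq)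
  have hF := contDiffAt_chartMap hf₀
  have hF1 := (hF.of_le (m := 1) (by simp)).eventually (by simp)
  have hFT : ∀ᶠ x in 𝓝 (extChartAt (Model n) q₀ q₀),
      chartMap q₀ (f q₀) f x ∈ (extChartAt (Model n) (f q₀)).target := by
    refine hF.continuousAt.eventually ?_
    rw [chartMap_self]
    exact eventually_mem_target _
  filter_upwards [(eventually_symm_chartMap hf₀.continuousAt).eventually_nhds, hF1, hFT,
    eventually_mem_target q₀, eventually_chart_symm (hU.mem_nhds hq)] with x h1 h2 h3 h4 h5 v
  have hd1 : MDifferentiableAt 𝓘(ℝ, Coord n) (Model n) (extChartAt (Model n) q₀).symm x := by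
    have := mdifferentiableWithinAt_extChartAt_symm (I := Model n) h4
    rwa [ModelWithCorners.range_eq_univ, mdifferentiableWithinAt_univ] at this
  have hd2 : MDifferentiableAt 𝓘(ℝ, Coord n) (Model n) (extChartAt (Model n) (f q₀)).symm
      (chartMap q₀ (f q₀) f x) := by
    have := mdifferentiableWithinAt_extChartAt_symm (I := Model n) h3
    rwa [ModelWithCorners.range_eq_univ, mdifferentiableWithinAt_univ] at this
  have hd3 : MDifferentiableAt (Model n) (Model n) f ((extChartAt (Model n) q₀).symm x) :=
    (hf.contMDiffAt (hU.mem_nhds h5)).mdifferentiableAt (by simp)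
  have hd4 : MDifferentiableAt 𝓘(ℝ, Coord n) 𝓘(ℝ, Coord n) (chartMap q₀ (f q₀) f) x :=
    (h2.differentiableAt (by simp)).mdifferentiableAt
  have e1 := mfderiv_comp x hd2 hd4
  have e2 := mfderiv_comp x hd3 hd1
  have e3 : mfderiv 𝓘(ℝ, Coord n) (Model n)
      ((extChartAt (Model n) (f q₀)).symm ∘ chartMap q₀ (f q₀) f) x =
      mfderiv 𝓘(ℝ, Coord n) (Model n) (f ∘ (extChartAt (Model n) q₀).symm) x :=
    Filter.EventuallyEq.mfderiv_eq h1
  rw [e1, e2] at e3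
  have e4 := congrArg (fun L : Coord n →L[ℝ] Coord n => L v) e3
  rw [mfderiv_eq_fderiv] at e4
  simp only [chartDeriv, ModelWithCorners.range_eq_univ, mfderivWithin_univ]
  exact e4

theorem IsCRDiffeoOn.injective_mfderiv (hf : IsCRDiffeoOn S S' f U) {q : M} (hq : q ∈ U) :
    Function.Injective (mfderiv (Model n) (Model n) f q) := by
  obtain ⟨h, hh, hinv⟩ := hf.exists_inverse
  have h1 := (hf.smooth.contMDiffAt (hf.isOpen_source.mem_nhds hq)).mdifferentiableAt (by simp)
  have h2 := (hh.contMDiffAt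
    (hf.isOpen_image.mem_nhds (mem_image_of_mem f hq))).mdifferentiableAt (by simp)
  have e1 := mfderiv_comp q h2 h1
  have e2 : mfderiv (Model n) (Model n) (h ∘ f) q = mfderiv (Model n) (Model n) (id : M → M) q := by
    apply Filter.EventuallyEq.mfderiv_eq
    filter_upwards [hf.isOpen_source.mem_nhds hq] with z hz using hinv hz
  rw [e1, mfderiv_id] at e2
  intro v w hvw
  have hv := congrArg (fun L : Coord n →L[ℝ] Coord n => L v) e2
  have hw := congrArg (fun L : Coord n →L[ℝ] Coord n => L w) e2
  have : (mfderiv (Model n) (Model n) h (f q)) (mfderiv (Model n) (Model n) f q v) =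
      (mfderiv (Model n) (Model n) h (f q)) (mfderiv (Model n) (Model n) f q w) := by rw [hvw]
  exact hv.symm.trans (Eq.trans this hw)

/-- Both directions are needed: one pushes the structure forward by f, the other pulls it back by g.
The converse rests on injectivity of the differential. -/
theorem IsCRDiffeoOn.eventually_chartJ_iff (hf : IsCRDiffeoOn S S' f U) (hq : q₀ ∈ U) :
    ∀ᶠ x in 𝓝 (extChartAt (Model n) q₀ q₀), ∀ v w : Coord n,
      S'.ChartJ (f q₀) (chartMap q₀ (f q₀) f x) (fderiv ℝ (chartMap q₀ (f q₀) f) x v)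
        (fderiv ℝ (chartMap q₀ (f q₀) f) x w) ↔ S.ChartJ q₀ x v w := by
  filter_upwards [eventually_chartDeriv_fderiv_chartMap hf.isOpen_source hq hf.smooth,
    eventually_symm_chartMap (hf.smooth.contMDiffAt
      (hf.isOpen_source.mem_nhds hq)).continuousAt,
    eventually_chart_symm (hf.isOpen_source.mem_nhds hq)] with x h1 h2 h3 v w
  constructor
  · intro h
    obtain ⟨hv, hw⟩ := h.exists_of_eq h2
    have hv' := hv
    rw [← hf.map_H _ h3] at hv'
    obtain ⟨u, hu, hu'⟩ := hv'
    have hu1 : u = chartDeriv q₀ x v := hf.injective_mfderiv h3 (hu'.trans (h1 v))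
    subst hu1
    refine ⟨hu, hf.injective_mfderiv h3 ?_⟩
    have h5 := hf.map_J _ h3 ⟨_, hu⟩ ⟨_, hv⟩ hu'
    exact ((h1 w).symm.trans hw).trans h5.symm
  · rintro ⟨hv, hw⟩
    have hv' : (chartDeriv (f q₀) (chartMap q₀ (f q₀) f x)
        (fderiv ℝ (chartMap q₀ (f q₀) f) x v) : Coord n) ∈
        S'.H (f ((extChartAt (Model n) q₀).symm x)) := by
      rw [h1 v, ← hf.map_H _ h3]
      exact ⟨_, hv, rfl⟩
    refine Structure.chartJ_of_eq h2 hv' ?_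
    have h5 := hf.map_J _ h3 ⟨_, hv⟩ ⟨_, hv'⟩ (h1 v).symm
    rw [← hw] at h5
    exact (h1 w).trans h5

end Chart

/-! ### The complex Levi form in terms of the real form Ω. -/

section Complexification

variable {V W : Type*} [AddCommGroup V] [Module ℝ V] [AddCommGroup W] [Module ℝ W]

@[simp]
theorem rePart_tmul (z : ℂ) (v : V) : rePart V (z ⊗ₜ v) = z.re • v := by simp [rePart]

@[simp]
theorem imPart_tmul (z : ℂ) (v : V) : imPart V (z ⊗ₜ v) = z.im • v := by simp [imPart]

@[simp]
theorem rePart_mkComplex (a b : V) : rePart V (mkComplex a b) = a := by simp [mkComplex]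

@[simp]
theorem imPart_mkComplex (a b : V) : imPart V (mkComplex a b) = b := by simp [mkComplex]

theorem mkComplex_rePart_imPart (ξ : ℂ ⊗[ℝ] V) : mkComplex (rePart V ξ) (imPart V ξ) = ξ := by
  induction ξ with
  | zero => simp [mkComplex]
  | add x y hx hy =>
    simp only [mkComplex, map_add, TensorProduct.tmul_add] at hx hy ⊢
    conv_rhs => rw [← hx, ← hy]
    abel
  | tmul z v =>
    rw [rePart_tmul, imPart_tmul, mkComplex, ← TensorProduct.smul_tmul, ← TensorProduct.smul_tmul,
      ← TensorProduct.add_tmul]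
    congr 1
    rw [Complex.real_smul, Complex.real_smul, mul_one, Complex.re_add_im]

theorem baseChange_mkComplex (A : V →ₗ[ℝ] W) (a b : V) :
    A.baseChange ℂ (mkComplex a b) = mkComplex (A a) (A b) := by
  simp [mkComplex]

theorem I_smul_mkComplex (a b : V) : Complex.I • mkComplex a b = mkComplex (-b) a := by
  simp only [mkComplex, smul_add, TensorProduct.smul_tmul', smul_eq_mul, Complex.I_mul_I, mul_one,
    TensorProduct.neg_tmul, TensorProduct.tmul_neg]
  abel

end Complexification

theorem eq_zero_of_smul_add_coe_eq_zero {T : Type*} [AddCommGroup T] [Module ℝ T]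
    {H : Submodule ℝ T} {t : T} (ht : t ∉ H) {a : ℝ} {z : H} (h : a • t + (z : T) = 0) :
    a = 0 ∧ z = 0 := by
  have h0 : a = 0 := by
    by_contra ha
    refine ht ((Submodule.smul_mem_iff _ ha).1 ?_)
    rw [eq_neg_of_add_eq_zero_left h]
    exact Submodule.neg_mem _ z.2
  refine ⟨h0, Subtype.ext ?_⟩
  rwa [h0, zero_smul, zero_add] at h

namespace Structure

variable {n : ℕ} {M : Type*} [TopologicalSpace M]
  [ChartedSpace (EuclideanSpace ℝ (Fin (2 * n + 1))) M] [IsManifold (Model n) ∞ M]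
  {S : Structure n M}

theorem mkComplex_mem_H10 (q : M) (v : S.H q) :
    mkComplex (v : TangentSpace (Model n) q) (-(S.J q v : TangentSpace (Model n) q)) ∈ S.H10 q := by
  refine ⟨mkComplex v (-S.J q v), ?_, ?_⟩
  · rw [SetLike.mem_coe, Module.End.mem_eigenspace_iff, baseChange_mkComplex, I_smul_mkComplex,
      map_neg, S.J_sq]
    simp only [neg_neg]
  · rw [baseChange_mkComplex]
    rfl

theorem exists_of_mem_H10 {q : M} {ξ : CTangent n q} (h : ξ ∈ S.H10 q) :
    ∃ v : S.H q, rePart _ ξ = v ∧ imPart _ ξ = -(S.J q v : TangentSpace (Model n) q) := by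
  obtain ⟨η, hη, rfl⟩ := h
  rw [SetLike.mem_coe, Module.End.mem_eigenspace_iff] at hη
  rw [← mkComplex_rePart_imPart η] at hη ⊢
  rw [baseChange_mkComplex, I_smul_mkComplex] at hη
  have h1 := congrArg (rePart _) hη
  rw [rePart_mkComplex, rePart_mkComplex] at h1
  rw [baseChange_mkComplex, rePart_mkComplex, imPart_mkComplex]
  refine ⟨_, rfl, ?_⟩
  rw [h1]
  simp

theorem proj_mkComplex_eq_zero {q : M} {a b : TangentSpace (Model n) q} (ha : a ∈ S.H q)
    (hb : b ∈ S.H q) : S.proj q (mkComplex a b) = 0 := by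
  rw [proj, baseChange_mkComplex, Submodule.mkQ_apply, Submodule.mkQ_apply,
    (Submodule.Quotient.mk_eq_zero _).2 ha, (Submodule.Quotient.mk_eq_zero _).2 hb]
  simp [mkComplex]

end Structure

section Frame

open Set Filter
open scoped Topology

variable {n : ℕ} {M : Type*} [TopologicalSpace M]
  [ChartedSpace (EuclideanSpace ℝ (Fin (2 * n + 1))) M] [IsManifold (Model n) ∞ M]
  {S : Structure n M}

/-- A frame of the CR subbundle, written in the chart at `q₀`. -/
noncomputable def chartFrame (q₀ : M) (e : ∀ q : M, Module.Basis (Fin (2 * n)) ℝ (S.H q))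
    (i : Fin (2 * n)) : Coord n → Coord n :=
  chartField q₀ fun q => (e q i : TangentSpace (Model n) q)

/-- The image of a frame under the complex structure, written in the chart at `q₀`. -/
noncomputable def chartJFrame (q₀ : M) (e : ∀ q : M, Module.Basis (Fin (2 * n)) ℝ (S.H q))
    (i : Fin (2 * n)) : Coord n → Coord n :=
  chartField q₀ fun q => (S.J q (e q i) : TangentSpace (Model n) q)

variable {q₀ : M} {e : ∀ q : M, Module.Basis (Fin (2 * n)) ℝ (S.H q)} {x v w : Coord n}

theorem chartJ_frameMap (hx : x ∈ (extChartAt (Model n) q₀).target) (c : Fin (2 * n) → ℝ) :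
    S.ChartJ q₀ x (frameMap (chartFrame q₀ e) x c) (frameMap (chartJFrame q₀ e) x c) := by
  rw [frameMap_apply, frameMap_apply]
  exact Structure.ChartJ.sum (fun i => Structure.ChartJ.of_field hx fun q => e q i) c

theorem Structure.ChartJ.exists_eq_frameMap (hx : x ∈ (extChartAt (Model n) q₀).target)
    (h : S.ChartJ q₀ x v w) (e : ∀ q : M, Module.Basis (Fin (2 * n)) ℝ (S.H q)) :
    ∃ c, v = frameMap (chartFrame q₀ e) x c := by
  obtain ⟨c, hc⟩ := Structure.exists_eq_sum_of_mem hx e h.1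
  exact ⟨c, by rw [hc, frameMap_apply]; rfl⟩

theorem frameMap_chartFrame_self (c : Fin (2 * n) → ℝ) :
    frameMap (chartFrame q₀ e) (extChartAt (Model n) q₀ q₀) c =
      ((∑ i, c i • e q₀ i : S.H q₀) : TangentSpace (Model n) q₀) := by
  rw [frameMap_apply, Submodule.coe_sum]
  refine Finset.sum_congr rfl fun i _ => ?_
  rw [chartFrame, chartField_self]
  rfl

theorem frameMap_chartJFrame_self (c : Fin (2 * n) → ℝ) :
    frameMap (chartJFrame q₀ e) (extChartAt (Model n) q₀ q₀) c =
      (S.J q₀ (∑ i, c i • e q₀ i) : TangentSpace (Model n) q₀) := by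
  rw [frameMap_apply, map_sum, Submodule.coe_sum]
  refine Finset.sum_congr rfl fun i _ => ?_
  rw [chartJFrame, chartField_self, map_smul]
  rfl

theorem exists_isInvertible_fullFrame (q₀ : M)
    (e : ∀ q : M, Module.Basis (Fin (2 * n)) ℝ (S.H q)) :
    ∃ t, (frameMap (fullFrame (chartFrame q₀ e) t) (extChartAt (Model n) q₀ q₀)).IsInvertible := by
  have hfin : Module.finrank ℝ (S.H q₀) = 2 * n := by
    rw [Module.finrank_eq_card_basis (e q₀), Fintype.card_fin]
  have hT : Module.finrank ℝ (TangentSpace (Model n) q₀) = 2 * n + 1 :=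
    finrank_euclideanSpace_fin
  have hne : S.H q₀ ≠ ⊤ := by
    intro h
    rw [h, finrank_top, hT] at hfin
    omega
  obtain ⟨t, -, ht⟩ := SetLike.exists_of_lt hne.lt_top
  -- Any vector outside the hyperplane H at q₀ will do; it is now read as a constant field on the
  -- model space.
  suffices key : ∀ t : Coord n, (show TangentSpace (Model n) q₀ from t) ∉ S.H q₀ →
      (frameMap (fullFrame (chartFrame q₀ e) t) (extChartAt (Model n) q₀ q₀)).IsInvertible from
    ⟨t, key t ht⟩
  clear ht t
  intro t ht
  set L := frameMap (fullFrame (chartFrame q₀ e) t) (extChartAt (Model n) q₀ q₀) with hLdef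
  have hL : Function.Injective L := by
    rw [injective_iff_map_eq_zero]
    intro c hc
    rw [hLdef, frameMap_fullFrame, frameMap_chartFrame_self] at hc
    obtain ⟨h0, h1⟩ := eq_zero_of_smul_add_coe_eq_zero (T := TangentSpace (Model n) q₀) ht hc
    have h2 := (Fintype.linearIndependent_iff.1 (e q₀).linearIndependent) _ h1
    funext k
    rcases k with _ | i
    · exact h0
    · exact h2 i
  exact ⟨(LinearMap.linearEquivOfInjective L.toLinearMap hL
    (by simp [Fintype.card_option])).toContinuousLinearEquiv, by ext; rfl⟩

section Levi

variable {U : Set M} {t : Coord n}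

theorem contDiffAt_chartFrame (hU : IsOpen U) (hq : q₀ ∈ U)
    (he : ∀ j, SmoothFieldOn (fun q => (e q j : TangentSpace (Model n) q)) U) (i : Fin (2 * n)) :
    ContDiffAt ℝ ∞ (chartFrame q₀ e i) (extChartAt (Model n) q₀ q₀) :=
  contDiffAt_chartField hU hq (he i)

theorem mem_of_contactForm_eq_zero
    (h₀ : (frameMap (fullFrame (chartFrame q₀ e) t) (extChartAt (Model n) q₀ q₀)).IsInvertible)
    {z : TangentSpace (Model n) q₀}
    (hz : contactForm (chartFrame q₀ e) t (extChartAt (Model n) q₀ q₀) z = 0) : z ∈ S.H q₀ := by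
  have h := frameMap_of_contactForm_eq_zero h₀ hz
  rw [frameMap_chartFrame_self] at h
  rw [← h]
  exact Submodule.coe_mem _

theorem eventually_contactForm_chartField (hU : IsOpen U) (hq : q₀ ∈ U)
    (he : ∀ j, SmoothFieldOn (fun q => (e q j : TangentSpace (Model n) q)) U)
    (h₀ : (frameMap (fullFrame (chartFrame q₀ e) t) (extChartAt (Model n) q₀ q₀)).IsInvertible)
    {V : ∀ q : M, TangentSpace (Model n) q} (hV : ∀ᶠ q in 𝓝 q₀, V q ∈ S.H q) :
    ∀ᶠ x in 𝓝 (extChartAt (Model n) q₀ q₀),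
      contactForm (chartFrame q₀ e) t x (chartField q₀ V x) = 0 := by
  filter_upwards [eventually_mem_target q₀, eventually_chart_symm hV,
    eventually_isInvertible_frameMap
      (contDiffAt_fullFrame (contDiffAt_chartFrame hU hq he) t) h₀] with x hx hVx hinv
  rw [← chartDeriv_chartField hx V] at hVx
  obtain ⟨c, hc⟩ := Structure.exists_eq_sum_of_mem hx e hVx
  rw [hc]
  have := contactForm_frameMap hinv c
  rwa [frameMap_apply] at this

theorem contactForm_mlieBracket (hU : IsOpen U) (hq : q₀ ∈ U)
    (he : ∀ j, SmoothFieldOn (fun q => (e q j : TangentSpace (Model n) q)) U)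
    (h₀ : (frameMap (fullFrame (chartFrame q₀ e) t) (extChartAt (Model n) q₀ q₀)).IsInvertible)
    {V W : ∀ q : M, TangentSpace (Model n) q} {U' : Set M} (hU' : IsOpen U') (hq' : q₀ ∈ U')
    (hV : SmoothFieldOn V U') (hW : SmoothFieldOn W U')
    (hVH : ∀ q ∈ U', V q ∈ S.H q) (hWH : ∀ q ∈ U', W q ∈ S.H q) :
    contactForm (chartFrame q₀ e) t (extChartAt (Model n) q₀ q₀)
        (VectorField.mlieBracket (Model n) V W q₀ : Coord n) =
      leviTwoForm (contactForm (chartFrame q₀ e) t) (extChartAt (Model n) q₀ q₀)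
        (V q₀ : Coord n) (W q₀ : Coord n) := by
  rw [mlieBracket_eq_lieBracket_chartField, form_lieBracket
    ((contDiffAt_contactForm (contDiffAt_chartFrame hU hq he) h₀).differentiableAt (by simp))
    ((contDiffAt_chartField hU' hq' hV).differentiableAt (by simp))
    ((contDiffAt_chartField hU' hq' hW).differentiableAt (by simp))
    (eventually_contactForm_chartField hU hq he h₀ (eventually_of_mem (hU'.mem_nhds hq') hVH))
    (eventually_contactForm_chartField hU hq he h₀ (eventually_of_mem (hU'.mem_nhds hq') hWH)),
    chartField_self, chartField_self]

/-- For X = v − iJv and Y = y − iJy, the real part of [conj X, Y] is [v, y] + [Jv, Jy], so modulo H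
the Levi form is governed by the J-invariant part of Ω. The vector with coefficients `c` is extended
to a section with constant coefficients in the frame. -/
theorem Structure.LeviNondegenerateAt.eq_zero_of_leviTwoForm (hU : IsOpen U) (hq : q₀ ∈ U)
    (he : ∀ j, SmoothFieldOn (fun q => (e q j : TangentSpace (Model n) q)) U)
    (hJe : ∀ j, SmoothFieldOn (fun q => (S.J q (e q j) : TangentSpace (Model n) q)) U)
    (h₀ : (frameMap (fullFrame (chartFrame q₀ e) t) (extChartAt (Model n) q₀ q₀)).IsInvertible)
    (hS : S.LeviNondegenerateAt q₀) (c : Fin (2 * n) → ℝ)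
    (hc : ∀ d, leviTwoForm (contactForm (chartFrame q₀ e) t) (extChartAt (Model n) q₀ q₀)
        (frameMap (chartFrame q₀ e) (extChartAt (Model n) q₀ q₀) c)
        (frameMap (chartFrame q₀ e) (extChartAt (Model n) q₀ q₀) d)
      + leviTwoForm (contactForm (chartFrame q₀ e) t) (extChartAt (Model n) q₀ q₀)
        (frameMap (chartJFrame q₀ e) (extChartAt (Model n) q₀ q₀) c)
        (frameMap (chartJFrame q₀ e) (extChartAt (Model n) q₀ q₀) d) = 0) : c = 0 := by
  set L := leviTwoForm (contactForm (chartFrame q₀ e) t) (extChartAt (Model n) q₀ q₀)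
  set v : ∀ q : M, S.H q := fun q => ∑ i, c i • e q i with hv
  have hvs : SmoothFieldOn (fun q => (v q : TangentSpace (Model n) q)) U := by
    have := ContMDiffOn.sum_section (I := Model n) (n := ∞) (u := U)
      (F := Coord n) (V := fun q : M => TangentSpace (Model n) q) (s := Finset.univ)
      (t := fun i q => c i • (e q i : TangentSpace (Model n) q))
      fun i _ => (he i).const_smul_section (a := c i)
    refine this.congr fun q _ => ?_
    simp [hv]
  have hws : SmoothFieldOn (fun q => (S.J q (v q) : TangentSpace (Model n) q)) U := by
    have := ContMDiffOn.sum_section (I := Model n) (n := ∞) (u := U)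
      (F := Coord n) (V := fun q : M => TangentSpace (Model n) q) (s := Finset.univ)
      (t := fun i q => c i • (S.J q (e q i) : TangentSpace (Model n) q))
      fun i _ => (hJe i).const_smul_section (a := c i)
    refine this.congr fun q _ => ?_
    simp [hv]
  have hX := hS (fun q => mkComplex (v q : TangentSpace (Model n) q)
    (-(S.J q (v q) : TangentSpace (Model n) q)))
    ⟨U, hU, hq, by simpa only [rePart_mkComplex] using hvs,
      by simp only [imPart_mkComplex]; exact ContMDiffOn.neg_section hws,
      fun q _ => Structure.mkComplex_mem_H10 q (v q)⟩ ?_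
  · have h1 := congrArg (rePart _) hX
    rw [rePart_mkComplex, map_zero] at h1
    have h2 : (∑ i, c i • e q₀ i : S.H q₀) = 0 := Subtype.ext h1
    exact funext ((Fintype.linearIndependent_iff.1 (e q₀).linearIndependent) _ h2)
  · rintro Y ⟨U', hU', hq', hys, hys', hYH⟩
    obtain ⟨y, hy, hy'⟩ := Structure.exists_of_mem_H10 (hYH q₀ hq')
    have hyH : ∀ q ∈ U ∩ U', rePart _ (Y q) ∈ S.H q := fun q hq => by
      obtain ⟨u, hu, -⟩ := Structure.exists_of_mem_H10 (hYH q hq.2)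
      rw [hu]; exact Submodule.coe_mem _
    have hyH' : ∀ q ∈ U ∩ U', imPart _ (Y q) ∈ S.H q := fun q hq => by
      obtain ⟨u, -, hu⟩ := Structure.exists_of_mem_H10 (hYH q hq.2)
      rw [hu]; exact Submodule.neg_mem _ (Submodule.coe_mem _)
    have hW := hU.inter hU'
    have hvs' := ContMDiffOn.mono hvs (inter_subset_left (t := U'))
    have hws' := ContMDiffOn.mono hws (inter_subset_left (t := U'))
    have hys₁ := ContMDiffOn.mono hys (inter_subset_right (s := U))
    have hys₂ := ContMDiffOn.mono hys' (inter_subset_right (s := U))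
    have hc' : ∀ u : S.H q₀, L ((v q₀ : TangentSpace (Model n) q₀) : Coord n)
        ((u : TangentSpace (Model n) q₀) : Coord n) +
        L ((S.J q₀ (v q₀) : TangentSpace (Model n) q₀) : Coord n)
          ((S.J q₀ u : TangentSpace (Model n) q₀) : Coord n) = 0 := fun u => by
      have h := hc ((e q₀).repr u)
      simp only [frameMap_chartFrame_self, frameMap_chartJFrame_self, (e q₀).sum_repr] at h
      exact h
    simp only [Structure.levi, cBracket, conjVec, rePart_mkComplex, imPart_mkComplex, neg_neg]
    rw [Structure.proj_mkComplex_eq_zero, smul_zero]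
    · refine mem_of_contactForm_eq_zero h₀ ((map_sub (contactForm (chartFrame q₀ e) t
        (extChartAt (Model n) q₀ q₀)) _ _).trans ?_)
      rw [contactForm_mlieBracket hU hq he h₀ hW ⟨hq, hq'⟩ hvs' hys₁
          (fun q _ => Submodule.coe_mem _) hyH,
        contactForm_mlieBracket hU hq he h₀ hW ⟨hq, hq'⟩ hws' hys₂
          (fun q _ => Submodule.coe_mem _) hyH', hy, hy']
      have h1 := hc' y
      have h2 := map_neg (L ((S.J q₀ (v q₀) : TangentSpace (Model n) q₀) : Coord n))
        ((S.J q₀ y : TangentSpace (Model n) q₀) : Coord n)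
      refine Eq.trans (congrArg (_ - ·) h2) ?_
      rw [sub_neg_eq_add]
      exact h1
    · refine mem_of_contactForm_eq_zero h₀ ((map_add (contactForm (chartFrame q₀ e) t
        (extChartAt (Model n) q₀ q₀)) _ _).trans ?_)
      rw [contactForm_mlieBracket hU hq he h₀ hW ⟨hq, hq'⟩ hvs' hys₂
          (fun q _ => Submodule.coe_mem _) hyH',
        contactForm_mlieBracket hU hq he h₀ hW ⟨hq, hq'⟩ hws' hys₁
          (fun q _ => Submodule.coe_mem _) hyH, hy, hy']
      -- The imaginary part of the bracket is the real identity with y replaced by −Jy.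
      have h1 := hc' (-S.J q₀ y)
      rw [map_neg, S.J_sq, neg_neg] at h1
      exact h1

end Levi

end Frame

open Set Filter
open scoped Topology

/-! ### Jets, local uniqueness and propagation along U. -/

section Jets

variable {E F G : Type*} [NormedAddCommGroup E] [NormedSpace ℝ E] [NormedAddCommGroup F]
  [NormedSpace ℝ F] [NormedAddCommGroup G] [NormedSpace ℝ G] {x₀ : E}

theorem eq_of_frequently_eq {X Y : Type*} [TopologicalSpace X] [TopologicalSpace Y] [T2Space Y]
    {u v : X → Y} {x : X} (hu : ContinuousAt u x) (hv : ContinuousAt v x)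
    (h : ∃ᶠ z in 𝓝 x, u z = v z) : u x = v x := by
  by_contra hne
  exact h ((hu.ne_iff_eventually_ne hv).1 hne)

/-- The second order derivative of `k ∘ f` at `x₀`, in terms of the derivatives of `k` and `f`. -/
theorem hasFDerivAt_fderiv_comp {k : F → G} {f : E → F} (hk : ContDiffAt ℝ ∞ k (f x₀))
    (hf : ContDiffAt ℝ ∞ f x₀) :
    HasFDerivAt (fderiv ℝ (k ∘ f))
      ((ContinuousLinearMap.compL ℝ E F G (fderiv ℝ k (f x₀))).comp (fderiv ℝ (fderiv ℝ f) x₀)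
        + ((ContinuousLinearMap.compL ℝ E F G).flip (fderiv ℝ f x₀)).comp
          ((fderiv ℝ (fderiv ℝ k) (f x₀)).comp (fderiv ℝ f x₀))) x₀ := by
  have hk' : ContDiffAt ℝ ∞ (fderiv ℝ k) (f x₀) := hk.fderiv_right (by simp)
  have hf' : ContDiffAt ℝ ∞ (fderiv ℝ f) x₀ := hf.fderiv_right (by simp)
  have h1 := (hk'.differentiableAt (by simp)).hasFDerivAt.comp x₀
    (hf.differentiableAt (by simp)).hasFDerivAt
  have h2 := h1.clm_comp (hf'.differentiableAt (by simp)).hasFDerivAt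
  refine h2.congr_of_eventuallyEq ?_
  filter_upwards [hf.eventually_differentiableAt,
    hf.continuousAt.eventually hk.eventually_differentiableAt] with x hx hx'
  exact fderiv_comp x hx' hx

theorem fderiv_fderiv_comp_congr {k : F → G} {f g : E → F} (hk : ContDiffAt ℝ ∞ k (f x₀))
    (hf : ContDiffAt ℝ ∞ f x₀) (hg : ContDiffAt ℝ ∞ g x₀) (h0 : f x₀ = g x₀)
    (h1 : fderiv ℝ f x₀ = fderiv ℝ g x₀)
    (h2 : fderiv ℝ (fderiv ℝ f) x₀ = fderiv ℝ (fderiv ℝ g) x₀) :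
    fderiv ℝ (k ∘ f) x₀ = fderiv ℝ (k ∘ g) x₀ ∧
      fderiv ℝ (fderiv ℝ (k ∘ f)) x₀ = fderiv ℝ (fderiv ℝ (k ∘ g)) x₀ := by
  have hk' := hk
  rw [h0] at hk'
  constructor
  · rw [fderiv_comp x₀ (hk.differentiableAt (by simp)) (hf.differentiableAt (by simp)),
      fderiv_comp x₀ (hk'.differentiableAt (by simp)) (hg.differentiableAt (by simp)), h0, h1]
  · rw [(hasFDerivAt_fderiv_comp hk hf).fderiv, (hasFDerivAt_fderiv_comp hk' hg).fderiv, h0, h1, h2]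

end Jets

section Uniqueness

variable {n : ℕ} {M : Type*} [TopologicalSpace M]
  [ChartedSpace (EuclideanSpace ℝ (Fin (2 * n + 1))) M]
  {M' : Type*} [TopologicalSpace M'] [ChartedSpace (EuclideanSpace ℝ (Fin (2 * n + 1))) M']
  {f g : M → M'} {U : Set M} {q₀ : M} {q₁ : M'}

theorem chartMap_eventuallyEq {q : M} (hq : q ∈ (extChartAt (Model n) q₀).source)
    (h : f =ᶠ[𝓝 q] g) :
    chartMap q₀ q₁ f =ᶠ[𝓝 (extChartAt (Model n) q₀ q)] chartMap q₀ q₁ g := by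
  have hc := continuousAt_extChartAt_symm' (I := Model n) hq
  rw [ContinuousAt, (extChartAt (Model n) q₀).left_inv hq] at hc
  filter_upwards [hc.eventually h] with x hx
  exact congrArg (extChartAt (Model n) q₁) hx

theorem frequently_chartMap_eventuallyEq (h : ∃ᶠ q in 𝓝 q₀, f =ᶠ[𝓝 q] g) :
    ∃ᶠ x in 𝓝 (extChartAt (Model n) q₀ q₀), chartMap q₀ q₁ f =ᶠ[𝓝 x] chartMap q₀ q₁ g := by
  intro hc
  refine h ?_
  filter_upwards [(continuousAt_extChartAt (I := Model n) q₀).eventually hc,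
    extChartAt_source_mem_nhds (I := Model n) q₀] with q hq hqs hfg
  exact hq (chartMap_eventuallyEq hqs hfg)

theorem eventuallyEq_of_chartMap (hf : ContinuousAt f q₀) (hg : ContinuousAt g q₀)
    (hf₁ : f q₀ = q₁) (hg₁ : g q₀ = q₁)
    (h : chartMap q₀ q₁ f =ᶠ[𝓝 (extChartAt (Model n) q₀ q₀)] chartMap q₀ q₁ g) :
    f =ᶠ[𝓝 q₀] g := by
  have hs : ∀ᶠ q in 𝓝 q₁, q ∈ (extChartAt (Model n) q₁).source :=
    extChartAt_source_mem_nhds (I := Model n) q₁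
  rw [ContinuousAt, hf₁] at hf
  rw [ContinuousAt, hg₁] at hg
  filter_upwards [(continuousAt_extChartAt (I := Model n) q₀).eventually h,
    extChartAt_source_mem_nhds (I := Model n) q₀, hf.eventually hs, hg.eventually hs] with q hq hqs h1 h2
  simp only [chartMap, Function.comp_apply, (extChartAt (Model n) q₀).left_inv hqs] at hq
  exact (extChartAt (Model n) q₁).injOn h1 h2 hq

theorem chartMap_comp_eventually_id {f : M → M'} {h : M' → M} (hf : ContinuousAt f q₀)
    (hh : ∀ᶠ q in 𝓝 q₀, h (f q) = q) :
    ∀ᶠ x in 𝓝 (extChartAt (Model n) q₀ q₀),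
      chartMap (f q₀) q₀ h (chartMap q₀ (f q₀) f x) = x := by
  filter_upwards [eventually_symm_chartMap hf, eventually_mem_target q₀,
    eventually_chart_symm hh] with x h1 h2 h3
  rw [chartMap, Function.comp_apply, Function.comp_apply, h1, h3,
    (extChartAt (Model n) q₀).right_inv h2]

variable [IsManifold (Model n) ∞ M] [IsManifold (Model n) ∞ M']
  {S : Structure n M} {S' : Structure n M'}

/-- The local inverse of a CR-diffeomorphism, in charts. -/
theorem IsCRDiffeoOn.exists_chart_inverse (hf : IsCRDiffeoOn S S' f U) (hq : q₀ ∈ U) :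
    ∃ K : Coord n → Coord n,
      ContDiffAt ℝ ∞ K (extChartAt (Model n) (f q₀) (f q₀)) ∧
      (∀ᶠ x in 𝓝 (extChartAt (Model n) q₀ q₀), K (chartMap q₀ (f q₀) f x) = x) ∧
      ∀ᶠ y in 𝓝 (extChartAt (Model n) (f q₀) (f q₀)), chartMap q₀ (f q₀) f (K y) = y := by
  obtain ⟨h, hh, hinv⟩ := hf.exists_inverse
  have hU := hf.isOpen_source.mem_nhds hq
  have hfU := hf.isOpen_image.mem_nhds (mem_image_of_mem f hq)
  have hq₀ : h (f q₀) = q₀ := hinv hq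
  have hfc := (hf.smooth.contMDiffAt hU)
  have hhc := (hh.contMDiffAt hfU)
  refine ⟨chartMap (f q₀) q₀ h, ?_, ?_, ?_⟩
  · have := contDiffAt_chartMap hhc
    rwa [hq₀] at this
  · exact chartMap_comp_eventually_id hfc.continuousAt (eventually_of_mem hU hinv)
  · have := chartMap_comp_eventually_id (n := n) (q₀ := f q₀) (f := h) (h := f) hhc.continuousAt
      (eventually_of_mem hfU (by rintro _ ⟨q, hq, rfl⟩; rw [hinv hq]))
    rwa [hq₀] at this

/-- A local CR-diffeomorphism is determined near a point by its `2`-jet there. -/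
theorem IsCRDiffeoOn.eventuallyEq_of_jet (hn : 1 ≤ n) (hS : S.LeviNondegenerateAt q₀)
    (hf : IsCRDiffeoOn S S' f U) (hg : IsCRDiffeoOn S S' g U) (hq : q₀ ∈ U) (hq₁ : g q₀ = q₁)
    (h0 : f q₀ = q₁)
    (h1 : fderiv ℝ (chartMap q₀ q₁ f) (extChartAt (Model n) q₀ q₀) =
      fderiv ℝ (chartMap q₀ q₁ g) (extChartAt (Model n) q₀ q₀))
    (h2 : fderiv ℝ (fderiv ℝ (chartMap q₀ q₁ f)) (extChartAt (Model n) q₀ q₀) =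
      fderiv ℝ (fderiv ℝ (chartMap q₀ q₁ g)) (extChartAt (Model n) q₀ q₀)) :
    f =ᶠ[𝓝 q₀] g := by
  have : Nonempty (Fin (2 * n)) := ⟨⟨0, by omega⟩⟩
  have hU := hf.isOpen_source.mem_nhds hq
  have hfc := hf.smooth.contMDiffAt hU
  have hgc := hg.smooth.contMDiffAt hU
  have hF := contDiffAt_chartMap (n := n) hfc
  have hG := contDiffAt_chartMap (n := n) hgc
  have hF0 := chartMap_self (n := n) f q₀
  have hG0 := chartMap_self (n := n) g q₀
  have hFJ := hf.eventually_chartJ_iff hq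
  have hGJ := hg.eventually_chartJ_iff hq
  obtain ⟨K, hK, hKG, hGK⟩ := hg.exists_chart_inverse hq
  rw [hq₁] at hG hG0 hGJ hK hKG hGK
  rw [h0] at hF hF0 hFJ
  refine eventuallyEq_of_chartMap (n := n) hfc.continuousAt hgc.continuousAt h0 hq₁ ?_
  set F := chartMap (n := n) q₀ q₁ f
  set G := chartMap (n := n) q₀ q₁ g
  set x₀ : Coord n := extChartAt (Model n) q₀ q₀
  have hKF : ContDiffAt ℝ ∞ K (F x₀) := hF0 ▸ hK
  -- The derivatives of K ∘ F up to order two at x₀ are those of K ∘ G, which is the identity near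
  -- x₀.
  obtain ⟨h3, h4⟩ := fderiv_fderiv_comp_congr hKF hF hG (hF0.trans hG0.symm) h1 h2
  have hKG' : K ∘ G =ᶠ[𝓝 x₀] id := hKG
  rw [hKG'.fderiv_eq, fderiv_id] at h3
  rw [hKG'.fderiv.fderiv_eq, show fderiv ℝ (id : Coord n → Coord n) = fun _ =>
    ContinuousLinearMap.id ℝ (Coord n) from funext fun _ => fderiv_id, fderiv_fun_const] at h4
  have hφ : ContDiffAt ℝ ∞ (K ∘ F) x₀ := hKF.comp x₀ hF
  have hφ0 : (K ∘ F) x₀ = x₀ := by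
    rw [Function.comp_apply, hF0, ← hG0]
    exact hKG.self_of_nhds
  have hφt : Tendsto (K ∘ F) (𝓝 x₀) (𝓝 x₀) := by
    have := hφ.continuousAt
    rwa [ContinuousAt, hφ0] at this
  have hFt : Tendsto F (𝓝 x₀) (𝓝 (extChartAt (Model n) q₁ q₁)) := by
    have := hF.continuousAt
    rwa [ContinuousAt, hF0] at this
  have hGφ : ∀ᶠ x in 𝓝 x₀, G (K (F x)) = F x := hFt.eventually hGK
  obtain ⟨W, hW, hqW, e, he⟩ := S.exists_frame q₀
  obtain ⟨t, ht⟩ := exists_isInvertible_fullFrame q₀ e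
  have hes := contDiffAt_chartFrame hW hqW fun j => (he j).1
  have hinv := eventually_isInvertible_frameMap (contDiffAt_fullFrame hes t) ht
  have hmem := eventually_mem_target (n := n) q₀
  -- F carries the structure to `M'`, and the equivalence for G at the point φ(x) brings it back,
  -- since G ∘ φ = F.
  have hφJ : ∀ᶠ x in 𝓝 x₀, ∀ v w, S.ChartJ q₀ x v w →
      S.ChartJ q₀ (K (F x)) (fderiv ℝ (K ∘ F) x v) (fderiv ℝ (K ∘ F) x w) := by
    filter_upwards [hFJ, hφt.eventually hGJ, hGφ.eventually_nhds, hGφ,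
      hφ.eventually_differentiableAt, hφt.eventually hG.eventually_differentiableAt]
      with x hx1 hx2 hx3 hx4 hx5 hx6 v w hvw
    have hx7 : G ∘ (K ∘ F) =ᶠ[𝓝 x] F := hx3
    have hx8 := hx7.fderiv_eq (𝕜 := ℝ)
    rw [fderiv_comp x hx6 hx5] at hx8
    have hx9 := (hx1 v w).2 hvw
    rw [← hx8, ← hx4] at hx9
    exact (hx2 _ _).1 hx9
  have hframe : ∀ᶠ x in 𝓝 x₀, ∀ i, S.ChartJ q₀ x (chartFrame q₀ e i x) (chartJFrame q₀ e i x) := by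
    filter_upwards [hmem] with x hx i
    exact Structure.ChartJ.of_field hx fun q => e q i
  have hid : ∀ᶠ x in 𝓝 x₀, (K ∘ F) x = x := by
    refine eventually_eq_id_of_jet (e := chartFrame q₀ e) (je := chartJFrame q₀ e) (t := t) hes
      (fun i => contDiffAt_chartField hW hqW (he i).2) ht (fun i => ?_) (fun c d hcd => ?_)
      (fun c => hS.eq_zero_of_leviTwoForm hW hqW (fun j => (he j).1) (fun j => (he j).2) ht c)
      hφ hφ0 h3 h4 (fun i => ?_) (fun i => ?_)
    · filter_upwards [hmem, hframe, hinv] with x hx1 hx2 hx3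
      obtain ⟨c, hc⟩ := (hx2 i).symm_neg.exists_eq_frameMap hx1 e
      rw [hc]
      exact contactForm_frameMap hx3 c
    · have hx := hmem.self_of_nhds
      have j1 := (chartJ_frameMap (e := e) hx c).symm_neg
      rw [hcd] at j1
      exact (chartJ_frameMap (e := e) hx d).unique hx j1
    · filter_upwards [hφt.eventually hmem, hframe, hφt.eventually hinv, hφJ] with x hx1 hx2 hx3 hx4
      obtain ⟨c, hc⟩ := (hx4 _ _ (hx2 i)).exists_eq_frameMap hx1 e
      rw [hc]
      exact contactForm_frameMap hx3 c
    · filter_upwards [hφt.eventually hmem, hframe, hφJ] with x hx1 hx2 hx4 c hc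
      have j1 := hx4 _ _ (hx2 i)
      rw [hc] at j1
      exact j1.unique hx1 (chartJ_frameMap (e := e) hx1 c)
  filter_upwards [hid, hGφ] with x hx1 hx2
  rw [← hx2]
  exact congrArg G hx1

theorem IsCRDiffeoOn.eventuallyEq_of_sameJet (hn : 1 ≤ n) (hS : S.LeviNondegenerateAt q₀)
    (hf : IsCRDiffeoOn S S' f U) (hg : IsCRDiffeoOn S S' g U) (hq : q₀ ∈ U)
    (h : SameJet n 2 f g q₀) : f =ᶠ[𝓝 q₀] g := by
  obtain ⟨h0, hj⟩ := h
  have hj1 := hj 1 (by norm_num)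
  have hj2 := hj 2 le_rfl
  change iteratedFDeriv ℝ 1 (chartMap q₀ (f q₀) f) _ =
    iteratedFDeriv ℝ 1 (chartMap q₀ (g q₀) g) _ at hj1
  change iteratedFDeriv ℝ 2 (chartMap q₀ (f q₀) f) _ =
    iteratedFDeriv ℝ 2 (chartMap q₀ (g q₀) g) _ at hj2
  rw [h0] at hj1 hj2
  refine hf.eventuallyEq_of_jet hn hS hg hq rfl h0 ?_ ?_
  · ext1 v
    have := congrArg (fun L => L fun _ => v) hj1
    simpa only [iteratedFDeriv_one_apply] using this
  · ext1 v
    ext1 w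
    have := congrArg (fun L => L ![v, w]) hj2
    simpa only [iteratedFDeriv_two_apply, Matrix.cons_val_zero, Matrix.cons_val_one] using this

/-- Closedness of the set of local coincidence: values and the first two derivatives in charts are
continuous, so they agree at a limit point, and the jet criterion applies there. Separation of `M'`
is needed for the values. -/
theorem IsCRDiffeoOn.eventuallyEq_of_frequently [T2Space M'] (hn : 1 ≤ n)
    (hS : S.LeviNondegenerateAt q₀)
    (hf : IsCRDiffeoOn S S' f U) (hg : IsCRDiffeoOn S S' g U) (hq : q₀ ∈ U)
    (h : ∃ᶠ q in 𝓝 q₀, f =ᶠ[𝓝 q] g) : f =ᶠ[𝓝 q₀] g := by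
  have hU := hf.isOpen_source.mem_nhds hq
  have hfc := hf.smooth.contMDiffAt hU
  have hgc := hg.smooth.contMDiffAt hU
  have h0 : f q₀ = g q₀ := eq_of_frequently_eq hfc.continuousAt hgc.continuousAt
    (h.mono fun q hq => hq.self_of_nhds)
  have hF := contDiffAt_chartMap (n := n) hfc
  have hG := contDiffAt_chartMap (n := n) hgc
  rw [h0] at hF
  have hF1 : ContDiffAt ℝ ∞ (fderiv ℝ (chartMap q₀ (g q₀) f)) _ := hF.fderiv_right (by simp)
  have hG1 : ContDiffAt ℝ ∞ (fderiv ℝ (chartMap q₀ (g q₀) g)) _ := hG.fderiv_right (by simp)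
  have hF2 : ContDiffAt ℝ ∞ (fderiv ℝ (fderiv ℝ (chartMap q₀ (g q₀) f))) _ :=
    hF1.fderiv_right (by simp)
  have hG2 : ContDiffAt ℝ ∞ (fderiv ℝ (fderiv ℝ (chartMap q₀ (g q₀) g))) _ :=
    hG1.fderiv_right (by simp)
  have hx := frequently_chartMap_eventuallyEq (n := n) (q₁ := g q₀) h
  exact hf.eventuallyEq_of_jet hn hS hg hq rfl h0
    (eq_of_frequently_eq hF1.continuousAt hG1.continuousAt
      (hx.mono fun x hx => hx.fderiv_eq))
    (eq_of_frequently_eq hF2.continuousAt hG2.continuousAt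
      (hx.mono fun x hx => hx.fderiv.fderiv_eq))

end Uniqueness

end AlmostCR

/-- On strongly nondegenerate almost CR manifolds of hypersurface type of the same dimension,
CR-diffeomorphisms on a connected open set are determined by their `2`-jet at one point. -/
theorem corollary2p2 (n : ℕ) (hn : 1 ≤ n)
    (M : Type*) [TopologicalSpace M] [T2Space M]
    [ChartedSpace (EuclideanSpace ℝ (Fin (2 * n + 1))) M]
    [IsManifold (AlmostCR.Model n) ∞ M]
    (M' : Type*) [TopologicalSpace M'] [T2Space M']
    [ChartedSpace (EuclideanSpace ℝ (Fin (2 * n + 1))) M']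
    [IsManifold (AlmostCR.Model n) ∞ M']
    (S : AlmostCR.Structure n M) (hS : S.StronglyNondegenerate)
    (S' : AlmostCR.Structure n M') (hS' : S'.StronglyNondegenerate)
    (U : Set M) (hU : IsConnected U)
    (f g : M → M')
    (hf : AlmostCR.IsCRDiffeoOn S S' f U) (hg : AlmostCR.IsCRDiffeoOn S S' g U)
    (p : M) (hp : p ∈ U) (hjet : AlmostCR.SameJet n 2 f g p) :
    Set.EqOn f g U := by
  -- An open set that meets the connected set U and contains its own limit points in U contains U.
  have hsub : U ⊆ {q | f =ᶠ[nhds q] g} :=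
    hU.isPreconnected.subset_of_closure_inter_subset isOpen_setOfPred_eventually_nhds
      ⟨p, hp, hf.eventuallyEq_of_sameJet hn (hS p).1 hg hp hjet⟩
      fun q hq => hf.eventuallyEq_of_frequently hn (hS q).1 hg hq.2
        (mem_closure_iff_frequently.1 hq.1)
  exact fun q hq => (hsub hq).self_of_nhds
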